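/- **Setting.** Let $A\in\mathbb C^{N\times M}$ be a non-zero matrix with columns $\boldsymbol a_1,\dots,\boldsymbol a_M$, let $\boldsymbol b\in\mathbb C^N$, and let $n=\lceil\log_2 N\rceil$. Vectors in $\mathbb C^N$ are identified with vectors of amplitudes on $n$ qubits (padded by zeros if $N$ is not a power of two). A quantum circuit is a sequence of layers of one- and two-qubit unitary gates, the gates of one layer acting on disjoint qubits; its depth is the number of layers. Assume quantum access to $A$ and $\boldsymbol b$: numbers $\|\boldsymbol a_j\|\ge 0$, $\|\boldsymbol b\|>0$ and circuits for unitaries $U_1,\dots,U_M,U_{\boldsymbol b}$ of depth at most $d$ are given such that $\boldsymbol a_j=\|\boldsymbol a_j\|\,U_j|0^n\rangle$ and $\boldsymbol b=\|\boldsymbol b\|\,U_{\boldsymbol b}|0^n\rangle$. Write $|a_j\rangle=U_j|0^n\rangle$, $|b\rangle=U_{\boldsymbol b}|0^n\rangle$. $\|A\|$ is the spectral norm, $A^{-1}$ the Moore–Penrose pseudo-inverse, $\kappa(A)=\|A\|\|A^{-1}\|$, $\boldsymbol x^*=A^{-1}\boldsymbol b$, and $\Gamma_1=\max_j\max(\|\boldsymbol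 a_j\|\|\boldsymbol b\|,\|\boldsymbol a_j\|^2)$. The Hadamard test of $\{|0^n\rangle,U\}$ applies, on $n+1$ qubits, a Hadamard gate on an ancilla, $U$ controlled by the ancilla, a phase gate ($\mathrm{id}$ or $\mathrm{diag}(1,-i)$) and a Hadamard gate on the ancilla, and then measures the ancilla; the outcome is $0$ with probability $(1+\mathrm{Re}\langle 0|U|0\rangle)/2$, respectively $(1+\mathrm{Im}\langle 0|U|0\rangle)/2$. **Algorithm 1** (input: the quantum access data, $\varepsilon>0$, the numbers $\|A\|,\|A^{-1}\|,\|\boldsymbol x^*\|$, and a factor $\rho>0$). 1. Compute $\Gamma_1$, $\;\lambda=\dfrac{\varepsilon}{2\|A\|^2\|A^{-1}\|^4\|\boldsymbol b\|}$, $\;T=\rho\,\dfrac{M\|A^{-1}\|^4\kappa(A)^4\|\boldsymbol b\|^2(\|A\|(\|\boldsymbol x^*\|+1)+\varepsilon)^2}{\varepsilon^4}$ and $S=\lceil\Gamma_1^2T\rceil$. 2. For all $j,k\in[M]$, estimate $\langle a_j|a_k\rangle$ by $v_{jk}$, repeating the Hadamard tests of $\{|0^n\rangle,U_j^\dagger U_k\}$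 for the real and for the imaginary part independently $S$ times each and averaging; put $\hat W_{jk}=\|\boldsymbol a_j\|\|\boldsymbol a_k\|v_{jk}+\lambda\,\delta_{jk}$. 3. For all $j\in[M]$, estimate $\langle a_j|b\rangle$ by $\hat u_j$ in the same way with $\{|0^n\rangle,U_j^\dagger U_{\boldsymbol b}\}$; put $\hat q_j=\|\boldsymbol a_j\|\|\boldsymbol b\|\hat u_j$. 4. Compute $\hat{\boldsymbol x}=\hat W^{-1}\hat{\boldsymbol q}$ with a classical algorithm that solves every invertible $M\times M$ system and always stops after $O(M^3+1)$ steps, and return $\hat{\boldsymbol x}$. Time is the number of steps of a hybrid random access machine: arithmetic operations and comparisons of complex numbers (in exact arithmetic) and index operations cost one step each, rounding a real number up to a natural number $k$ costs $k+1$ steps, and running a quantum circuit costs as many steps as it has one- and two-qubit gates, plus one for the measurement. **Theorem.** The following holds for a suitable classical program for step 4, for a suitable implementation of the Hadamard tests by circuits of one- and two-qubit gates, of size linear in the sizes of the two given circuits, and for suitable universal constants $c,C>0$. Let $0<\delta<1$ and $\rho=c\log(2/\delta)$. Then for all $N,M$, $A\neq0$, $\boldsymbol b$, $d$ and $\varepsilon>0$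 as above: 1. With probability at least $1-\delta$, the output $\hat{\boldsymbol x}$ of Algorithm 1 satisfies $$\|A\hat{\boldsymbol x}-\boldsymbol b\|-\min_{\boldsymbol x\in\mathbb C^M}\|A\boldsymbol x-\boldsymbol b\|\le\varepsilon .$$ 2. With $$B=\frac{\Gamma_1^2M^3\|A^{-1}\|^4\kappa(A)^4\|\boldsymbol b\|^2\bigl(\|A\|(\|\boldsymbol x^*\|+1)+\varepsilon\bigr)^2}{\varepsilon^4},$$ every run of Algorithm 1 takes time at most $C\log(2/\delta)\,(1+d\lceil\log_2N\rceil)\,(B+M^3)$. If $B\ge M^3$, it takes time at most $C\log(2/\delta)\,(1+d\lceil\log_2N\rceil)\,B$. In particular, if $d=\mathrm{polylog}\,N$ and $B\ge M^3$, then the running time is $\tilde O(B)$, where $\tilde O$ hides factors $\mathrm{polylog}\,N$ and $\log(1/\delta)$. -/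

import Mathlib

open scoped Matrix.Norms.L2Operator

noncomputable section

namespace HybridLS

/-! ### Linear algebra -/

/-- The Moore-Penrose pseudo-inverse `A⁺ = (Aᴴ A)⁺ Aᴴ`. The pseudo-inverse of the Hermitian matrix
`Aᴴ A` is obtained from its spectral decomposition by inverting the non-zero eigenvalues
(recall `0⁻¹ = 0`). -/
def pinv {N M : ℕ} (A : Matrix (Fin N) (Fin M) ℂ) : Matrix (Fin M) (Fin N) ℂ :=
  let hA := Matrix.isHermitian_conjTranspose_mul_self A
  (hA.eigenvectorUnitary : Matrix (Fin M) (Fin M) ℂ) *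
    Matrix.diagonal (fun i => ((hA.eigenvalues i)⁻¹ : ℂ)) *
    (hA.eigenvectorUnitary : Matrix (Fin M) (Fin M) ℂ).conjTranspose * A.conjTranspose

/-- The condition number `κ(A) = ‖A‖ ‖A⁺‖` (spectral norms): the ratio of the largest to the
smallest non-zero singular value. -/
def condNumber {N M : ℕ} (A : Matrix (Fin N) (Fin M) ℂ) : ℝ := ‖A‖ * ‖pinv A‖

/-- The minimum-norm least-squares solution `x* = A⁺ b`. -/
def optSol {N M : ℕ} (A : Matrix (Fin N) (Fin M) ℂ) (b : EuclideanSpace ℂ (Fin N)) :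
    EuclideanSpace ℂ (Fin M) := Matrix.toEuclideanLin (pinv A) b

/-- The `j`-th column of `A`. -/
def column {N M : ℕ} (A : Matrix (Fin N) (Fin M) ℂ) (j : Fin M) : EuclideanSpace ℂ (Fin N) :=
  WithLp.toLp 2 fun i => A i j

/-- `Γ₁ = max_j max(‖a_j‖ ‖b‖, ‖a_j‖²)`. -/
def Gamma1 {N M : ℕ} (A : Matrix (Fin N) (Fin M) ℂ) (b : EuclideanSpace ℂ (Fin N)) : ℝ :=
  ⨆ j : Fin M, max (‖column A j‖ * ‖b‖) (‖column A j‖ ^ 2)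

/-- `Γ₁² M³ ‖A⁺‖⁴ κ(A)⁴ ‖b‖² (‖A‖ (‖x*‖ + 1) + ε)² / ε⁴`. -/
def timeTerm {N M : ℕ} (A : Matrix (Fin N) (Fin M) ℂ) (b : EuclideanSpace ℂ (Fin N))
    (ε : ℝ) : ℝ :=
  Gamma1 A b ^ 2 * (M : ℝ) ^ 3 * ‖pinv A‖ ^ 4 * condNumber A ^ 4 * ‖b‖ ^ 2 *
    (‖A‖ * (‖optSol A b‖ + 1) + ε) ^ 2 / ε ^ 4

/-- `x` solves `min_y ‖A y - b‖` up to additive error `ε`. -/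
def IsApproxSolution {N M : ℕ} (A : Matrix (Fin N) (Fin M) ℂ) (b : EuclideanSpace ℂ (Fin N))
    (ε : ℝ) (x : EuclideanSpace ℂ (Fin M)) : Prop :=
  ‖Matrix.toEuclideanLin A x - b‖ -
    (⨅ y : EuclideanSpace ℂ (Fin M), ‖Matrix.toEuclideanLin A y - b‖) ≤ ε

/-! ### Quantum circuits -/

/-- The computational basis of `n` qubits. -/
abbrev Basis (n : ℕ) : Type := Fin n → Fin 2

/-- An elementary gate: a unitary on one or two of the `n` qubits. -/
structure Gate (n : ℕ) where
  wires : Finset (Fin n)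
  nonempty : wires.Nonempty
  card_le : wires.card ≤ 2
  u : Matrix.unitaryGroup (wires → Fin 2) ℂ

/-- The matrix of a gate on all `n` qubits: the identity on the qubits it does not touch. -/
def Gate.mat {n : ℕ} (g : Gate n) : Matrix (Basis n) (Basis n) ℂ :=
  Matrix.of fun x y =>
    if ∀ q, q ∉ g.wires → x q = y q then
      (g.u : Matrix (g.wires → Fin 2) (g.wires → Fin 2) ℂ) (fun q => x q) (fun q => y q)
    else 0

theorem Gate.mat_mem {n : ℕ} (g : Gate n) : g.mat ∈ Matrix.unitaryGroup (Basis n) ℂ := by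
  have key : g.mat = ((g.u : Matrix (g.wires → Fin 2) (g.wires → Fin 2) ℂ).kronecker
      (1 : Matrix ({q // q ∉ g.wires} → Fin 2) ({q // q ∉ g.wires} → Fin 2) ℂ)).submatrix
      (Equiv.piEquivPiSubtypeProd (fun q => q ∈ g.wires) fun _ => Fin 2)
      (Equiv.piEquivPiSubtypeProd (fun q => q ∈ g.wires) fun _ => Fin 2) := by
    ext x y
    simp only [Gate.mat, Matrix.of_apply, Matrix.submatrix_apply, Matrix.kronecker,
      Matrix.kroneckerMap_apply, Equiv.piEquivPiSubtypeProd_apply, Matrix.one_apply, mul_ite,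
      mul_one, mul_zero, funext_iff, Subtype.forall]
  rw [key, Matrix.mem_unitaryGroup_iff, Matrix.star_eq_conjTranspose, Matrix.conjTranspose_submatrix,
    Matrix.submatrix_mul_equiv, ← Matrix.star_eq_conjTranspose]
  have h := Matrix.mem_unitaryGroup_iff.1 (Matrix.kronecker_mem_unitary g.u.2
    (one_mem (Matrix.unitaryGroup ({q // q ∉ g.wires} → Fin 2) ℂ)))
  rw [Matrix.kronecker, h, Matrix.submatrix_one_equiv]

/-- A circuit is a list of layers; the gates of one layer act on disjoint sets of qubits. -/
structure Circuit (n : ℕ) where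
  layers : List (List (Gate n))
  disj : ∀ l ∈ layers, l.Pairwise fun g h => Disjoint g.wires h.wires

/-- The depth: the number of layers. -/
def Circuit.depth {n : ℕ} (c : Circuit n) : ℕ := c.layers.length

/-- The gates in the order in which they are applied. -/
def Circuit.gates {n : ℕ} (c : Circuit n) : List (Gate n) := c.layers.flatten

/-- The size: the number of gates. -/
def Circuit.size {n : ℕ} (c : Circuit n) : ℕ := c.gates.length

/-- The unitary of a circuit (the first gate is the rightmost factor). -/
def Circuit.unitary {n : ℕ} (c : Circuit n) : Matrix.unitaryGroup (Basis n) ℂ :=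
  (c.gates.map fun g => (⟨g.mat, g.mat_mem⟩ : Matrix.unitaryGroup (Basis n) ℂ)).reverse.prod

/-- The matrix of a circuit. -/
def Circuit.mat {n : ℕ} (c : Circuit n) : Matrix (Basis n) (Basis n) ℂ := c.unitary

/-- The amplitudes of the state `U |0…0⟩` prepared by a circuit. -/
def Circuit.state {n : ℕ} (c : Circuit n) (x : Basis n) : ℂ := c.mat x 0

theorem Circuit.sum_state {n : ℕ} (c : Circuit n) :
    ∑ x, ENNReal.ofReal (‖c.state x‖ ^ 2) = 1 := by
  rw [← ENNReal.ofReal_sum_of_nonneg (fun _ _ => by positivity)]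
  have h := congrFun (congrFun (Matrix.mem_unitaryGroup_iff'.1 c.unitary.2) 0) 0
  rw [Matrix.mul_apply, Matrix.one_apply_eq] at h
  have h2 : ((∑ x, ‖c.state x‖ ^ 2 : ℝ) : ℂ) = 1 := by
    rw [← h]
    push_cast
    refine Finset.sum_congr rfl fun x _ => ?_
    rw [Matrix.star_apply]
    exact (Complex.conj_mul' _).symm
  rw [show (∑ x, ‖c.state x‖ ^ 2 : ℝ) = 1 by exact_mod_cast h2, ENNReal.ofReal_one]

/-- Run the circuit on `|0…0⟩` and measure qubit `q` in the computational basis (Born rule). -/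
def Circuit.measure {n : ℕ} (c : Circuit n) (q : Fin n) : PMF (Fin 2) :=
  (PMF.ofFintype (fun x : Basis n => ENNReal.ofReal (‖c.state x‖ ^ 2)) c.sum_state).map fun x => x q

/-! ### The Hadamard test -/

/-- A single-qubit matrix acting on qubit `0` of `n + 1` qubits. -/
def onAncilla {n : ℕ} (g : Matrix (Fin 2) (Fin 2) ℂ) :
    Matrix (Basis (n + 1)) (Basis (n + 1)) ℂ :=
  Matrix.of fun x y => if Fin.tail x = Fin.tail y then g (x 0) (y 0) else 0

/-- `U` on qubits `1, …, n`, controlled by qubit `0`. -/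
def controlled {n : ℕ} (U : Matrix (Basis n) (Basis n) ℂ) :
    Matrix (Basis (n + 1)) (Basis (n + 1)) ℂ :=
  Matrix.of fun x y =>
    if x 0 = y 0 then
      (if x 0 = 1 then U else 1 : Matrix (Basis n) (Basis n) ℂ) (Fin.tail x) (Fin.tail y)
    else 0

/-- The Hadamard gate. -/
def hadamardGate : Matrix (Fin 2) (Fin 2) ℂ :=
  ((Real.sqrt 2 : ℝ) : ℂ)⁻¹ • !![1, 1; 1, -1]

/-- The parts of an amplitude that a Hadamard test can estimate. -/
inductive Part
  | re
  | im

/-- The phase gate of the test: trivial for the real part, `diag(1, -i)` for the imaginary part. -/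
def phaseGate : Part → Matrix (Fin 2) (Fin 2) ℂ
  | Part.re => 1
  | Part.im => !![1, 0; 0, -Complex.I]

/-- The unitary of the Hadamard test of `{|0⟩, U}`. Measuring qubit `0` after it has been applied to
`|0…0⟩` yields `0` with probability `(1 + Re ⟨0|U|0⟩) / 2`, respectively
`(1 + Im ⟨0|U|0⟩) / 2`. -/
def hadamardTest {n : ℕ} (p : Part) (U : Matrix (Basis n) (Basis n) ℂ) :
    Matrix (Basis (n + 1)) (Basis (n + 1)) ℂ :=
  onAncilla hadamardGate * onAncilla (phaseGate p) * controlled U * onAncilla hadamardGate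

/-- A rule that turns two circuits for `U₁`, `U₂` into a circuit of one- and two-qubit gates for the
Hadamard test of `{|0⟩, U₁ᴴ U₂}`, with linear overhead. -/
def IsHadamardCompiler (comp : ∀ n : ℕ, Circuit n → Circuit n → Part → Circuit (n + 1))
    (C : ℝ) : Prop :=
  ∀ (n : ℕ) (c₁ c₂ : Circuit n) (p : Part),
    (comp n c₁ c₂ p).mat = hadamardTest p (c₁.mat.conjTranspose * c₂.mat) ∧
      ((comp n c₁ c₂ p).size : ℝ) ≤ C * (c₁.size + c₂.size + 1)

/-! ### Quantum access to the input -/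

/-- A vector of length `N`, padded by zeros to a vector of amplitudes on `⌈log₂ N⌉` qubits. -/
def pad {N : ℕ} (v : Fin N → ℂ) (x : Basis (Nat.clog 2 N)) : ℂ :=
  if h : (finFunctionFinEquiv x : ℕ) < N then v ⟨finFunctionFinEquiv x, h⟩ else 0

/-- Quantum access to a matrix: column `j` is `nrm j • U_j |0…0⟩`, where `nrm j ≥ 0` is known
and `U_j` is given by a circuit of depth at most `d`. -/
structure ColumnAccess {N M : ℕ} (A : Matrix (Fin N) (Fin M) ℂ) (nrm : Fin M → ℝ)
    (U : Fin M → Circuit (Nat.clog 2 N)) (d : ℕ) : Prop where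
  nonneg : ∀ j, 0 ≤ nrm j
  column_eq : ∀ j x, pad (fun i => A i j) x = nrm j * (U j).state x
  depth_le : ∀ j, (U j).depth ≤ d

/-- Quantum access to a vector: `b = nrm • U_b |0…0⟩`, where `nrm > 0` is known and `U_b` is given
by a circuit of depth at most `d`. -/
structure VectorAccess {N : ℕ} (b : EuclideanSpace ℂ (Fin N)) (nrm : ℝ)
    (U : Circuit (Nat.clog 2 N)) (d : ℕ) : Prop where
  pos : 0 < nrm
  vector_eq : ∀ x, pad (fun i => b i) x = nrm * U.state x
  depth_le : U.depth ≤ d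

/-! ### A hybrid random access machine

Programs with natural-number registers, two-dimensional arrays of complex numbers (exact arithmetic
at unit cost), counted loops, comparisons of real parts, and an instruction that runs a quantum
circuit and stores the measured bit. -/

/-- The memory: natural-number registers, and complex arrays `arr name row column`. -/
structure Mem where
  nat : ℕ → ℕ
  arr : ℕ → ℕ → ℕ → ℂ

/-- Write a natural-number register. -/
def Mem.setNat (m : Mem) (r v : ℕ) : Mem := { m with nat := Function.update m.nat r v }

/-- Write an array cell. -/
def Mem.setArr (m : Mem) (a i j : ℕ) (z : ℂ) : Mem :=
  { m with arr := fun a' i' j' => if a' = a ∧ i' = i ∧ j' = j then z else m.arr a' i' j' }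

/-- Index expressions. -/
inductive NExpr
  | lit (k : ℕ)
  | reg (r : ℕ)
  | add (e f : NExpr)
  | sub (e f : NExpr)

/-- The value of an index expression (subtraction is truncated). -/
def NExpr.eval (m : Mem) : NExpr → ℕ
  | lit k => k
  | reg r => m.nat r
  | add e f => e.eval m + f.eval m
  | sub e f => e.eval m - f.eval m

/-- The cost of evaluating an index expression: its number of nodes. -/
def NExpr.cost : NExpr → ℕ
  | lit _ => 1
  | reg _ => 1
  | add e f => e.cost + f.cost + 1
  | sub e f => e.cost + f.cost + 1

/-- Arithmetic expressions over the complex numbers. -/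
inductive CExpr
  | int (k : ℤ)
  | imag
  | cast (e : NExpr)
  | get (a : ℕ) (i j : NExpr)
  | add (e f : CExpr)
  | sub (e f : CExpr)
  | mul (e f : CExpr)
  | div (e f : CExpr)
  | conj (e : CExpr)

/-- The value of an arithmetic expression (with `z / 0 = 0`). -/
def CExpr.eval (m : Mem) : CExpr → ℂ
  | int k => k
  | imag => Complex.I
  | cast e => (e.eval m : ℂ)
  | get a i j => m.arr a (i.eval m) (j.eval m)
  | add e f => e.eval m + f.eval m
  | sub e f => e.eval m - f.eval m
  | mul e f => e.eval m * f.eval m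
  | div e f => e.eval m / f.eval m
  | conj e => (starRingEnd ℂ) (e.eval m)

/-- The cost of evaluating an arithmetic expression: its number of nodes. -/
def CExpr.cost : CExpr → ℕ
  | int _ => 1
  | imag => 1
  | cast e => e.cost + 1
  | get _ i j => i.cost + j.cost + 1
  | add e f => e.cost + f.cost + 1
  | sub e f => e.cost + f.cost + 1
  | mul e f => e.cost + f.cost + 1
  | div e f => e.cost + f.cost + 1
  | conj e => e.cost + 1

/-- Programs. -/
inductive Cmd
  /-- do nothing -/
  | skip
  /-- first `c`, then `d` -/
  | seq (c d : Cmd)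
  /-- natural-number register `r := e` -/
  | setNat (r : ℕ) (e : NExpr)
  /-- array cell `a[i, j] := e` -/
  | setArr (a : ℕ) (i j : NExpr) (e : CExpr)
  /-- register `r := ⌈Re e⌉`, computed by counting -/
  | ceil (r : ℕ) (e : CExpr)
  /-- if `Re e ≤ Re f` then `c` else `d` -/
  | ite (e f : CExpr) (c d : Cmd)
  /-- for `r = 0, …, e - 1` do `c` (`e` is evaluated once, at the start) -/
  | loop (r : ℕ) (e : NExpr) (c : Cmd)
  /-- cell `a[i, j] :=` the bit measured in one run of the Hadamard test number `(e, f, p)` -/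
  | test (a : ℕ) (i j : NExpr) (e f : NExpr) (p : Part)

/-- A program is classical if it runs no quantum circuit. -/
def Cmd.Classical : Cmd → Prop
  | skip => True
  | seq c d => c.Classical ∧ d.Classical
  | setNat _ _ => True
  | setArr _ _ _ _ => True
  | ceil _ _ => True
  | ite _ _ c d => c.Classical ∧ d.Classical
  | loop _ _ c => c.Classical
  | test _ _ _ _ _ _ => False

/-- Iterate a randomized step with a step count; every round costs one more step. -/
def iterate (f : ℕ → Mem → PMF (Mem × ℕ)) : ℕ → Mem → PMF (Mem × ℕ)
  | 0, m => PMF.pure (m, 1)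
  | k + 1, m => (iterate f k m).bind fun r =>
      (f k r.1).map fun s => (s.1, r.2 + s.2 + 1)

/-- The joint distribution of the final memory and the number of steps, where `circ e f p` is the
circuit of the Hadamard test number `(e, f, p)`. Running a circuit costs as many steps as it
has gates, and one more for the measurement of qubit `0`. -/
def run {n : ℕ} (circ : ℕ → ℕ → Part → Circuit (n + 1)) : Cmd → Mem → PMF (Mem × ℕ)
  | .skip, m => PMF.pure (m, 1)
  | .seq c d, m => (run circ c m).bind fun r =>
      (run circ d r.1).map fun s => (s.1, r.2 + s.2)
  | .setNat r e, m => PMF.pure (m.setNat r (e.eval m), e.cost + 1)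
  | .setArr a i j e, m =>
      PMF.pure (m.setArr a (i.eval m) (j.eval m) (e.eval m), i.cost + j.cost + e.cost + 1)
  | .ceil r e, m => PMF.pure (m.setNat r ⌈(e.eval m).re⌉₊, ⌈(e.eval m).re⌉₊ + e.cost + 1)
  | .ite e f c d, m =>
      (if (e.eval m).re ≤ (f.eval m).re then run circ c m else run circ d m).map fun s =>
        (s.1, s.2 + e.cost + f.cost + 1)
  | .loop r e c, m =>
      (iterate (fun i m' => run circ c (m'.setNat r i)) (e.eval m) m).map fun s =>
        (s.1, s.2 + e.cost)
  | .test a i j e f p, m =>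
      ((circ (e.eval m) (f.eval m) p).measure 0).map fun z =>
        (m.setArr a (i.eval m) (j.eval m) ((z : ℕ) : ℂ),
          (circ (e.eval m) (f.eval m) p).size + 1 + i.cost + j.cost + e.cost + f.cost + 1)

/-! ### The algorithm -/

/-! Natural-number registers. All others are scratch registers. -/

/-- `M` -/
abbrev rM : ℕ := 0
/-- number of repetitions of each Hadamard test -/
abbrev rS : ℕ := 1
/-- row index -/
abbrev rJ : ℕ := 2
/-- column index -/
abbrev rK : ℕ := 3
/-- repetition index -/
abbrev rT : ℕ := 4

/-! Arrays. All others are scratch arrays. A scalar is kept in cell `[0, 0]`. -/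

/-- input: cell `[j, 0]` holds `‖a_j‖` for `j < M`, cell `[M, 0]` holds `‖b‖` -/
abbrev aNrm : ℕ := 0
/-- input: `‖A‖` -/
abbrev aA : ℕ := 1
/-- input: `‖A⁺‖` -/
abbrev aAinv : ℕ := 2
/-- input: `‖x*‖` -/
abbrev aXs : ℕ := 3
/-- input: `ε` -/
abbrev aEps : ℕ := 4
/-- input: the factor hidden in the `O(·)` of the number of repetitions -/
abbrev aRho : ℕ := 5
/-- `Γ₁` -/
abbrev aGam : ℕ := 6
/-- the shift `λ` -/
abbrev aLam : ℕ := 7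
/-- accumulator for the estimates -/
abbrev aAcc : ℕ := 8
/-- the last measured bit -/
abbrev aBit : ℕ := 9
/-- the shifted estimated matrix `Ŵ` -/
abbrev aW : ℕ := 10
/-- the estimated right-hand side `q̂` -/
abbrev aQ : ℕ := 11
/-- output: cell `[j, 0]` holds `x̂_j` -/
abbrev aX : ℕ := 12

/-- Read a scalar. -/
def sc (a : ℕ) : CExpr := .get a (.lit 0) (.lit 0)

/-- Write a scalar. -/
def setSc (a : ℕ) (e : CExpr) : Cmd := .setArr a (.lit 0) (.lit 0) e

/-- Read the norm of the vector number `e` (column `a_e` if `e < M`, and `b` if `e = M`). -/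
def nrmOf (e : NExpr) : CExpr := .get aNrm e (.lit 0)

/-- Squares. -/
def CExpr.sq (e : CExpr) : CExpr := .mul e e

/-- `Γ₁ := max_j {‖a_j‖ ‖b‖, ‖a_j‖²}` -/
def computeGamma : Cmd :=
  .seq (setSc aGam (.int 0)) <|
  .loop rJ (.reg rM) <|
    .seq (.ite (sc aGam) (.mul (nrmOf (.reg rJ)) (nrmOf (.reg rM)))
        (setSc aGam (.mul (nrmOf (.reg rJ)) (nrmOf (.reg rM)))) .skip)
      (.ite (sc aGam) (nrmOf (.reg rJ)).sq
        (setSc aGam (nrmOf (.reg rJ)).sq) .skip)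

/-- `λ := ε / (2 ‖A‖² ‖A⁺‖⁴ ‖b‖)` -/
def computeLambda : Cmd :=
  setSc aLam <| .div (sc aEps) <|
    .mul (.int 2) <| .mul (sc aA).sq <| .mul (sc aAinv).sq.sq (nrmOf (.reg rM))

/-- `T := ρ M ‖A⁺‖⁴ κ(A)⁴ ‖b‖² (‖A‖ (‖x*‖ + 1) + ε)² / ε⁴` -/
def exprT : CExpr :=
  .div
    (.mul (sc aRho) <| .mul (.cast (.reg rM)) <| .mul (sc aAinv).sq.sq <|
      .mul (CExpr.mul (sc aA) (sc aAinv)).sq.sq <| .mul (nrmOf (.reg rM)).sq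
        (CExpr.add (.mul (sc aA) (.add (sc aXs) (.int 1))) (sc aEps)).sq)
    (sc aEps).sq.sq

/-- The number of repetitions `⌈Γ₁² T⌉`. -/
def computeS : Cmd := .ceil rS (.mul (sc aGam).sq exprT)

/-- Estimate `⟨0|U_eᴴ U_f|0⟩` by repeating the Hadamard tests for its real and imaginary parts
independently: a part is estimated by the average of `1 - 2 z` over the measured bits `z`. The
estimate is left in the accumulator. -/
def estimate (e f : NExpr) : Cmd :=
  .seq (setSc aAcc (.int 0)) <|
  .seq
    (.loop rT (.reg rS) <|
      .seq (.test aBit (.lit 0) (.lit 0) e f .re) <|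
      .seq (setSc aAcc (.add (sc aAcc) (.sub (.int 1) (.mul (.int 2) (sc aBit))))) <|
      .seq (.test aBit (.lit 0) (.lit 0) e f .im) <|
        setSc aAcc (.add (sc aAcc) (.mul .imag (.sub (.int 1) (.mul (.int 2) (sc aBit)))))) <|
  setSc aAcc (.div (sc aAcc) (.cast (.reg rS)))

/-- `Ŵ_jk := ‖a_j‖ ‖a_k‖ v_jk` for all `j, k`, and then `Ŵ_jj := Ŵ_jj + λ` for all `j`. -/
def computeW : Cmd :=
  .loop rJ (.reg rM) <|
    .seq
      (.loop rK (.reg rM) <|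
        .seq (estimate (.reg rJ) (.reg rK)) <|
          .setArr aW (.reg rJ) (.reg rK)
            (.mul (.mul (nrmOf (.reg rJ)) (nrmOf (.reg rK))) (sc aAcc)))
      (.setArr aW (.reg rJ) (.reg rJ) (.add (.get aW (.reg rJ) (.reg rJ)) (sc aLam)))

/-- `q̂_j := ‖a_j‖ ‖b‖ u_j` for all `j`. -/
def computeQ : Cmd :=
  .loop rJ (.reg rM) <|
    .seq (estimate (.reg rJ) (.reg rM)) <|
      .setArr aQ (.reg rJ) (.lit 0)
        (.mul (.mul (nrmOf (.reg rJ)) (nrmOf (.reg rM))) (sc aAcc))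

/-- The hybrid algorithm for over-determined systems, with the classical subroutine `solve` for
`x̂ := Ŵ⁻¹ q̂`. -/
def hybridAlgorithm (solve : Cmd) : Cmd :=
  .seq computeGamma <| .seq computeLambda <| .seq computeS <|
    .seq computeW <| .seq computeQ solve

/-- The `M × M` matrix stored in the array `aW`. -/
def Mem.matW (m : Mem) (M : ℕ) : Matrix (Fin M) (Fin M) ℂ := Matrix.of fun j k => m.arr aW j k

/-- The vector stored in the array `aQ`. -/
def Mem.vecQ (m : Mem) (M : ℕ) : Fin M → ℂ := fun j => m.arr aQ j 0

/-- The vector stored in the array `aX`. -/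
def Mem.vecX (m : Mem) (M : ℕ) : Fin M → ℂ := fun j => m.arr aX j 0

/-- A classical program that computes `W⁻¹ q` for every invertible `W` of every size `M × M`, and
that always stops after at most `C (M³ + 1)` steps. -/
def IsLinearSolver (solve : Cmd) (C : ℝ) : Prop :=
  solve.Classical ∧
  ∀ (n : ℕ) (circ : ℕ → ℕ → Part → Circuit (n + 1)) (m : Mem) (M : ℕ), m.nat rM = M →
    ∀ r ∈ (run circ solve m).support,
      (r.2 : ℝ) ≤ C * ((M : ℝ) ^ 3 + 1) ∧
      (IsUnit (m.matW M).det → r.1.vecX M = (m.matW M)⁻¹.mulVec (m.vecQ M))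

/-- The initial memory: the dimension `M`, the norms `‖a_j‖` and `‖b‖`, the parameters `‖A‖`, `‖A⁺‖`,
`‖x*‖`, `ε`, and the factor `ρ` in the number of repetitions. -/
def initMem {N M : ℕ} (A : Matrix (Fin N) (Fin M) ℂ) (b : EuclideanSpace ℂ (Fin N))
    (nrm : Fin M → ℝ) (nrmB : ℝ) (ε ρ : ℝ) : Mem where
  nat r := if r = rM then M else 0
  arr a i j :=
    if j ≠ 0 then 0
    else if a = aNrm then
      (if h : i < M then (nrm ⟨i, h⟩ : ℂ) else if i = M then (nrmB : ℂ) else 0)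
    else if i ≠ 0 then 0
    else if a = aA then (‖A‖ : ℂ)
    else if a = aAinv then (‖pinv A‖ : ℂ)
    else if a = aXs then (‖optSol A b‖ : ℂ)
    else if a = aEps then (ε : ℂ)
    else if a = aRho then (ρ : ℂ)
    else 0

/-- The Hadamard test circuits: index `j < M` refers to `U_j`, the index `M` to `U_b`. -/
def testCircuit (comp : ∀ n : ℕ, Circuit n → Circuit n → Part → Circuit (n + 1))
    {n M : ℕ} (U : Fin M → Circuit n) (Ub : Circuit n) (e f : ℕ) (p : Part) : Circuit (n + 1) :=
  comp n (if h : e < M then U ⟨e, h⟩ else Ub) (if h : f < M then U ⟨f, h⟩ else Ub) p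

/-- The joint distribution of the output `x̂` and the running time of the algorithm. -/
def runAlgorithm (solve : Cmd)
    (comp : ∀ n : ℕ, Circuit n → Circuit n → Part → Circuit (n + 1))
    {N M : ℕ} (A : Matrix (Fin N) (Fin M) ℂ) (b : EuclideanSpace ℂ (Fin N))
    (nrm : Fin M → ℝ) (U : Fin M → Circuit (Nat.clog 2 N))
    (nrmB : ℝ) (Ub : Circuit (Nat.clog 2 N)) (ε ρ : ℝ) :
    PMF (EuclideanSpace ℂ (Fin M) × ℕ) :=
  (run (testCircuit comp U Ub) (hybridAlgorithm solve) (initMem A b nrm nrmB ε ρ)).map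
    fun r => (WithLp.toLp 2 (r.1.vecX M), r.2)

end HybridLS

end

open HybridLS

noncomputable section

namespace HybridLS

/-! ### Diagonalization of unitary matrices -/

/-! Put `H = Aᴴ A` and `x* = A⁺ b`. The output solves a perturbed ridge regression `(H + λ + E) x =
Aᴴ b + f`, where `E` and `f` collect the sampling errors of the Hadamard tests. The proof combines a
deterministic estimate, a concentration estimate and a count of steps.

Deterministic estimate (`perturbed_solution`). By Pythagoras, `x*` attains the minimal residual, so
the excess residual of `x` is at most `‖A (x - x*)‖`. The exact ridge solution `y` has bias `‖A (y -
x*)‖ ≤ λ ‖A‖ ‖A⁺‖³ ‖b‖ = ε / (2 κ) ≤ ε / 2` (`norm_bias_le`). Since `H + λ` is bounded below by `λ`,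
errors of norm at most `τ = θ λ`, with `θ = ε / (8 R)` and `R = ‖A‖ (‖x*‖ + 1) + ε`, keep the matrix
invertible and move the solution by at most `θ (1 + ‖x‖)`. This costs at most another `ε / 2`.

Concentration. The value `1 - 2 z` of a test has the desired part as its mean, and its centered
exponential moment at `a` is at most `exp (2 a²)` (`mgf_le`). Every test is run afresh, so along the
program the exponential of a linear functional of the errors, divided by these bounds, is a
supermartingale (`wp_loop_le`, `wp_estimate_le`, `wp_estimates_le`). Hence every fixed linear
functional of the errors is subgaussian, with variance proxy of order `Γ₁² / S` times the squared
`ℓ²` norm of its coefficients. For the functionals `⟨u, E w⟩` and `⟨u, f⟩` with `u`, `w` in the unit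
ball this norm is at most `1`, whatever `M` is. A `1/2`-net of at most `25 ^ M` points reduces the
operator norm of `E` and the norm of `f` to at most `2 * 625 ^ M` such functionals. The union bound
thus costs only a factor exponential in `M`, which the factor `M` in `T` pays for (`wp_failure_le`,
`tail_le`).

Running time. There are `M² + M` estimates with `2 S` tests each, and a test circuit has `O(1 + d
⌈log₂ N⌉)` gates. The identity `M² Γ₁² T = ρ B` gives the term `B`; rounding `S` up and the linear
solver are absorbed in `M³` (`running_time_le`). The solver orthogonalizes rows
(`isLinearSolver_solver`). The test circuits come from diagonalizing each two-qubit gate, so that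
only a diagonal matrix has to be controlled (`exists_hadamardCompiler`). -/

theorem exists_norm_eq_one_det_ne_zero {ι : Type*} [Fintype ι] [DecidableEq ι] (U : Matrix ι ι ℂ) :
    ∃ ω : ℂ, ‖ω‖ = 1 ∧ (Matrix.scalar ι ω + U).det ≠ 0 := by
  by_contra! h
  have hinf : (Metric.sphere (0 : ℂ) 1).Infinite := by
    refine IsPreconnected.infinite_of_nontrivial
      (isPreconnected_sphere (by simp [Complex.rank_real_complex]) _ _) ⟨1, by simp, -1, by simp, ?_⟩
    norm_num [Complex.ext_iff]
  -- `det (ω + U)` is the value at `ω` of the characteristic polynomial of `-U`. A monic polynomial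
  -- cannot vanish on the whole unit circle, which is infinite.
  have h0 : (-U).charpoly = 0 := by
    refine Polynomial.eq_zero_of_infinite_isRoot _ (hinf.mono fun ω hω => ?_)
    have := h ω (by simpa using hω)
    simpa [Polynomial.IsRoot, Matrix.eval_charpoly, sub_neg_eq_add] using this
  exact (Matrix.charpoly_monic _).ne_zero h0

/-- The Cayley transform `K = i (ω - U) (ω + U)⁻¹` is Hermitian, so the spectral theorem for
Hermitian matrices applies to it; an orthonormal eigenbasis of `K` also diagonalizes `U`. -/
theorem exists_diagonalization {ι : Type*} [Fintype ι] [DecidableEq ι] (U : Matrix ι ι ℂ)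
    (hU : U ∈ Matrix.unitaryGroup ι ℂ) :
    ∃ V ∈ Matrix.unitaryGroup ι ℂ, ∃ d : ι → ℂ, U = V * Matrix.diagonal d * V.conjTranspose := by
  obtain ⟨ω, hω, hdet⟩ := exists_norm_eq_one_det_ne_zero U
  have hω' : star ω * ω = 1 := by
    have := Complex.conj_mul' ω
    simpa [hω] using this
  have hUU : U.conjTranspose * U = 1 := Matrix.mem_unitaryGroup_iff'.1 hU
  set Y : Matrix ι ι ℂ := Matrix.scalar ι ω + U with hY
  have hYu : IsUnit Y.det := isUnit_iff_ne_zero.2 hdet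
  have hsc : (Matrix.scalar ι ω : Matrix ι ι ℂ) = ω • 1 := by
    ext i j; simp [Matrix.scalar_apply, Matrix.diagonal_apply, Matrix.one_apply]
  have hYe : Y = ω • 1 + U := by rw [hY, hsc]
  set K : Matrix ι ι ℂ := (Complex.I • (ω • 1 - U)) * Y⁻¹ with hK
  have hKY : K * Y = Complex.I • (ω • 1 - U) := Matrix.nonsing_inv_mul_cancel_right _ _ hYu
  -- It suffices to see that the congruent matrix `Yᴴ K Y = i (ω Uᴴ - ω̄ U)` is Hermitian.
  have hX : (Y.conjTranspose * (K * Y)).IsHermitian := by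
    rw [hKY, hYe]
    have : (ω • (1 : Matrix ι ι ℂ) + U).conjTranspose * Complex.I • (ω • 1 - U)
        = Complex.I • (ω • U.conjTranspose - star ω • U) := by
      simp only [Matrix.conjTranspose_add, Matrix.conjTranspose_smul, Matrix.conjTranspose_one,
        Matrix.mul_smul, add_mul, mul_sub, Matrix.smul_mul, one_mul, mul_one, hUU, smul_smul]
      rw [mul_comm ω, hω', one_smul, ← smul_add]
      congr 1
      abel
    rw [this]
    simp only [Matrix.IsHermitian, Matrix.conjTranspose_smul, Matrix.conjTranspose_sub,
      Matrix.conjTranspose_conjTranspose, star_star]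
    rw [show star Complex.I = -Complex.I from Complex.conj_I, neg_smul, ← smul_neg, neg_sub]
  have hKh : K.IsHermitian := by
    have hYH : IsUnit Y.conjTranspose.det := by
      rw [Matrix.det_conjTranspose]; exact hYu.star
    have e : K = (Y⁻¹).conjTranspose * (Y.conjTranspose * (K * Y)) * Y⁻¹ := by
      rw [Matrix.conjTranspose_nonsing_inv, Matrix.nonsing_inv_mul_cancel_left _ _ hYH,
        Matrix.mul_nonsing_inv_cancel_right _ _ hYu]
    rw [e]
    exact Matrix.isHermitian_conjTranspose_mul_mul _ hX
  set V : Matrix ι ι ℂ := (hKh.eigenvectorUnitary : Matrix ι ι ℂ) with hV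
  have hVm : V ∈ Matrix.unitaryGroup ι ℂ := hKh.eigenvectorUnitary.2
  have hVV : V.conjTranspose * V = 1 := Matrix.mem_unitaryGroup_iff'.1 hVm
  have hVV' : V * V.conjTranspose = 1 := Matrix.mem_unitaryGroup_iff.1 hVm
  have hspec : V.conjTranspose * K * V
      = Matrix.diagonal fun i => (hKh.eigenvalues i : ℂ) := by
    have h1 : K = V * (Matrix.diagonal fun i => (hKh.eigenvalues i : ℂ)) * V.conjTranspose := by
      have := hKh.spectral_theorem
      rw [Unitary.conjStarAlgAut_apply] at this
      exact this
    conv_lhs => rw [h1]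
    simp only [Matrix.mul_assoc]
    rw [hVV, ← Matrix.mul_assoc, hVV, mul_one, one_mul]
  set W := V.conjTranspose * U * V with hW
  have hUW : U = V * W * V.conjTranspose := by
    rw [hW]
    simp only [Matrix.mul_assoc]
    rw [hVV', ← Matrix.mul_assoc, ← Matrix.mul_assoc, hVV', one_mul, mul_one]
  -- The relation `K (ω + U) = i (ω - U)` reads `(K + i) U = ω (i - K)`. In the eigenbasis the
  -- factor `K + i` is diagonal, and invertible because the eigenvalues of `K` are real.
  have hrel : (Matrix.diagonal fun i => (hKh.eigenvalues i : ℂ) + Complex.I) * W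
      = Matrix.diagonal fun i => ω * (Complex.I - (hKh.eigenvalues i : ℂ)) := by
    have h1 : K * U + Complex.I • U = (Complex.I * ω) • 1 - ω • K := by
      have := hKY
      rw [hYe, mul_add, smul_sub, Matrix.mul_smul, mul_one, smul_smul] at this
      rw [eq_sub_iff_add_eq, ← sub_eq_zero]
      rw [← sub_eq_zero] at this
      rw [← this]; abel
    have h2 : V.conjTranspose * (K * U + Complex.I • U) * V
        = V.conjTranspose * ((Complex.I * ω) • 1 - ω • K) * V := by rw [h1]
    have h3 : V.conjTranspose * (K * U) * V = (V.conjTranspose * K * V) * W := by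
      rw [hW]
      simp only [Matrix.mul_assoc]
      rw [← Matrix.mul_assoc V V.conjTranspose, hVV', one_mul]
    rw [mul_add, add_mul, h3, hspec, Matrix.mul_smul, Matrix.smul_mul, ← hW, mul_sub, sub_mul,
      Matrix.mul_smul, Matrix.smul_mul, mul_one, hVV, Matrix.mul_smul, Matrix.smul_mul, hspec] at h2
    ext i j
    have h4 := congrFun (congrFun h2 i) j
    simp only [Matrix.add_apply, Matrix.smul_apply, Matrix.sub_apply, Matrix.diagonal_mul,
      Matrix.diagonal_apply, Matrix.one_apply, smul_eq_mul] at h4 ⊢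
    rw [add_mul, h4]
    split_ifs <;> ring
  have hne : ∀ i, (hKh.eigenvalues i : ℂ) + Complex.I ≠ 0 := fun i h => by
    have := congrArg Complex.im h
    simp at this
  refine ⟨V, hVm, fun i => ω * (Complex.I - (hKh.eigenvalues i : ℂ)) /
    ((hKh.eigenvalues i : ℂ) + Complex.I), ?_⟩
  rw [hUW]
  congr 2
  ext i j
  have := congrFun (congrFun hrel i) j
  rw [Matrix.diagonal_mul] at this
  rw [Matrix.diagonal_apply] at this ⊢
  rw [← mul_right_inj' (hne i), this]
  split_ifs
  · field_simp [hne i]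
  · simp

/-! ### Local matrices and lists of gates -/

/-- `G` acts as the identity on the qubits outside `S`. -/
def IsLocal {n : ℕ} (S : Finset (Fin n)) (G : Matrix (Basis n) (Basis n) ℂ) : Prop :=
  (∀ x y, (∃ q, q ∉ S ∧ x q ≠ y q) → G x y = 0) ∧
  ∀ x y x' y', (∀ q, q ∉ S → x q = y q) → (∀ q, q ∉ S → x' q = y' q) →
    (∀ q ∈ S, x q = x' q) → (∀ q ∈ S, y q = y' q) → G x y = G x' y'

/-- Extend a basis state of the qubits in `S` by the values of `x`. -/
def override {n : ℕ} (S : Finset (Fin n)) (x : Basis n) (s : S → Fin 2) : Basis n :=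
  fun q => if h : q ∈ S then s ⟨q, h⟩ else x q

theorem override_mem {n : ℕ} {S : Finset (Fin n)} {x : Basis n} {s : S → Fin 2} {q : Fin n}
    (h : q ∈ S) : override S x s q = s ⟨q, h⟩ := dif_pos h

theorem override_notMem {n : ℕ} {S : Finset (Fin n)} {x : Basis n} {s : S → Fin 2} {q : Fin n}
    (h : q ∉ S) : override S x s q = x q := dif_neg h

theorem override_injective {n : ℕ} (S : Finset (Fin n)) (x : Basis n) :
    Function.Injective (override S x) := fun s t h => by
  ext q
  have := congrFun h q
  rw [override_mem q.2, override_mem q.2] at this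
  exact congrArg _ this

theorem override_restrict {n : ℕ} {S : Finset (Fin n)} {x y : Basis n}
    (h : ∀ q, q ∉ S → x q = y q) : override S x (fun q => y q) = y := by
  ext q
  by_cases hq : q ∈ S
  · rw [override_mem hq]
  · rw [override_notMem hq, h q hq]

/-- The sum over all basis states that agree with `x` outside `S`. -/
theorem sum_override {n : ℕ} (S : Finset (Fin n)) (x : Basis n) (f : Basis n → ℂ)
    (hf : ∀ y, (∃ q, q ∉ S ∧ x q ≠ y q) → f y = 0) :
    ∑ s, f (override S x s) = ∑ y, f y := by
  refine Fintype.sum_of_injective _ (override_injective S x) _ _ (fun y hy => hf y ?_) fun _ => rfl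
  by_contra! h
  exact hy ⟨_, override_restrict h⟩

/-- A unitary local matrix is the matrix of an elementary gate. -/
theorem IsLocal.exists_gate {n : ℕ} {S : Finset (Fin n)} {G : Matrix (Basis n) (Basis n) ℂ}
    (hG : IsLocal S G) (hne : S.Nonempty) (hcard : S.card ≤ 2)
    (hu : G ∈ Matrix.unitaryGroup (Basis n) ℂ) : ∃ g : Gate n, g.mat = G := by
  -- The small matrix is read off with all outer qubits equal to `0`; by locality any other outer
  -- value gives the same entries.
  let u : Matrix (S → Fin 2) (S → Fin 2) ℂ :=
    Matrix.of fun s t => G (override S 0 s) (override S 0 t)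
  have hu' : u ∈ Matrix.unitaryGroup (S → Fin 2) ℂ := by
    rw [Matrix.mem_unitaryGroup_iff]
    ext s t
    have h := congrFun (congrFun (Matrix.mem_unitaryGroup_iff.1 hu) (override S 0 s))
      (override S 0 t)
    rw [Matrix.mul_apply, ← sum_override S 0] at h
    · rw [Matrix.mul_apply]
      refine h.trans ?_
      rw [Matrix.one_apply, Matrix.one_apply]
      simp [(override_injective S 0).eq_iff]
    · rintro y ⟨q, hq, hy⟩
      rw [hG.1 _ _ ⟨q, hq, ?_⟩, zero_mul]
      rwa [override_notMem hq]
  refine ⟨⟨S, hne, hcard, ⟨u, hu'⟩⟩, ?_⟩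
  ext x y
  simp only [Gate.mat, Matrix.of_apply]
  split_ifs with h
  · refine hG.2 _ _ _ _ (fun q hq => ?_) h (fun q hq => ?_) (fun q hq => ?_)
    · rw [override_notMem hq, override_notMem hq]
    · rw [override_mem hq]
    · rw [override_mem hq]
  · push Not at h
    exact (hG.1 _ _ h).symm

/-- The matrix on all qubits of a matrix on the qubits in `S`. -/
def embed {n : ℕ} (S : Finset (Fin n)) (u : Matrix (S → Fin 2) (S → Fin 2) ℂ) :
    Matrix (Basis n) (Basis n) ℂ :=
  Matrix.of fun x y => if ∀ q, q ∉ S → x q = y q then u (fun q => x q) (fun q => y q) else 0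

theorem Gate.mat_eq_embed {n : ℕ} (g : Gate n) : g.mat = embed g.wires g.u := rfl

theorem isLocal_embed {n : ℕ} (S : Finset (Fin n)) (u : Matrix (S → Fin 2) (S → Fin 2) ℂ) :
    IsLocal S (embed S u) := by
  refine ⟨fun x y ⟨q, hq, h⟩ => if_neg fun h' => h (h' q hq), fun x y x' y' h h' hx hy => ?_⟩
  simp only [embed, Matrix.of_apply]
  rw [if_pos h, if_pos h']
  congr 1
  · ext q; rw [hx q q.2]
  · ext q; rw [hy q q.2]

theorem embed_mul {n : ℕ} (S : Finset (Fin n)) (u v : Matrix (S → Fin 2) (S → Fin 2) ℂ) :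
    embed S (u * v) = embed S u * embed S v := by
  ext x y
  have hz : ∀ w, (∃ q, q ∉ S ∧ x q ≠ w q) → embed S u x w * embed S v w y = 0 := fun w hw => by
    rw [(isLocal_embed S u).1 x w hw, zero_mul]
  rw [Matrix.mul_apply, ← sum_override S x _ hz]
  have h1 : ∀ s, embed S u x (override S x s) = u (fun q => x q) s := fun s => by
    simp only [embed, Matrix.of_apply]
    rw [if_pos fun q hq => (override_notMem hq).symm]
    congr 1
    ext q; rw [override_mem q.2]
  simp only [h1]
  by_cases h : ∀ q, q ∉ S → x q = y q
  · have h2 : ∀ s, embed S v (override S x s) y = v s fun q => y q := fun s => by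
      simp only [embed, Matrix.of_apply]
      rw [if_pos fun q hq => (override_notMem hq).trans (h q hq)]
      congr 1
      ext q; rw [override_mem q.2]
    simp only [h2]
    rw [embed, Matrix.of_apply, if_pos h, Matrix.mul_apply]
  · push Not at h
    rw [(isLocal_embed S _).1 x y h]
    refine (Finset.sum_eq_zero fun s _ => ?_).symm
    obtain ⟨q, hq, hxy⟩ := h
    rw [(isLocal_embed S v).1 _ y ⟨q, hq, by rwa [override_notMem hq]⟩, mul_zero]

/-- `G` is a product of at most `k` elementary gates. -/
def IsGateProduct {n : ℕ} (G : Matrix (Basis n) (Basis n) ℂ) (k : ℕ) : Prop :=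
  ∃ gs : List (Gate n), gs.length ≤ k ∧ (gs.map Gate.mat).reverse.prod = G

theorem IsGateProduct.one {n : ℕ} : IsGateProduct (1 : Matrix (Basis n) (Basis n) ℂ) 0 :=
  ⟨[], by simp, by simp⟩

/-- The right factor acts first, so its gates come first in the list. -/
theorem IsGateProduct.mul {n : ℕ} {G H : Matrix (Basis n) (Basis n) ℂ} {k l : ℕ}
    (hG : IsGateProduct G k) (hH : IsGateProduct H l) : IsGateProduct (G * H) (l + k) := by
  obtain ⟨gs, h1, rfl⟩ := hG
  obtain ⟨hs, h2, rfl⟩ := hH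
  exact ⟨hs ++ gs, by simpa using add_le_add h2 h1, by simp⟩

theorem IsGateProduct.mono {n : ℕ} {G : Matrix (Basis n) (Basis n) ℂ} {k l : ℕ}
    (hG : IsGateProduct G k) (h : k ≤ l) : IsGateProduct G l := by
  obtain ⟨gs, h1, h2⟩ := hG
  exact ⟨gs, h1.trans h, h2⟩

theorem IsLocal.isGateProduct {n : ℕ} {S : Finset (Fin n)} {G : Matrix (Basis n) (Basis n) ℂ}
    (hG : IsLocal S G) (hne : S.Nonempty) (hcard : S.card ≤ 2)
    (hu : G ∈ Matrix.unitaryGroup (Basis n) ℂ) : IsGateProduct G 1 := by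
  obtain ⟨g, rfl⟩ := hG.exists_gate hne hcard hu
  exact ⟨[g], by simp, by simp⟩

theorem IsLocal.conjTranspose {n : ℕ} {S : Finset (Fin n)} {G : Matrix (Basis n) (Basis n) ℂ}
    (hG : IsLocal S G) : IsLocal S G.conjTranspose := by
  refine ⟨fun x y ⟨q, hq, h⟩ => ?_, fun x y x' y' h h' hx hy => ?_⟩
  · rw [Matrix.conjTranspose_apply, hG.1 y x ⟨q, hq, h.symm⟩, star_zero]
  · rw [Matrix.conjTranspose_apply, Matrix.conjTranspose_apply,
      hG.2 y x y' x' (fun q hq => (h q hq).symm) (fun q hq => (h' q hq).symm) hy hx]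

theorem conjTranspose_mem_unitaryGroup {ι : Type*} [Fintype ι] [DecidableEq ι] {U : Matrix ι ι ℂ}
    (hU : U ∈ Matrix.unitaryGroup ι ℂ) : U.conjTranspose ∈ Matrix.unitaryGroup ι ℂ :=
  Unitary.star_mem hU

theorem Gate.isLocal {n : ℕ} (g : Gate n) : IsLocal g.wires g.mat := isLocal_embed _ _

theorem IsGateProduct.conjTranspose {n : ℕ} {G : Matrix (Basis n) (Basis n) ℂ} {k : ℕ}
    (hG : IsGateProduct G k) : IsGateProduct G.conjTranspose k := by
  obtain ⟨gs, h1, rfl⟩ := hG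
  refine IsGateProduct.mono (k := gs.length) ?_ h1
  clear h1
  induction gs with
  | nil => simpa using IsGateProduct.one
  | cons g l ih =>
    have hg := g.isLocal.conjTranspose.isGateProduct g.nonempty g.card_le
      (conjTranspose_mem_unitaryGroup g.mat_mem)
    have := hg.mul ih
    simpa using this

theorem Circuit.mat_eq_prod {n : ℕ} (c : Circuit n) :
    c.mat = (c.gates.map Gate.mat).reverse.prod := by
  rw [Circuit.mat, Circuit.unitary]
  have : ∀ l : List (Matrix.unitaryGroup (Basis n) ℂ),
      ((l.prod : Matrix.unitaryGroup (Basis n) ℂ) : Matrix (Basis n) (Basis n) ℂ)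
        = (l.map Subtype.val).prod := fun l => by
    induction l with
    | nil => simp
    | cons a l ih => simp [ih]
  rw [this, List.map_reverse, List.map_map]
  rfl

theorem Circuit.isGateProduct {n : ℕ} (c : Circuit n) : IsGateProduct c.mat c.size :=
  ⟨c.gates, le_rfl, c.mat_eq_prod.symm⟩

/-- One gate per layer makes disjointness trivial; only the size of a test circuit is charged, so
its depth may be wasted. -/
theorem IsGateProduct.exists_circuit {n : ℕ} {G : Matrix (Basis n) (Basis n) ℂ} {k : ℕ}
    (h : IsGateProduct G k) : ∃ c : Circuit n, c.mat = G ∧ c.size ≤ k := by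
  obtain ⟨gs, h1, rfl⟩ := h
  have hfl : (gs.map fun g => [g]).flatten = gs := by
    clear h1
    induction gs with
    | nil => rfl
    | cons a l ih => simp [ih]
  refine ⟨⟨gs.map fun g => [g], ?_⟩, ?_, ?_⟩
  · intro l hl
    obtain ⟨g, -, rfl⟩ := List.mem_map.1 hl
    exact List.pairwise_singleton _ _
  · rw [Circuit.mat_eq_prod, Circuit.gates, hfl]
  · rw [Circuit.size, Circuit.gates, hfl]; exact h1

/-- The gates of one layer act on disjoint non-empty sets of qubits. -/
theorem Circuit.size_le {n : ℕ} (c : Circuit n) : c.size ≤ c.depth * n := by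
  rw [Circuit.size, Circuit.gates, List.length_flatten, Circuit.depth]
  have key : ∀ l ∈ c.layers, l.length ≤ n := fun l hl => by
    have hd := c.disj l hl
    -- `S` is the union of all wires of the layer. The clause about `T` states this in the form that
    -- the induction needs: a new gate is disjoint from everything collected so far.
    suffices h : ∀ l : List (Gate n), (l.Pairwise fun g h => Disjoint g.wires h.wires) →
        ∃ S : Finset (Fin n), l.length ≤ S.card ∧ ∀ T : Finset (Fin n),
          (∀ g ∈ l, Disjoint T g.wires) → Disjoint T S by
      obtain ⟨S, hS, -⟩ := h l hd
      exact hS.trans (by simpa using Finset.card_le_univ S)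
    intro l hl
    induction l with
    | nil => exact ⟨∅, by simp, fun T _ => Finset.disjoint_empty_right T⟩
    | cons g l ih =>
      rw [List.pairwise_cons] at hl
      obtain ⟨S, hS, hS'⟩ := ih hl.2
      refine ⟨g.wires ∪ S, ?_, fun T hT => ?_⟩
      · rw [Finset.card_union_of_disjoint (hS' _ hl.1), List.length_cons]
        have := g.nonempty.card_pos
        omega
      · rw [Finset.disjoint_union_right]
        exact ⟨hT g (by simp), hS' T fun h hh => hT h (by simp [hh])⟩
  have := List.sum_le_card_nsmul (c.layers.map List.length) n (by
    intro x hx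
    obtain ⟨l, hl, rfl⟩ := List.mem_map.1 hx
    exact key l hl)
  simpa using this

/-! ### Compiling the Hadamard test -/

theorem sum_basis_succ {n : ℕ} {α : Type*} [AddCommMonoid α] (f : Basis (n + 1) → α) :
    ∑ x, f x = ∑ z : Fin 2, ∑ y : Basis n, f (Fin.cons z y) := by
  rw [← (Fin.consEquiv fun _ => Fin 2).sum_comp, Fintype.sum_prod_type]
  rfl

/-- `A` on the last `n` qubits if qubit `0` is set, and `B` if it is not. -/
def block {n : ℕ} (A B : Matrix (Basis n) (Basis n) ℂ) :
    Matrix (Basis (n + 1)) (Basis (n + 1)) ℂ :=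
  Matrix.of fun x y =>
    if x 0 = y 0 then (if x 0 = 1 then A else B) (Fin.tail x) (Fin.tail y) else 0

theorem controlled_eq_block {n : ℕ} (U : Matrix (Basis n) (Basis n) ℂ) :
    controlled U = block U 1 := rfl

theorem block_mul {n : ℕ} (A B A' B' : Matrix (Basis n) (Basis n) ℂ) :
    block A B * block A' B' = block (A * A') (B * B') := by
  ext x y
  rw [Matrix.mul_apply, sum_basis_succ]
  simp only [block, Matrix.of_apply, Fin.cons_zero, Fin.tail_cons]
  rw [Finset.sum_eq_single (x 0) (fun z _ hz => by simp [hz.symm]) (by simp)]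
  by_cases h : x 0 = y 0
  · simp only [h, if_true]
    split_ifs <;> simp [Matrix.mul_apply]
  · simp [h]

theorem block_one {n : ℕ} : block (1 : Matrix (Basis n) (Basis n) ℂ) 1 = 1 := by
  ext x y
  simp only [block, Matrix.of_apply, ite_self, Matrix.one_apply]
  rw [← ite_and]
  congr 1
  refine propext ⟨fun ⟨h, h'⟩ => ?_, fun h => by simp [h]⟩
  rw [← Fin.cons_self_tail x, ← Fin.cons_self_tail y, h, h']

theorem block_conjTranspose {n : ℕ} (A B : Matrix (Basis n) (Basis n) ℂ) :
    (block A B).conjTranspose = block A.conjTranspose B.conjTranspose := by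
  ext x y
  simp only [block, Matrix.of_apply, Matrix.conjTranspose_apply]
  by_cases h : x 0 = y 0
  · simp only [h, if_true]
    split_ifs <;> simp
  · simp [h, Ne.symm h]

theorem block_mem_unitaryGroup {n : ℕ} {A B : Matrix (Basis n) (Basis n) ℂ}
    (hA : A ∈ Matrix.unitaryGroup (Basis n) ℂ) (hB : B ∈ Matrix.unitaryGroup (Basis n) ℂ) :
    block A B ∈ Matrix.unitaryGroup (Basis (n + 1)) ℂ := by
  rw [Matrix.mem_unitaryGroup_iff, Matrix.star_eq_conjTranspose] at *
  rw [block_conjTranspose, block_mul, hA, hB, block_one]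

theorem IsLocal.one {n : ℕ} (S : Finset (Fin n)) : IsLocal S (1 : Matrix (Basis n) (Basis n) ℂ) := by
  refine ⟨fun x y ⟨q, hq, h⟩ => ?_, fun x y x' y' h h' hx hy => ?_⟩
  · exact Matrix.one_apply_ne fun e => h (congrFun e q)
  · simp only [Matrix.one_apply]
    congr 1
    refine propext ⟨fun e => ?_, fun e => ?_⟩
    · subst e
      ext q
      by_cases hq : q ∈ S
      · rw [← hx q hq, ← hy q hq]
      · rw [h' q hq]
    · subst e
      ext q
      by_cases hq : q ∈ S
      · rw [hx q hq, hy q hq]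
      · rw [h q hq]

/-- Selecting between two matrices costs one extra wire, the control. So a controlled one-qubit gate
is again elementary, while a controlled two-qubit gate touches three qubits. -/
theorem IsLocal.block {n : ℕ} {S : Finset (Fin n)} {A B : Matrix (Basis n) (Basis n) ℂ}
    (hA : IsLocal S A) (hB : IsLocal S B) :
    IsLocal (insert 0 (S.map (Fin.succEmb n))) (block A B) := by
  have hs : ∀ q, q ∉ S → q.succ ∉ insert 0 (S.map (Fin.succEmb n)) := fun q hq => by
    simpa [Fin.succ_ne_zero] using hq
  have hs' : ∀ q, q ∈ S → q.succ ∈ insert 0 (S.map (Fin.succEmb n)) := fun q hq => by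
    simpa [Fin.succ_ne_zero] using hq
  refine ⟨fun x y ⟨q, hq, h⟩ => ?_, fun x y x' y' h h' hx hy => ?_⟩
  · have h0 : q ≠ 0 := fun e => hq (by simp [e])
    obtain ⟨p, rfl⟩ := Fin.exists_succ_eq.2 h0
    have hp : p ∉ S := fun hp => hq (hs' p hp)
    simp only [HybridLS.block, Matrix.of_apply]
    split_ifs
    · exact hA.1 _ _ ⟨p, hp, h⟩
    · exact hB.1 _ _ ⟨p, hp, h⟩
    · rfl
  · simp only [HybridLS.block, Matrix.of_apply]
    rw [hx 0 (by simp), hy 0 (by simp)]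
    have key : ∀ {G : Matrix (Basis n) (Basis n) ℂ}, IsLocal S G →
        G (Fin.tail x) (Fin.tail y) = G (Fin.tail x') (Fin.tail y') := fun hG =>
      hG.2 _ _ _ _ (fun q hq => h _ (hs q hq)) (fun q hq => h' _ (hs q hq))
        (fun q hq => hx _ (hs' q hq)) (fun q hq => hy _ (hs' q hq))
    split_ifs
    · exact key hA
    · exact key hB
    · rfl

/-- Equal blocks ignore the control, so no wire is added. -/
theorem IsLocal.block_self {n : ℕ} {S : Finset (Fin n)} {A : Matrix (Basis n) (Basis n) ℂ}
    (hA : IsLocal S A) : IsLocal (S.map (Fin.succEmb n)) (HybridLS.block A A) := by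
  refine ⟨fun x y ⟨q, hq, h⟩ => ?_, fun x y x' y' h h' hx hy => ?_⟩
  · simp only [HybridLS.block, Matrix.of_apply, ite_self]
    split_ifs with h0
    · have hq0 : q ≠ 0 := fun e => h (e ▸ h0)
      obtain ⟨p, rfl⟩ := Fin.exists_succ_eq.2 hq0
      exact hA.1 _ _ ⟨p, fun hp => hq (by simpa using hp), h⟩
    · rfl
  · have h0 : (0 : Fin (n + 1)) ∉ S.map (Fin.succEmb n) := by simp [Fin.succ_ne_zero]
    simp only [HybridLS.block, Matrix.of_apply, ite_self]
    rw [if_pos (h 0 h0), if_pos (h' 0 h0)]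
    exact hA.2 _ _ _ _ (fun q hq => h _ (by simpa using hq)) (fun q hq => h' _ (by simpa using hq))
      (fun q hq => hx _ (by simpa using hq)) (fun q hq => hy _ (by simpa using hq))

theorem isGateProduct_block_self {n : ℕ} {S : Finset (Fin n)} {A : Matrix (Basis n) (Basis n) ℂ}
    (hA : IsLocal S A) (hne : S.Nonempty) (hcard : S.card ≤ 2)
    (hu : A ∈ Matrix.unitaryGroup (Basis n) ℂ) : IsGateProduct (block A A) 1 :=
  hA.block_self.isGateProduct (by simpa using hne) (by simpa using hcard)
    (block_mem_unitaryGroup hu hu)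

/-! Diagonal gates and controlled negations. -/

theorem isGateProduct_diagonal {n : ℕ} (S : Finset (Fin n)) (hne : S.Nonempty) (hcard : S.card ≤ 2)
    (f : Basis n → ℂ) (hf : ∀ x y, (∀ q ∈ S, x q = y q) → f x = f y) (hf1 : ∀ x, ‖f x‖ = 1) :
    IsGateProduct (Matrix.diagonal f) 1 := by
  refine IsLocal.isGateProduct (S := S) ⟨fun x y ⟨q, hq, h⟩ => ?_, fun x y x' y' h h' hx hy => ?_⟩
    hne hcard ?_
  · exact Matrix.diagonal_apply_ne _ fun e => h (congrFun e q)
  · have := (IsLocal.one S).2 x y x' y' h h' hx hy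
    rw [Matrix.one_apply, Matrix.one_apply] at this
    rw [Matrix.diagonal_apply, Matrix.diagonal_apply, hf x x' hx]
    by_cases e : x = y <;> by_cases e' : x' = y' <;> simp [e, e'] at this ⊢
  · rw [Matrix.mem_unitaryGroup_iff, Matrix.star_eq_conjTranspose, Matrix.diagonal_conjTranspose,
      Matrix.diagonal_mul_diagonal, ← Matrix.diagonal_one]
    congr 1
    ext x
    have := Complex.mul_conj' (f x)
    rw [hf1] at this
    simpa using this

/-- The matrix of a map of basis states. -/
def mapMatrix {n : ℕ} (σ : Basis n → Basis n) : Matrix (Basis n) (Basis n) ℂ :=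
  Matrix.of fun x y => if σ x = y then 1 else 0

theorem mapMatrix_mul {n : ℕ} (σ : Basis n → Basis n) (G : Matrix (Basis n) (Basis n) ℂ) :
    mapMatrix σ * G = G.submatrix σ id := by
  ext x y
  simp [mapMatrix, Matrix.mul_apply]

/-- Applied to a controlled negation, this turns a phase depending on one bit into a phase depending
on the parity of two bits. -/
theorem mapMatrix_mul_diagonal_mul {n : ℕ} {σ : Basis n → Basis n} (hσ : ∀ x, σ (σ x) = x)
    (f : Basis n → ℂ) :
    mapMatrix σ * Matrix.diagonal f * mapMatrix σ = Matrix.diagonal fun x => f (σ x) := by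
  have h : mapMatrix σ * mapMatrix σ = 1 := by
    rw [mapMatrix_mul]
    ext x y
    simp [mapMatrix, hσ, Matrix.one_apply]
  have h' : mapMatrix σ * Matrix.diagonal f
      = (Matrix.diagonal fun x => f (σ x)) * mapMatrix σ := by
    ext x y
    rw [mapMatrix_mul, Matrix.diagonal_mul]
    simp only [Matrix.submatrix_apply, id, Matrix.diagonal_apply, mapMatrix, Matrix.of_apply]
    split_ifs <;> simp
  rw [h', Matrix.mul_assoc, h, mul_one]

/-- The controlled negation of qubit `b`, with control `a`. -/
def cnot {n : ℕ} (a b : Fin n) (x : Basis n) : Basis n := Function.update x b (x a + x b)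

theorem cnot_cnot {n : ℕ} {a b : Fin n} (hab : a ≠ b) (x : Basis n) : cnot a b (cnot a b x) = x := by
  simp only [cnot, Function.update_idem, Function.update_self, Function.update_of_ne hab]
  rw [← add_assoc, show x a + x a = 0 by generalize x a = z; revert z; decide, zero_add,
    Function.update_eq_self]

theorem isGateProduct_cnot {n : ℕ} {a b : Fin n} (hab : a ≠ b) :
    IsGateProduct (mapMatrix (cnot a b)) 1 := by
  have hmem : ∀ q, q ∉ ({a, b} : Finset (Fin n)) → q ≠ b := fun q hq e => hq (by simp [e])
  refine IsLocal.isGateProduct (S := {a, b})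
    ⟨fun x y ⟨q, hq, h⟩ => ?_, fun x y x' y' h h' hx hy => ?_⟩ (by simp) Finset.card_le_two ?_
  · refine if_neg fun e => h ?_
    rw [← e, cnot, Function.update_of_ne (hmem q hq)]
  · have key : ∀ x y : Basis n, (∀ q, q ∉ ({a, b} : Finset (Fin n)) → x q = y q) →
        (cnot a b x = y ↔ x a = y a ∧ x a + x b = y b) := fun x y h => by
      refine ⟨fun e => ?_, fun ⟨ea, eb⟩ => ?_⟩
      · rw [← e]; simp [cnot, hab]
      · ext q
        by_cases hb : q = b
        · subst hb; simp [cnot, eb]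
        · rw [cnot, Function.update_of_ne hb]
          by_cases ha : q = a
          · rw [ha, ea]
          · rw [h q (by simp [ha, hb])]
    simp only [mapMatrix, Matrix.of_apply]
    congr 1
    rw [key x y h, key x' y' h', hx a (by simp), hx b (by simp), hy a (by simp), hy b (by simp)]
  · rw [Matrix.mem_unitaryGroup_iff, mapMatrix_mul]
    ext x y
    rw [Matrix.submatrix_apply, Matrix.star_apply, Matrix.one_apply]
    simp only [mapMatrix, Matrix.of_apply, id]
    have hinj : cnot a b y = cnot a b x ↔ x = y :=
      ⟨fun e => by rw [← cnot_cnot hab x, ← e, cnot_cnot hab], fun e => by rw [e]⟩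
    simp [hinj]

theorem exists_sqrt_norm_one (z : ℂ) (hz : ‖z‖ = 1) : ∃ a : ℂ, a ^ 2 = z ∧ ‖a‖ = 1 := by
  obtain ⟨a, ha⟩ := IsAlgClosed.exists_pow_nat_eq z two_pos
  refine ⟨a, ha, ?_⟩
  have : ‖a‖ * ‖a‖ = 1 := by rw [← norm_mul, ← sq, ha, hz]
  nlinarith [norm_nonneg a]

/-- A function of two bits is a product of functions of the bits and of their parity. -/
theorem exists_parity_factorization (d : Fin 2 → Fin 2 → ℂ) (hd : ∀ p q, ‖d p q‖ = 1) :
    ∃ g₁ g₂ g₃ : Fin 2 → ℂ, (∀ p, ‖g₁ p‖ = 1) ∧ (∀ p, ‖g₂ p‖ = 1) ∧ (∀ p, ‖g₃ p‖ = 1) ∧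
      ∀ p q, d p q = g₁ p * g₂ q * g₃ (p + q) := by
  have h0 : ∀ p q, d p q ≠ 0 := fun p q h => by have := hd p q; simp [h] at this
  -- With `g₁ 0 = d 0 0`, `g₁ 1 = a` and `g₂ 0 = g₃ 0 = 1`, three of the four equations fix the
  -- remaining values; the last one, at `(0, 1)`, fixes `a ^ 2`.
  obtain ⟨a, ha, ha1⟩ := exists_sqrt_norm_one (d 1 0 * d 1 1 * d 0 0 / d 0 1) (by simp [hd])
  have ha0 : a ≠ 0 := fun h => by simp [h] at ha1
  refine ⟨![d 0 0, a], ![1, d 1 1 / a], ![1, d 1 0 / a], ?_, ?_, ?_, ?_⟩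
  · intro p; fin_cases p <;> simp [hd, ha1]
  · intro p; fin_cases p <;> simp [hd, ha1]
  · intro p; fin_cases p <;> simp [hd, ha1]
  · have h01 : d 0 1 * a ^ 2 = d 1 0 * d 1 1 * d 0 0 := by rw [ha]; field_simp [h0 0 1]
    intro p q
    fin_cases p <;> fin_cases q
    · simp
    · simp only [Fin.zero_eta, Fin.mk_one, Fin.isValue, Matrix.cons_val_zero, Matrix.cons_val_one,
        zero_add]
      field_simp
      rw [h01]; ring
    · simp [field]
    · simp [field]

/-- A controlled diagonal matrix on two qubits. -/
theorem isGateProduct_controlled_diagonal {n : ℕ} {a b : Fin n} (hab : a ≠ b) (f : Basis n → ℂ)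
    (hf : ∀ x y, x a = y a → x b = y b → f x = f y) (hf1 : ∀ x, ‖f x‖ = 1) :
    IsGateProduct (controlled (Matrix.diagonal f)) 5 := by
  obtain ⟨g₁, g₂, g₃, h1, h2, h3, hg⟩ := exists_parity_factorization
    (fun p q => f fun w => if w = a then p else q) fun p q => hf1 _
  have hfg : ∀ x, f x = g₁ (x a) * g₂ (x b) * g₃ (x a + x b) := fun x => by
    rw [← hg]; exact hf _ _ (by simp) (by simp [hab.symm])
  -- A controlled phase on a single qubit: it involves only the control and that qubit, so it is
  -- elementary. Three of these and two controlled negations give the count `5`.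
  let F : (Fin 2 → ℂ) → Fin n → Basis (n + 1) → ℂ :=
    fun g q x => if x 0 = 1 then g (x q.succ) else 1
  have hF : ∀ g q, (∀ p, ‖g p‖ = 1) → IsGateProduct (Matrix.diagonal (F g q)) 1 := fun g q hg => by
    refine isGateProduct_diagonal {0, q.succ} (by simp) Finset.card_le_two _ (fun x y h => ?_)
      fun x => ?_
    · simp only [F]
      rw [h 0 (by simp), h q.succ (by simp)]
    · simp only [F]
      split_ifs <;> simp [hg]
  have hab' : a.succ ≠ b.succ := fun h => hab (Fin.succ_injective _ h)
  have hc := isGateProduct_cnot hab'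
  have key : controlled (Matrix.diagonal f) = Matrix.diagonal (F g₁ a) * (Matrix.diagonal (F g₂ b) *
      (mapMatrix (cnot a.succ b.succ) * Matrix.diagonal (F g₃ b) *
        mapMatrix (cnot a.succ b.succ))) := by
    rw [mapMatrix_mul_diagonal_mul (cnot_cnot hab'), Matrix.diagonal_mul_diagonal,
      Matrix.diagonal_mul_diagonal]
    ext x y
    by_cases hxy : x = y
    · subst hxy
      simp only [controlled, Matrix.of_apply, Matrix.diagonal_apply_eq, F]
      have : cnot a.succ b.succ x 0 = x 0 := by
        rw [cnot, Function.update_of_ne (Fin.succ_ne_zero b).symm]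
      rw [this]
      by_cases h : x 0 = 1
      · simp only [h, if_true]
        rw [Matrix.diagonal_apply_eq, hfg]
        simp [cnot, Fin.tail, mul_assoc]
      · simp [h]
    · rw [Matrix.diagonal_apply_ne _ hxy]
      simp only [controlled, Matrix.of_apply]
      split_ifs with h h'
      · refine Matrix.diagonal_apply_ne _ fun e => hxy ?_
        rw [← Fin.cons_self_tail x, ← Fin.cons_self_tail y, h, e]
      · refine Matrix.one_apply_ne fun e => hxy ?_
        rw [← Fin.cons_self_tail x, ← Fin.cons_self_tail y, h, e]
      · rfl
  rw [key]
  exact ((hF g₁ a h1).mul ((hF g₂ b h2).mul ((hc.mul (hF g₃ b h3)).mul hc)))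

theorem embed_conjTranspose {n : ℕ} (S : Finset (Fin n)) (u : Matrix (S → Fin 2) (S → Fin 2) ℂ) :
    embed S u.conjTranspose = (embed S u).conjTranspose := by
  ext x y
  simp only [embed, Matrix.of_apply, Matrix.conjTranspose_apply, apply_ite star, star_zero]
  congr 1
  simp only [eq_comm]

theorem embed_diagonal {n : ℕ} (S : Finset (Fin n)) (d : (S → Fin 2) → ℂ) :
    embed S (Matrix.diagonal d) = Matrix.diagonal fun x : Basis n => d fun q => x q := by
  ext x y
  by_cases hxy : x = y
  · subst hxy; simp [embed]
  · rw [Matrix.diagonal_apply_ne _ hxy]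
    simp only [embed, Matrix.of_apply]
    split_ifs with h
    · refine Matrix.diagonal_apply_ne _ fun e => hxy ?_
      ext q
      by_cases hq : q ∈ S
      · exact congrArg _ (congrFun e ⟨q, hq⟩)
      · rw [h q hq]
    · rfl

theorem embed_mem_unitaryGroup {n : ℕ} (S : Finset (Fin n))
    {u : Matrix (S → Fin 2) (S → Fin 2) ℂ} (hu : u ∈ Matrix.unitaryGroup (S → Fin 2) ℂ) :
    embed S u ∈ Matrix.unitaryGroup (Basis n) ℂ := by
  rw [Matrix.mem_unitaryGroup_iff, Matrix.star_eq_conjTranspose] at *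
  rw [← embed_conjTranspose, ← embed_mul, hu, ← Matrix.diagonal_one, embed_diagonal,
    Matrix.diagonal_one]

/-- A two-qubit gate is `E D Eᴴ` with `D` diagonal. When the control is off, `E Eᴴ = 1`, so `E` and
`Eᴴ` may be applied without control; they add two gates to the five for the controlled `D`. -/
theorem IsGateProduct.controlled_gate {n : ℕ} (g : Gate n) : IsGateProduct (controlled g.mat) 7 := by
  have hcard := g.card_le
  obtain h1 | h2 : g.wires.card = 1 ∨ g.wires.card = 2 := by
    have := g.nonempty.card_pos; omega
  · refine IsGateProduct.mono (k := 1) ?_ (by norm_num)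
    refine (g.isLocal.block (IsLocal.one g.wires)).isGateProduct (by simp) ?_
      (block_mem_unitaryGroup g.mat_mem (one_mem _))
    refine (Finset.card_insert_le _ _).trans ?_
    rw [Finset.card_map, h1]
  · obtain ⟨a, b, hab, hw⟩ := Finset.card_eq_two.1 h2
    obtain ⟨V, hV, d, hd⟩ := exists_diagonalization
      (g.u : Matrix (g.wires → Fin 2) (g.wires → Fin 2) ℂ) g.u.2
    set E : Matrix (Basis n) (Basis n) ℂ := embed g.wires V with hE
    have hEm : E ∈ Matrix.unitaryGroup (Basis n) ℂ := embed_mem_unitaryGroup _ hV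
    have hVV : E * E.conjTranspose = 1 := Matrix.mem_unitaryGroup_iff.1 hEm
    have hVV' : E.conjTranspose * E = 1 := Matrix.mem_unitaryGroup_iff'.1 hEm
    let f : Basis n → ℂ := fun x => d fun q => x q
    have hdiag : embed g.wires (Matrix.diagonal d) = Matrix.diagonal f := embed_diagonal _ _
    have hg : g.mat = E * Matrix.diagonal f * E.conjTranspose := by
      rw [Gate.mat_eq_embed, hd, embed_mul, embed_mul, hdiag, embed_conjTranspose]
    have hfu : Matrix.diagonal f ∈ Matrix.unitaryGroup (Basis n) ℂ := by
      have e : Matrix.diagonal f = E.conjTranspose * g.mat * E := by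
        rw [hg]
        simp only [Matrix.mul_assoc]
        rw [hVV', ← Matrix.mul_assoc, hVV', one_mul, mul_one]
      rw [e]
      exact mul_mem (mul_mem (conjTranspose_mem_unitaryGroup hEm) g.mat_mem) hEm
    have hf1 : ∀ x, ‖f x‖ = 1 := fun x => by
      have := Matrix.mem_unitaryGroup_iff.1 hfu
      rw [Matrix.star_eq_conjTranspose, Matrix.diagonal_conjTranspose,
        Matrix.diagonal_mul_diagonal] at this
      have := congrFun (congrFun this x) x
      rw [Matrix.diagonal_apply_eq, Matrix.one_apply_eq, Pi.star_apply] at this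
      have h' := congrArg norm this
      rw [norm_mul, norm_star, norm_one] at h'
      nlinarith [norm_nonneg (f x)]
    have hctrl : controlled g.mat = block E E * controlled (Matrix.diagonal f) *
        (block E E).conjTranspose := by
      rw [controlled_eq_block, controlled_eq_block, block_conjTranspose, block_mul, block_mul, ← hg,
        mul_one, hVV]
    rw [hctrl]
    have hb := isGateProduct_block_self (isLocal_embed _ V) g.nonempty g.card_le hEm
    refine ((hb.mul (isGateProduct_controlled_diagonal hab f (fun x y ha hb => ?_) hf1)).mul
      hb.conjTranspose).mono le_rfl
    refine congrArg d (funext fun q => ?_)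
    have hq : (q : Fin n) = a ∨ (q : Fin n) = b := by
      have : (q : Fin n) ∈ ({a, b} : Finset (Fin n)) := hw ▸ q.2
      simpa using this
    obtain h | h := hq <;> rw [h] <;> assumption

theorem IsGateProduct.controlled {n : ℕ} {G : Matrix (Basis n) (Basis n) ℂ} {k : ℕ}
    (hG : IsGateProduct G k) : IsGateProduct (controlled G) (7 * k) := by
  obtain ⟨gs, h1, rfl⟩ := hG
  refine IsGateProduct.mono (k := 7 * gs.length) ?_ (by omega)
  clear h1
  induction gs with
  | nil => simpa [controlled_eq_block, block_one] using IsGateProduct.one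
  | cons g l ih =>
    have := ih.mul (IsGateProduct.controlled_gate g)
    rw [controlled_eq_block, controlled_eq_block, block_mul, mul_one, ← controlled_eq_block] at this
    simp only [List.map_cons, List.reverse_cons, List.prod_append, List.prod_singleton,
      List.length_cons]
    exact this.mono (by omega)

theorem isGateProduct_onAncilla {n : ℕ} (g : Matrix (Fin 2) (Fin 2) ℂ)
    (hg : g ∈ Matrix.unitaryGroup (Fin 2) ℂ) :
    IsGateProduct (onAncilla g : Matrix (Basis (n + 1)) _ ℂ) 1 := by
  have htail : ∀ x y : Basis (n + 1), Fin.tail x = Fin.tail y ↔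
      ∀ q, q ∉ ({0} : Finset (Fin (n + 1))) → x q = y q := by
    intro x y
    refine ⟨fun h q hq => ?_, fun h => funext fun q => h _ (by simp [Fin.succ_ne_zero])⟩
    obtain ⟨p, rfl⟩ := Fin.exists_succ_eq.2 (by simpa using hq)
    exact congrFun h p
  refine IsLocal.isGateProduct (S := {0}) ⟨fun x y h => ?_, fun x y x' y' h h' hx hy => ?_⟩
    (by simp) (by simp) ?_
  · refine if_neg fun e => ?_
    obtain ⟨q, hq, h⟩ := h
    exact h ((htail x y).1 e q hq)
  · simp only [onAncilla, Matrix.of_apply]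
    rw [if_pos ((htail x y).2 h), if_pos ((htail x' y').2 h'), hx 0 (by simp), hy 0 (by simp)]
  · rw [Matrix.mem_unitaryGroup_iff] at hg ⊢
    ext x y
    rw [Matrix.mul_apply, sum_basis_succ]
    simp only [onAncilla, Matrix.of_apply, Matrix.star_apply, Fin.cons_zero, Fin.tail_cons]
    have h := congrFun (congrFun hg (x 0)) (y 0)
    rw [Matrix.mul_apply] at h
    simp only [Matrix.star_apply] at h
    by_cases hxy : Fin.tail x = Fin.tail y
    · simp only [hxy, apply_ite star, star_zero, mul_ite, ite_mul, zero_mul, mul_zero,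
        Finset.sum_ite_eq, Finset.mem_univ, if_true]
      rw [h, Matrix.one_apply, Matrix.one_apply]
      congr 1
      refine propext ⟨fun e => ?_, fun e => by rw [e]⟩
      rw [← Fin.cons_self_tail x, ← Fin.cons_self_tail y, e, hxy]
    · rw [Matrix.one_apply_ne fun e => hxy (by rw [e])]
      refine Finset.sum_eq_zero fun z _ => Finset.sum_eq_zero fun w _ => ?_
      by_cases hw : Fin.tail x = w
      · rw [if_neg (fun e : Fin.tail y = w => hxy (hw.trans e.symm)), star_zero, mul_zero]
      · rw [if_neg hw, zero_mul]

theorem hadamardGate_mem : hadamardGate ∈ Matrix.unitaryGroup (Fin 2) ℂ := by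
  have h : ((Real.sqrt 2 : ℝ) : ℂ)⁻¹ * ((Real.sqrt 2 : ℝ) : ℂ)⁻¹ = 1 / 2 := by
    rw [← mul_inv, ← Complex.ofReal_mul, Real.mul_self_sqrt (by norm_num)]; norm_num
  rw [Matrix.mem_unitaryGroup_iff]
  ext i j
  fin_cases i <;> fin_cases j <;>
    simp [hadamardGate, Matrix.mul_apply, Fin.sum_univ_two, h] <;> norm_num

theorem phaseGate_mem (p : Part) : phaseGate p ∈ Matrix.unitaryGroup (Fin 2) ℂ := by
  cases p
  · exact one_mem _
  · rw [Matrix.mem_unitaryGroup_iff]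
    ext i j
    fin_cases i <;> fin_cases j <;>
      simp [phaseGate, Matrix.mul_apply, Fin.sum_univ_two]

/-- A Hadamard test of `U₁ᴴ U₂` is a circuit of size linear in the sizes of `U₁` and `U₂`. -/
theorem exists_hadamardCompiler :
    ∃ comp : ∀ n : ℕ, Circuit n → Circuit n → Part → Circuit (n + 1),
      IsHadamardCompiler comp 7 := by
  have key : ∀ (n : ℕ) (c₁ c₂ : Circuit n) (p : Part), ∃ c : Circuit (n + 1),
      c.mat = hadamardTest p (c₁.mat.conjTranspose * c₂.mat) ∧
        (c.size : ℝ) ≤ 7 * (c₁.size + c₂.size + 1) := fun n c₁ c₂ p => by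
    have h := (((isGateProduct_onAncilla (n := n) _ hadamardGate_mem).mul
      (isGateProduct_onAncilla _ (phaseGate_mem p))).mul
      (c₁.isGateProduct.conjTranspose.mul c₂.isGateProduct).controlled).mul
      (isGateProduct_onAncilla _ hadamardGate_mem)
    obtain ⟨c, hc, hs⟩ := h.exists_circuit
    refine ⟨c, hc, ?_⟩
    -- Three gates on the ancilla, and seven for each gate of the two given circuits.
    have : c.size ≤ 7 * (c₁.size + c₂.size + 1) := by omega
    exact_mod_cast this
  choose comp hcomp using key
  exact ⟨comp, hcomp⟩

/-! ### Program logic -/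

@[simp] theorem Mem.setNat_arr (m : Mem) (r v : ℕ) : (m.setNat r v).arr = m.arr := rfl

@[simp] theorem Mem.setArr_nat (m : Mem) (a i j : ℕ) (z : ℂ) : (m.setArr a i j z).nat = m.nat := rfl

@[simp] theorem Mem.setNat_nat_self (m : Mem) (r v : ℕ) : (m.setNat r v).nat r = v := by
  simp [Mem.setNat]

theorem Mem.setNat_nat_of_ne (m : Mem) {r r' : ℕ} (v : ℕ) (h : r' ≠ r) :
    (m.setNat r v).nat r' = m.nat r' := by
  simp [Mem.setNat, Function.update_of_ne h]

theorem Mem.setNat_nat (m : Mem) (r r' v : ℕ) :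
    (m.setNat r v).nat r' = if r' = r then v else m.nat r' := by
  simp [Mem.setNat, Function.update_apply]

theorem Mem.setArr_arr (m : Mem) (a i j : ℕ) (z : ℂ) (a' i' j' : ℕ) :
    (m.setArr a i j z).arr a' i' j' = if a' = a ∧ i' = i ∧ j' = j then z else m.arr a' i' j' := rfl

@[simp] theorem Mem.setArr_arr_self (m : Mem) (a i j : ℕ) (z : ℂ) :
    (m.setArr a i j z).arr a i j = z := by
  simp [Mem.setArr]

theorem Mem.setArr_arr_of_ne (m : Mem) {a a' : ℕ} (i j : ℕ) (z : ℂ) (h : a' ≠ a) :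
    (m.setArr a i j z).arr a' = m.arr a' := by
  ext i' j'
  simp [Mem.setArr, h]

theorem run_seq_assoc {n : ℕ} {circ : ℕ → ℕ → Part → Circuit (n + 1)} {c d e : Cmd} {m : Mem} :
    run circ (.seq (.seq c d) e) m = run circ (.seq c (.seq d e)) m := by
  simp only [run, PMF.bind_bind, PMF.bind_map, PMF.map_bind, PMF.map_comp, Function.comp_def,
    add_assoc]

/-- Every run of `c` from `m` takes at most `t` steps and ends in a memory that satisfies `Q`. -/
def Spec {n : ℕ} (circ : ℕ → ℕ → Part → Circuit (n + 1)) (c : Cmd) (m : Mem) (t : ℕ)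
    (Q : Mem → Prop) : Prop :=
  ∀ r ∈ (run circ c m).support, r.2 ≤ t ∧ Q r.1

section Spec

variable {n : ℕ} {circ : ℕ → ℕ → Part → Circuit (n + 1)} {c d : Cmd} {m : Mem} {t t' : ℕ}
  {P Q : Mem → Prop}

theorem Spec.mono (h : Spec circ c m t P) (ht : t ≤ t') (hPQ : ∀ m', P m' → Q m') :
    Spec circ c m t' Q := fun r hr => ⟨(h r hr).1.trans ht, hPQ _ (h r hr).2⟩

theorem Spec.skip (h : Q m) : Spec circ .skip m 1 Q := by
  rintro r hr
  rw [run, PMF.mem_support_pure_iff] at hr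
  subst hr
  exact ⟨le_rfl, h⟩

theorem Spec.seq (h : Spec circ c m t P) (h' : ∀ m', P m' → Spec circ d m' t' Q) :
    Spec circ (.seq c d) m (t + t') Q := by
  rintro r hr
  rw [run, PMF.mem_support_bind_iff] at hr
  obtain ⟨r', hr', hr⟩ := hr
  rw [PMF.mem_support_map_iff] at hr
  obtain ⟨s, hs, rfl⟩ := hr
  have h1 := h r' hr'
  have h2 := h' _ h1.2 s hs
  exact ⟨add_le_add h1.1 h2.1, h2.2⟩

theorem Spec.setArr {a : ℕ} {i j : NExpr} {e : CExpr}
    (h : Q (m.setArr a (i.eval m) (j.eval m) (e.eval m))) :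
    Spec circ (.setArr a i j e) m (i.cost + j.cost + e.cost + 1) Q := by
  rintro r hr
  rw [run, PMF.mem_support_pure_iff] at hr
  subst hr
  exact ⟨le_rfl, h⟩

theorem Spec.setSc {a : ℕ} {e : CExpr} (h : Q (m.setArr a 0 0 (e.eval m))) :
    Spec circ (setSc a e) m (e.cost + 3) Q :=
  (Spec.setArr (i := .lit 0) (j := .lit 0) (e := e) h).mono (by simp [NExpr.cost]; omega)
    fun _ h => h

theorem Spec.seqSc {a : ℕ} {e : CExpr} (t : ℕ) (ht : e.cost + 3 + t ≤ t')
    (h : Spec circ c (m.setArr a 0 0 (e.eval m)) t Q) : Spec circ (.seq (HybridLS.setSc a e) c) m t' Q :=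
  Spec.mono (Spec.seq (Spec.setSc (Q := fun m' => m' = m.setArr a 0 0 (e.eval m)) rfl)
    (by rintro _ rfl; exact h)) ht fun _ h => h

theorem Spec.ceil {r : ℕ} {e : CExpr} (h : Q (m.setNat r ⌈(e.eval m).re⌉₊)) :
    Spec circ (.ceil r e) m (⌈(e.eval m).re⌉₊ + e.cost + 1) Q := by
  rintro r hr
  rw [run, PMF.mem_support_pure_iff] at hr
  subst hr
  exact ⟨le_rfl, h⟩

theorem Spec.ite {e f : CExpr} (h : (e.eval m).re ≤ (f.eval m).re → Spec circ c m t Q)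
    (h' : (f.eval m).re < (e.eval m).re → Spec circ d m t Q) :
    Spec circ (.ite e f c d) m (t + e.cost + f.cost + 1) Q := by
  rintro r hr
  rw [run, PMF.mem_support_map_iff] at hr
  obtain ⟨s, hs, rfl⟩ := hr
  split_ifs at hs with hc
  · have := h hc s hs
    exact ⟨by simpa using this.1, this.2⟩
  · have := h' (not_le.1 hc) s hs
    exact ⟨by simpa using this.1, this.2⟩

/-- The invariant is indexed by the number of completed rounds. Each round costs one step on top of
its body, and `iterate` starts with a count of one. -/
theorem Spec.loop {r k : ℕ} {e : NExpr} (he : e.eval m = k) (I : ℕ → Mem → Prop) (h0 : I 0 m)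
    (hI : ∀ i < k, ∀ m', I i m' → Spec circ c (m'.setNat r i) t (I (i + 1))) :
    Spec circ (.loop r e c) m (k * (t + 1) + 1 + e.cost) (I k) := by
  have key : ∀ j ≤ k, ∀ s ∈ (iterate (fun i m' => run circ c (m'.setNat r i)) j m).support,
      s.2 ≤ j * (t + 1) + 1 ∧ I j s.1 := by
    intro j
    induction j with
    | zero =>
      rintro - s hs
      rw [iterate, PMF.mem_support_pure_iff] at hs
      subst hs
      exact ⟨by simp, h0⟩
    | succ j ih =>
      intro hj s hs
      rw [iterate, PMF.mem_support_bind_iff] at hs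
      obtain ⟨s', hs', hs⟩ := hs
      rw [PMF.mem_support_map_iff] at hs
      obtain ⟨s'', hs'', rfl⟩ := hs
      have h1 := ih (by omega) s' hs'
      have h2 := hI j (by omega) _ h1.2 s'' hs''
      refine ⟨?_, h2.2⟩
      have := h1.1
      have := h2.1
      simp only
      rw [add_mul]
      omega
  rintro s hs
  rw [run, PMF.mem_support_map_iff, he] at hs
  obtain ⟨s', hs', rfl⟩ := hs
  have := key k le_rfl s' hs'
  exact ⟨by simpa using this.1, this.2⟩

theorem Spec.seqLoop {r k : ℕ} {e : NExpr} (s t : ℕ) (he : e.eval m = k) (I : ℕ → Mem → Prop)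
    (ht : k * (s + 1) + 1 + e.cost + t ≤ t') (h0 : I 0 m)
    (hI : ∀ i < k, ∀ m', I i m' → Spec circ c (m'.setNat r i) s (I (i + 1)))
    (hd : ∀ m', I k m' → Spec circ d m' t Q) : Spec circ (.seq (.loop r e c) d) m t' Q :=
  (Spec.seq (Spec.loop he I h0 hI) hd).mono ht fun _ h => h

end Spec

/-- The expectation of a non-negative function. -/
def expect {α : Type*} (p : PMF α) (F : α → ENNReal) : ENNReal := ∑' a, p a * F a

section expect

variable {α β : Type*}

theorem expect_pure (a : α) (F : α → ENNReal) : expect (PMF.pure a) F = F a := by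
  rw [expect, tsum_eq_single a fun b hb => by simp [PMF.pure_apply, hb]]
  simp [PMF.pure_apply]

theorem expect_bind (p : PMF α) (f : α → PMF β) (F : β → ENNReal) :
    expect (p.bind f) F = expect p fun a => expect (f a) F := by
  simp only [expect, PMF.bind_apply, ← ENNReal.tsum_mul_right, ← ENNReal.tsum_mul_left]
  rw [ENNReal.tsum_comm]
  simp only [mul_assoc]

theorem expect_map (p : PMF α) (f : α → β) (F : β → ENNReal) :
    expect (p.map f) F = expect p fun a => F (f a) := by
  rw [PMF.map, expect_bind]
  simp only [Function.comp, expect_pure]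

theorem expect_mono {p : PMF α} {F G : α → ENNReal} (h : ∀ a ∈ p.support, F a ≤ G a) :
    expect p F ≤ expect p G := by
  refine ENNReal.tsum_le_tsum fun a => ?_
  by_cases ha : a ∈ p.support
  · exact mul_le_mul_right (h a ha) _
  · rw [(PMF.apply_eq_zero_iff _ _).2 ha]; simp

theorem expect_const_mul (p : PMF α) (c : ENNReal) (F : α → ENNReal) :
    expect p (fun a => c * F a) = c * expect p F := by
  simp only [expect, ← ENNReal.tsum_mul_left]
  congr 1
  ext a
  ring

theorem expect_sum {ι : Type*} (p : PMF α) (s : Finset ι) (F : ι → α → ENNReal) :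
    expect p (fun a => ∑ i ∈ s, F i a) = ∑ i ∈ s, expect p (F i) := by
  simp only [expect, Finset.mul_sum]
  exact Summable.tsum_finsetSum fun _ _ => ENNReal.summable

theorem expect_add (p : PMF α) (F G : α → ENNReal) :
    expect p (fun a => F a + G a) = expect p F + expect p G := by
  simp only [expect, mul_add]
  exact ENNReal.tsum_add

end expect

/-- The expectation of a function of the final memory. -/
def wp {n : ℕ} (circ : ℕ → ℕ → Part → Circuit (n + 1)) (c : Cmd) (F : Mem → ENNReal) (m : Mem) :
    ENNReal := expect (run circ c m) fun r => F r.1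

section wp

variable {n : ℕ} {circ : ℕ → ℕ → Part → Circuit (n + 1)} {c d : Cmd} {m : Mem}
  {F G : Mem → ENNReal}

theorem wp_seq : wp circ (.seq c d) F m = wp circ c (wp circ d F) m := by
  simp only [wp, run, expect_bind, expect_map]

theorem wp_setArr {a : ℕ} {i j : NExpr} {e : CExpr} :
    wp circ (.setArr a i j e) F m = F (m.setArr a (i.eval m) (j.eval m) (e.eval m)) := by
  simp only [wp, run, expect_pure]

theorem wp_setSc {a : ℕ} {e : CExpr} : wp circ (setSc a e) F m = F (m.setArr a 0 0 (e.eval m)) :=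
  wp_setArr

theorem wp_mono (h : ∀ m', F m' ≤ G m') : wp circ c F m ≤ wp circ c G m :=
  expect_mono fun _ _ => h _

theorem Spec.wp_mono {t : ℕ} {Q : Mem → Prop} (hs : Spec circ c m t Q)
    (h : ∀ m', Q m' → F m' ≤ G m') : wp circ c F m ≤ wp circ c G m :=
  expect_mono fun r hr => h _ (hs r hr).2

theorem Spec.wp_le {t : ℕ} {Q : Mem → Prop} (hs : Spec circ c m t Q) {K : ENNReal}
    (h : ∀ m', Q m' → F m' ≤ K) : wp circ c F m ≤ K := by
  refine (expect_mono (G := fun _ => K) fun r hr => h _ (hs r hr).2).trans ?_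
  rw [expect, ENNReal.tsum_mul_right, PMF.tsum_coe, one_mul]

/-- The supermartingale rule: a potential that does not increase in expectation in any round does
not increase over the loop. All probability in the analysis of the sampling enters through this
rule. -/
theorem wp_loop_le {r k : ℕ} {e : NExpr} (he : e.eval m = k) (Φ : ℕ → Mem → ENNReal)
    (hΦ : ∀ i < k, ∀ m', wp circ c (Φ (i + 1)) (m'.setNat r i) ≤ Φ i m') :
    wp circ (.loop r e c) (Φ k) m ≤ Φ 0 m := by
  have key : ∀ j ≤ k, expect (iterate (fun i m' => run circ c (m'.setNat r i)) j m)
      (fun s => Φ j s.1) ≤ Φ 0 m := by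
    intro j
    induction j with
    | zero => intro _; rw [iterate, expect_pure]
    | succ j ih =>
      intro hj
      rw [iterate, expect_bind]
      refine (expect_mono fun s _ => ?_).trans (ih (by omega))
      rw [expect_map]
      exact hΦ j (by omega) s.1
  rw [wp, run, expect_map, he]
  exact key k le_rfl

theorem run_test {a : ℕ} {i j e f : NExpr} {p : Part} :
    run circ (.test a i j e f p) m =
      (((circ (e.eval m) (f.eval m) p).measure 0).bind fun z => PMF.pure (z : ℕ)).map fun z : ℕ =>
        (m.setArr a (i.eval m) (j.eval m) (z : ℂ),
          (circ (e.eval m) (f.eval m) p).size + 1 + i.cost + j.cost + e.cost + f.cost + 1) := rfl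

theorem wp_test {a : ℕ} {i j e f : NExpr} {p : Part} :
    wp circ (.test a i j e f p) F m =
      expect ((circ (e.eval m) (f.eval m) p).measure 0) fun z : Fin 2 =>
        F (m.setArr a (i.eval m) (j.eval m) ((z : ℕ) : ℂ)) := by
  simp only [wp, run_test, expect_map, expect_bind, expect_pure]

theorem Spec.test {a : ℕ} {i j e f : NExpr} {p : Part} {Q : Mem → Prop}
    (h : ∀ z : ℕ, Q (m.setArr a (i.eval m) (j.eval m) (z : ℂ))) :
    Spec circ (.test a i j e f p) m
      ((circ (e.eval m) (f.eval m) p).size + 1 + i.cost + j.cost + e.cost + f.cost + 1) Q := by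
  rintro r hr
  rw [run_test, PMF.mem_support_map_iff] at hr
  obtain ⟨z, -, rfl⟩ := hr
  exact ⟨le_rfl, h z⟩

end wp

/-! ### A linear solver: orthogonalization of the rows -/

/-- The `M × M` corner of a two-dimensional array. -/
def corner (M : ℕ) (W : ℕ → ℕ → ℂ) : Matrix (Fin M) (Fin M) ℂ := Matrix.of fun j k => W j k

/-- The inner product of two rows. -/
def rowInner (M : ℕ) (W : ℕ → ℕ → ℂ) (k i : ℕ) : ℂ :=
  ∑ l ∈ Finset.range M, W k l * (starRingEnd ℂ) (W i l)

/-- Subtract a multiple of row `i` from row `k`. -/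
def rowOp (M : ℕ) (W : ℕ → ℕ → ℂ) (k i : ℕ) (c : ℂ) : ℕ → ℕ → ℂ :=
  fun j l => if j = k ∧ l < M then W k l - c * W i l else W j l

/-- Subtract a multiple of entry `i` from entry `k` of the first column. -/
def entryOp (q : ℕ → ℕ → ℂ) (k i : ℕ) (c : ℂ) : ℕ → ℕ → ℂ :=
  fun j l => if j = k ∧ l = 0 then q k 0 - c * q i 0 else q j l

/-- The array `W` holds an invertible matrix and the system `W x = q` has the solution `x`. -/
def IsSystem (M : ℕ) (x : Fin M → ℂ) (W q : ℕ → ℕ → ℂ) : Prop :=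
  (corner M W).det ≠ 0 ∧ ∀ j < M, ∑ l : Fin M, W j l * x l = q j 0

/-- The first `k` rows are pairwise orthogonal. -/
def RowsOrthogonal (M : ℕ) (W : ℕ → ℕ → ℂ) (k : ℕ) : Prop :=
  ∀ a < k, ∀ b < k, a ≠ b → rowInner M W a b = 0

theorem rowInner_symm (M : ℕ) (W : ℕ → ℕ → ℂ) (k i : ℕ) :
    (starRingEnd ℂ) (rowInner M W k i) = rowInner M W i k := by
  simp [rowInner, mul_comm]

theorem rowInner_self_ne_zero {M : ℕ} {x : Fin M → ℂ} {W q : ℕ → ℕ → ℂ} (h : IsSystem M x W q)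
    {i : ℕ} (hi : i < M) : rowInner M W i i ≠ 0 := by
  intro h0
  refine h.1 (Matrix.det_eq_zero_of_row_eq_zero ⟨i, hi⟩ fun l => ?_)
  have h1 : ∑ l ∈ Finset.range M, ‖W i l‖ ^ 2 = 0 := by
    have : ((∑ l ∈ Finset.range M, ‖W i l‖ ^ 2 : ℝ) : ℂ) = 0 := by
      rw [← h0, rowInner]
      push_cast
      exact Finset.sum_congr rfl fun l _ => (Complex.mul_conj' _).symm
    exact_mod_cast this
  rw [Finset.sum_eq_zero_iff_of_nonneg fun _ _ => by positivity] at h1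
  have := h1 l (Finset.mem_range.2 l.2)
  simpa [corner] using this

/-- A row operation preserves the determinant, and the same operation on the right-hand side
preserves the solution, so orthogonalization never leaves the class of invertible systems with
solution `x`. -/
theorem IsSystem.rowOp {M : ℕ} {x : Fin M → ℂ} {W q : ℕ → ℕ → ℂ} (h : IsSystem M x W q)
    {k i : ℕ} (hk : k < M) (hi : i < M) (hik : i ≠ k) (c : ℂ) :
    IsSystem M x (rowOp M W k i c) (entryOp q k i c) := by
  refine ⟨?_, fun j hj => ?_⟩
  · have e : corner M (HybridLS.rowOp M W k i c) = (corner M W).updateRow ⟨k, hk⟩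
        (corner M W ⟨k, hk⟩ + (-c) • corner M W ⟨i, hi⟩) := by
      ext j l
      rw [Matrix.updateRow_apply]
      simp only [corner, Matrix.of_apply, HybridLS.rowOp, Fin.ext_iff, l.2, and_true]
      split_ifs
      · simp [sub_eq_add_neg]
      · rfl
    rw [e, Matrix.det_updateRow_add_smul_self _ (by simpa [Fin.ext_iff] using hik.symm)]
    exact h.1
  · by_cases hjk : j = k
    · subst hjk
      simp only [HybridLS.rowOp, entryOp, Fin.is_lt, and_true, if_true, sub_mul,
        Finset.sum_sub_distrib, mul_assoc, ← Finset.mul_sum, h.2 j hj, h.2 i hi]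
    · simp only [HybridLS.rowOp, entryOp, hjk, false_and, if_false, h.2 j hj]

theorem rowInner_rowOp_of_ne {M : ℕ} {W : ℕ → ℕ → ℂ} {k i a b : ℕ} (c : ℂ) (ha : a ≠ k)
    (hb : b ≠ k) : rowInner M (rowOp M W k i c) a b = rowInner M W a b := by
  simp [rowInner, rowOp, ha, hb]

theorem rowInner_rowOp_self {M : ℕ} {W : ℕ → ℕ → ℂ} {k i b : ℕ} (c : ℂ) (hb : b ≠ k) :
    rowInner M (rowOp M W k i c) k b = rowInner M W k b - c * rowInner M W i b := by
  simp only [rowInner]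
  rw [Finset.mul_sum, ← Finset.sum_sub_distrib]
  refine Finset.sum_congr rfl fun l hl => ?_
  simp only [rowOp, Finset.mem_range.1 hl, and_true, if_true, hb, if_false]
  ring

/-- A scratch array. -/
abbrev aTmp : ℕ := 13
/-- A scratch array. -/
abbrev aNsq : ℕ := 14

/-- Read entry `(j, k)` of the matrix. -/
def entryW (j k : ℕ) : CExpr := .get aW (.reg j) (.reg k)

/-- The inner product of the rows `rJ`, `rK`, divided by the square norm of the row `rK`. -/
def computeCoeff : Cmd :=
  .seq (setSc aTmp (.int 0)) <| .seq (setSc aNsq (.int 0)) <| .seq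
    (.loop rT (.reg rM) <| .seq
      (setSc aTmp (.add (sc aTmp) (.mul (entryW rJ rT) (.conj (entryW rK rT)))))
      (setSc aNsq (.add (sc aNsq) (.mul (entryW rK rT) (.conj (entryW rK rT))))))
    (setSc aTmp (.div (sc aTmp) (sc aNsq)))

/-- Make row `rJ` orthogonal to row `rK`, and change the right-hand side accordingly. -/
def reduceRow : Cmd :=
  .seq computeCoeff <| .seq
    (.loop rT (.reg rM) <|
      .setArr aW (.reg rJ) (.reg rT) (.sub (entryW rJ rT) (.mul (sc aTmp) (entryW rK rT))))
    (.setArr aQ (.reg rJ) (.lit 0) (.sub (.get aQ (.reg rJ) (.lit 0))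
      (.mul (sc aTmp) (.get aQ (.reg rK) (.lit 0)))))

/-- Make all rows orthogonal. -/
def orthogonalize : Cmd := .loop rJ (.reg rM) <| .loop rK (.reg rJ) reduceRow

/-- Solve a system with orthogonal rows. -/
def solveOrthogonal : Cmd :=
  .seq (.loop rJ (.reg rM) <| .setArr aX (.reg rJ) (.lit 0) (.int 0)) <|
  .loop rJ (.reg rM) <|
    .seq (setSc aNsq (.int 0)) <| .seq
      (.loop rT (.reg rM) <|
        setSc aNsq (.add (sc aNsq) (.mul (entryW rJ rT) (.conj (entryW rJ rT))))) <|
    .loop rT (.reg rM) <| .setArr aX (.reg rT) (.lit 0) (.add (.get aX (.reg rT) (.lit 0))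
      (.mul (.div (.get aQ (.reg rJ) (.lit 0)) (sc aNsq)) (.conj (entryW rJ rT))))

/-- The linear solver. -/
def solver : Cmd := .seq orthogonalize solveOrthogonal

section

variable {n : ℕ} {circ : ℕ → ℕ → Part → Circuit (n + 1)}

theorem spec_computeCoeff {m : Mem} {M k i : ℕ} (hM : m.nat rM = M) (hJ : m.nat rJ = k)
    (hK : m.nat rK = i) :
    Spec circ computeCoeff m (33 * M + 30) fun m' =>
      m'.nat rM = M ∧ m'.nat rJ = k ∧ m'.nat rK = i ∧ m'.arr aW = m.arr aW ∧
      m'.arr aQ = m.arr aQ ∧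
      m'.arr aTmp 0 0 = rowInner M (m.arr aW) k i / rowInner M (m.arr aW) i i := by
  refine Spec.seqSc (33 * M + 26) (by simp [CExpr.cost]; omega) <|
    Spec.seqSc (33 * M + 22) (by simp [CExpr.cost]; omega) <|
    Spec.seqLoop (k := M) 32 10 (by simpa [NExpr.eval] using hM)
      (fun l m' => m'.nat rM = M ∧ m'.nat rJ = k ∧ m'.nat rK = i ∧ m'.arr aW = m.arr aW ∧
        m'.arr aQ = m.arr aQ ∧ m'.arr aTmp 0 0 = rowInner l (m.arr aW) k i ∧
        m'.arr aNsq 0 0 = rowInner l (m.arr aW) i i)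
      (by simp [NExpr.cost]; omega) ?_ ?_ ?_
  · simp [Mem.setArr_arr, hM, hJ, hK, CExpr.eval, rowInner]
    constructor <;> rfl
  · rintro l hl m' ⟨h1, h2, h3, h4, h5, h6, h7⟩
    refine Spec.seqSc 16 (by simp [CExpr.cost, sc, entryW, NExpr.cost]) <| Spec.mono (Spec.setSc ?_)
      (by simp [CExpr.cost, sc, entryW, NExpr.cost]) fun _ h => h
    simp [Mem.setArr_arr, Mem.setNat_nat, CExpr.eval, rowInner, sc, entryW, NExpr.eval, h1, h2, h3,
      h4, h5, h6, h7, Finset.sum_range_succ, Mem.setArr_arr_of_ne]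
  · rintro m' ⟨h1, h2, h3, h4, h5, h6, h7⟩
    refine Spec.mono (Spec.setSc ?_) (by simp [CExpr.cost, sc, NExpr.cost]) fun _ h => h
    simp [CExpr.eval, sc, NExpr.eval, h1, h2, h3, h4, h5, h6, h7, Mem.setArr_arr_of_ne]

theorem spec_reduceRow {m : Mem} {M k i : ℕ} (hM : m.nat rM = M) (hJ : m.nat rJ = k)
    (hK : m.nat rK = i) (hik : i ≠ k) :
    Spec circ reduceRow m (50 * M + 50) fun m' =>
      m'.nat rM = M ∧ m'.nat rJ = k ∧
      m'.arr aW = rowOp M (m.arr aW) k i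
        (rowInner M (m.arr aW) k i / rowInner M (m.arr aW) i i) ∧
      m'.arr aQ = entryOp (m.arr aQ) k i
        (rowInner M (m.arr aW) k i / rowInner M (m.arr aW) i i) := by
  set c := rowInner M (m.arr aW) k i / rowInner M (m.arr aW) i i with hc
  refine (Spec.seq (spec_computeCoeff hM hJ hK) fun m' ⟨h1, h2, h3, h4, h5, h6⟩ => ?_).mono
    (t := 33 * M + 30 + (17 * M + 20)) (by omega) fun _ h => h
  -- After `l` rounds exactly the columns below `l` are updated, which is `rowOp` with `l` in place
  -- of `M`.
  refine Spec.seqLoop (k := M) 16 16 (by simpa [NExpr.eval] using h1)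
      (fun l m' => m'.nat rM = M ∧ m'.nat rJ = k ∧ m'.nat rK = i ∧
        m'.arr aW = rowOp l (m.arr aW) k i c ∧
        m'.arr aQ = m.arr aQ ∧ m'.arr aTmp 0 0 = c)
      (by simp [NExpr.cost]; omega) ?_ ?_ ?_
  · refine ⟨h1, h2, h3, ?_, h5, h6⟩
    rw [h4]
    funext j l
    simp [rowOp]
  · rintro l hl m' ⟨h1, h2, h3, h4, h5, h6⟩
    refine Spec.mono (Spec.setArr ?_) (by simp [CExpr.cost, sc, entryW, NExpr.cost]) fun _ h => h
    refine ⟨by simp [Mem.setNat_nat, h1], by simp [Mem.setNat_nat, h2],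
      by simp [Mem.setNat_nat, h3], ?_, by simp [Mem.setArr_arr_of_ne, h5],
      by simp [Mem.setArr_arr_of_ne, h6]⟩
    funext j l'
    simp only [Mem.setArr_arr, Mem.setNat_nat, CExpr.eval, sc, entryW, NExpr.eval, h2, h3, h4, h6,
      Mem.setNat_arr, rowOp]
    simp [hik]
    by_cases hj : j = k <;> by_cases hl' : l' = l
    · simp [hj, hl']
    · have : l' ≤ l ↔ l' < l := by omega
      simp [hj, hl', this]
    · simp [hj]
    · simp [hj]
  · rintro m' ⟨h1, h2, h3, h4, h5, h6⟩
    refine Spec.mono (Spec.setArr ?_) (by simp [CExpr.cost, sc, NExpr.cost]) fun _ h => h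
    refine ⟨by simp [h1], by simp [h2], by simp [Mem.setArr_arr_of_ne, h4], ?_⟩
    funext j l'
    simp only [Mem.setArr_arr, CExpr.eval, sc, NExpr.eval, h2, h3, h5, h6, entryOp, true_and]

/-- Modified Gram–Schmidt on the rows. Correctness is conditional on an invertible system, whereas
the time bound must also cover singular matrices, where divisions by zero return zero and the loops
still stop. -/
theorem spec_orthogonalize {m : Mem} {M : ℕ} (hM : m.nat rM = M) (x : Fin M → ℂ) :
    Spec circ orthogonalize m (M * (M * (50 * M + 51) + 3) + 2) fun m' =>
      m'.nat rM = M ∧ (IsSystem M x (m.arr aW) (m.arr aQ) →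
        IsSystem M x (m'.arr aW) (m'.arr aQ) ∧ RowsOrthogonal M (m'.arr aW) M) := by
  refine (Spec.loop (k := M) (t := M * (50 * M + 51) + 2) (by simpa [NExpr.eval] using hM)
    (fun k m' => m'.nat rM = M ∧ (IsSystem M x (m.arr aW) (m.arr aQ) →
        IsSystem M x (m'.arr aW) (m'.arr aQ) ∧ RowsOrthogonal M (m'.arr aW) k))
    ⟨hM, fun h => ⟨h, fun a ha => by omega⟩⟩ ?_).mono (by simp [NExpr.cost]) fun _ h => h
  rintro k hk m' ⟨h1, h2⟩
  refine (Spec.loop (k := k) (e := .reg rJ) (m := m'.setNat rJ k) (t := 50 * M + 50)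
    (Mem.setNat_nat_self _ _ _)
    (fun i m' => m'.nat rM = M ∧ m'.nat rJ = k ∧ (IsSystem M x (m.arr aW) (m.arr aQ) →
        IsSystem M x (m'.arr aW) (m'.arr aQ) ∧ RowsOrthogonal M (m'.arr aW) k ∧
        ∀ a < i, rowInner M (m'.arr aW) k a = 0))
    ⟨by simpa [Mem.setNat_nat] using h1, Mem.setNat_nat_self _ _ _,
      fun h => ⟨(h2 h).1, (h2 h).2, by simp⟩⟩ ?_).mono
    ?_ ?_
  · rintro i hi m' ⟨h1, h2, h3⟩
    have hik : i ≠ k := hi.ne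
    refine (spec_reduceRow (M := M) (k := k) (i := i) (by simpa [Mem.setNat_nat] using h1)
      (by simpa [Mem.setNat_nat] using h2) (Mem.setNat_nat_self _ _ _) hik).mono le_rfl ?_
    rintro m'' ⟨g1, g2, g3, g4⟩
    refine ⟨g1, g2, fun h => ?_⟩
    obtain ⟨s1, s2, s3⟩ := h3 h
    rw [g3, g4]
    refine ⟨s1.rowOp hk (hi.trans hk) hik _, fun a ha b hb hab => ?_, fun a ha => ?_⟩
    · rw [rowInner_rowOp_of_ne _ ha.ne hb.ne]
      exact s2 a ha b hb hab
    · have hak : a ≠ k := by omega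
      -- The coefficient is chosen to make row `k` orthogonal to row `i`. Orthogonality to an
      -- earlier row `a < i` survives because row `i` is itself orthogonal to row `a`.
      rw [rowInner_rowOp_self _ hak]
      simp only [Mem.setNat_arr]
      obtain rfl | hai := eq_or_ne a i
      · rw [div_mul_cancel₀ _ (rowInner_self_ne_zero s1 (hi.trans hk)), sub_self]
      · rw [s3 a (by omega), s2 i hi a (by omega) hai.symm, mul_zero, sub_zero]
  · have : k * (50 * M + 51) ≤ M * (50 * M + 51) := Nat.mul_le_mul_right _ hk.le
    simp [NExpr.cost]
    omega
  · rintro m'' ⟨g1, g2, g3⟩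
    refine ⟨g1, fun h => ⟨(g3 h).1, fun a ha b hb hab => ?_⟩⟩
    obtain ⟨s1, s2, s3⟩ := g3 h
    obtain rfl | ha' := eq_or_ne a k
    · exact s3 b (by omega)
    · obtain rfl | hb' := eq_or_ne b k
      · rw [← rowInner_symm, s3 a (by omega), map_zero]
      · exact s2 a (by omega) b (by omega) hab

theorem spec_solveOrthogonal {m : Mem} {M : ℕ} (hM : m.nat rM = M) :
    Spec circ solveOrthogonal m (M * (40 * M + 40) + 10) fun m' =>
      ∀ l < M, m'.arr aX l 0 = ∑ i ∈ Finset.range M,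
        m.arr aQ i 0 / rowInner M (m.arr aW) i i * (starRingEnd ℂ) (m.arr aW i l) := by
  refine Spec.seqLoop (k := M) 4 (M * (40 * M + 35) + 6) (by simpa [NExpr.eval] using hM)
      (fun j m' => m'.nat rM = M ∧ m'.arr aW = m.arr aW ∧ m'.arr aQ = m.arr aQ ∧
        ∀ l < j, m'.arr aX l 0 = 0)
      (by simp [NExpr.cost]; nlinarith) ⟨hM, rfl, rfl, by simp⟩ ?_ ?_
  · rintro j hj m' ⟨h1, h2, h3, h4⟩
    refine Spec.mono (Spec.setArr ?_) (by simp [CExpr.cost, NExpr.cost]) fun _ h => h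
    refine ⟨by simp [Mem.setNat_nat, h1], by simp [Mem.setArr_arr_of_ne, h2],
      by simp [Mem.setArr_arr_of_ne, h3], fun l hl => ?_⟩
    simp only [Mem.setArr_arr, NExpr.eval, CExpr.eval, Mem.setNat_nat_self, Mem.setNat_arr]
    split_ifs with h
    · simp
    · exact h4 l (by simp at h; omega)
  rintro m' ⟨h1, h2, h3, h4⟩
  refine (Spec.loop (k := M) (t := 40 * M + 20) (by simpa [NExpr.eval] using h1)
      (fun j m' => m'.nat rM = M ∧ m'.arr aW = m.arr aW ∧ m'.arr aQ = m.arr aQ ∧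
        ∀ l < M, m'.arr aX l 0 = ∑ i ∈ Finset.range j,
          m.arr aQ i 0 / rowInner M (m.arr aW) i i * (starRingEnd ℂ) (m.arr aW i l))
      ⟨h1, h2, h3, by simpa using h4⟩ ?_).mono (by simp [NExpr.cost]; nlinarith) fun _ h => h.2.2.2
  rintro j hj m' ⟨h1, h2, h3, h4⟩
  refine Spec.seqSc (40 * M + 16) (by simp [CExpr.cost]; omega) <|
    Spec.seqLoop (k := M) 16 (23 * M + 4) (by simpa [NExpr.eval, Mem.setNat_nat] using h1)
      (fun l m' => m'.nat rM = M ∧ m'.nat rJ = j ∧ m'.arr aW = m.arr aW ∧ m'.arr aQ = m.arr aQ ∧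
        m'.arr aNsq 0 0 = rowInner l (m.arr aW) j j ∧
        ∀ l < M, m'.arr aX l 0 = ∑ i ∈ Finset.range j,
          m.arr aQ i 0 / rowInner M (m.arr aW) i i * (starRingEnd ℂ) (m.arr aW i l))
      (by simp [NExpr.cost]; omega) ?_ ?_ ?_
  · simpa [Mem.setNat_nat, h1, h2, h3, Mem.setArr_arr_of_ne, rowInner, CExpr.eval] using h4
  · rintro l hl m' ⟨h1, h2, h3, h4, h5, h6⟩
    refine Spec.mono (Spec.setSc ?_) (by simp [CExpr.cost, sc, entryW, NExpr.cost]) fun _ h => h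
    simpa [Mem.setNat_nat, h1, h2, h3, h4, h5, Mem.setArr_arr_of_ne, rowInner, CExpr.eval,
      NExpr.eval, sc, entryW, Finset.sum_range_succ] using h6
  rintro m' ⟨h1, h2, h3, h4, h5, h6⟩
  -- In the middle of the update the entries below `l` already contain the contribution of row `j`
  -- and the others do not; the conditional range records this.
  refine (Spec.loop (k := M) (t := 20) (by simpa [NExpr.eval, Mem.setNat_nat] using h1)
      (fun l m' => m'.nat rM = M ∧ m'.nat rJ = j ∧ m'.arr aW = m.arr aW ∧ m'.arr aQ = m.arr aQ ∧
        m'.arr aNsq 0 0 = rowInner M (m.arr aW) j j ∧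
        ∀ l' < M, m'.arr aX l' 0 = ∑ i ∈ Finset.range (if l' < l then j + 1 else j),
          m.arr aQ i 0 / rowInner M (m.arr aW) i i * (starRingEnd ℂ) (m.arr aW i l'))
      ⟨h1, h2, h3, h4, h5, by simpa using h6⟩ ?_).mono (by simp [NExpr.cost]; omega) ?_
  · rintro l hl m' ⟨h1, h2, h3, h4, h5, h6⟩
    refine Spec.mono (Spec.setArr ?_) (by simp [CExpr.cost, sc, entryW, NExpr.cost]) fun _ h => h
    refine ⟨by simp [Mem.setNat_nat, h1], by simp [Mem.setNat_nat, h2],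
      by simp [Mem.setArr_arr_of_ne, h3], by simp [Mem.setArr_arr_of_ne, h4],
      by simp [Mem.setArr_arr_of_ne, h5], fun l' hl' => ?_⟩
    simp only [Mem.setArr_arr, NExpr.eval, CExpr.eval, Mem.setNat_nat, Mem.setNat_arr, sc, entryW]
    simp only [h2, h3, h4, h5, h6 l' hl']
    by_cases e : l' = l
    · subst e
      simp [Finset.sum_range_succ, h6 l' hl']
    · have : l' < l + 1 ↔ l' < l := by omega
      simp [e, this]
  · rintro m'' ⟨g1, g2, g3, g4, g5, g6⟩
    refine ⟨g1, g3, g4, fun l hl => ?_⟩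
    rw [g6 l hl, if_pos hl]

/-- Multiplying the candidate by row `j` kills every summand except `i = j`, by orthogonality, and
leaves `q j 0`. Injectivity of the matrix then identifies the candidate with `x`. -/
theorem solveOrthogonal_correct {M : ℕ} {x : Fin M → ℂ} {W q : ℕ → ℕ → ℂ}
    (h : IsSystem M x W q) (ho : RowsOrthogonal M W M) :
    (fun l : Fin M => ∑ i ∈ Finset.range M,
      q i 0 / rowInner M W i i * (starRingEnd ℂ) (W i l)) = x := by
  have hinj : Function.Injective (corner M W).mulVec :=
    Matrix.mulVec_injective_iff_isUnit.2
      ((Matrix.isUnit_iff_isUnit_det _).2 (isUnit_iff_ne_zero.2 h.1))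
  refine hinj (funext fun j => ?_)
  have h1 : (corner M W).mulVec x j = q j 0 := h.2 j j.2
  rw [h1]
  calc (corner M W).mulVec (fun l : Fin M => ∑ i ∈ Finset.range M,
      q i 0 / rowInner M W i i * (starRingEnd ℂ) (W i l)) j
      = ∑ l : Fin M, W j l * ∑ i ∈ Finset.range M,
        q i 0 / rowInner M W i i * (starRingEnd ℂ) (W i l) := rfl
    _ = ∑ i ∈ Finset.range M, q i 0 / rowInner M W i i * rowInner M W j i := by
      simp only [rowInner, Finset.mul_sum, Finset.sum_range (n := M) (fun l => _ * (W j l * _))]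
      rw [Finset.sum_comm]
      refine Finset.sum_congr rfl fun i _ => Finset.sum_congr rfl fun l _ => by ring
    _ = q j 0 := by
      rw [Finset.sum_eq_single (j : ℕ)]
      · rw [div_mul_cancel₀ _ (rowInner_self_ne_zero h j.2)]
      · intro i hi hij
        rw [ho j j.2 i (Finset.mem_range.1 hi) hij.symm, mul_zero]
      · intro hj
        exact absurd (Finset.mem_range.2 j.2) hj

end

theorem isLinearSolver_solver : IsLinearSolver solver 300 := by
  refine ⟨by simp [solver, orthogonalize, solveOrthogonal, reduceRow, computeCoeff, setSc,
    Cmd.Classical], fun n circ m M hM r hr => ?_⟩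
  set x := (m.matW M)⁻¹.mulVec (m.vecQ M) with hx
  have h := (Spec.seq (spec_orthogonalize (circ := circ) hM x) (t' := M * (40 * M + 40) + 10)
    (Q := fun m' => IsSystem M x (m.arr aW) (m.arr aQ) → m'.vecX M = x) fun m' hm' =>
      (spec_solveOrthogonal hm'.1).mono le_rfl fun m'' hm'' h => ?_) r hr
  · refine ⟨?_, fun hu => h.2 ⟨hu.ne_zero, fun j hj => ?_⟩⟩
    · have h0 : M ^ 2 ≤ M ^ 3 := by
        obtain rfl | h := Nat.eq_zero_or_pos M
        · simp
        · exact Nat.pow_le_pow_right h (by norm_num)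
      have h1 : (r.2 : ℝ) ≤ M * (M * (50 * M + 51) + 3) + 2 + (M * (40 * M + 40) + 10) := by
        exact_mod_cast h.1
      have h2 : (M : ℝ) ≤ M ^ 3 := by exact_mod_cast Nat.le_self_pow (by norm_num) M
      have h3 : (M : ℝ) ^ 2 ≤ M ^ 3 := by exact_mod_cast h0
      nlinarith
    · have : (m.matW M).mulVec x = m.vecQ M := by
        rw [hx, Matrix.mulVec_mulVec, Matrix.mul_nonsing_inv _ hu, Matrix.one_mulVec]
      exact congrFun this ⟨j, hj⟩
  · obtain ⟨g1, g2⟩ := hm'.2 h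
    rw [← solveOrthogonal_correct g1 g2]
    funext l
    exact hm'' l l.2

/-! ### The pseudo-inverse -/

section

variable {N M K : ℕ}

theorem toEuclideanLin_mul_apply (A : Matrix (Fin N) (Fin M) ℂ) (B : Matrix (Fin M) (Fin K) ℂ)
    (x : EuclideanSpace ℂ (Fin K)) : Matrix.toEuclideanLin (A * B) x =
      Matrix.toEuclideanLin A (Matrix.toEuclideanLin B x) := by
  simp [Matrix.toLpLin_apply, Matrix.mulVec_mulVec]

theorem inner_toEuclideanLin (A : Matrix (Fin N) (Fin M) ℂ) (x : EuclideanSpace ℂ (Fin M))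
    (y : EuclideanSpace ℂ (Fin N)) : inner ℂ (Matrix.toEuclideanLin A x) y =
      inner ℂ x (Matrix.toEuclideanLin A.conjTranspose y) := by
  rw [Matrix.toEuclideanLin_conjTranspose_eq_adjoint, LinearMap.adjoint_inner_right]

theorem norm_toEuclideanLin_le (A : Matrix (Fin N) (Fin M) ℂ) (x : EuclideanSpace ℂ (Fin M)) :
    ‖Matrix.toEuclideanLin A x‖ ≤ ‖A‖ * ‖x‖ := Matrix.l2_opNorm_mulVec A x

theorem toEuclideanLin_one_apply (x : EuclideanSpace ℂ (Fin M)) :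
    Matrix.toEuclideanLin (1 : Matrix (Fin M) (Fin M) ℂ) x = x := by
  simp [Matrix.toLpLin_one]

/-- The pseudo-inverse of `Aᴴ A`, and its relation to the pseudo-inverse of `A`. -/
theorem exists_gram_pinv (A : Matrix (Fin N) (Fin M) ℂ) :
    ∃ G : Matrix (Fin M) (Fin M) ℂ, G.IsHermitian ∧ pinv A = G * A.conjTranspose ∧
      (A.conjTranspose * A) * G * (A.conjTranspose * A) = A.conjTranspose * A ∧
      G * (A.conjTranspose * A) * G = G ∧
      (A.conjTranspose * A) * G = G * (A.conjTranspose * A) := by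
  set hA := Matrix.isHermitian_conjTranspose_mul_self A
  set V : Matrix (Fin M) (Fin M) ℂ := (hA.eigenvectorUnitary : Matrix (Fin M) (Fin M) ℂ) with hV
  have hVV : V.conjTranspose * V = 1 := Matrix.mem_unitaryGroup_iff'.1 hA.eigenvectorUnitary.2
  set D : Matrix (Fin M) (Fin M) ℂ := Matrix.diagonal fun i => (hA.eigenvalues i : ℂ) with hD
  set D' : Matrix (Fin M) (Fin M) ℂ := Matrix.diagonal fun i => ((hA.eigenvalues i)⁻¹ : ℂ) with hD'
  have hspec : A.conjTranspose * A = V * D * V.conjTranspose := by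
    have := hA.spectral_theorem
    rw [Unitary.conjStarAlgAut_apply] at this
    exact this
  have key : ∀ X Y : Matrix (Fin M) (Fin M) ℂ, V * X * V.conjTranspose * (V * Y * V.conjTranspose)
      = V * (X * Y) * V.conjTranspose := fun X Y => by
    simp only [Matrix.mul_assoc]
    rw [← Matrix.mul_assoc V.conjTranspose V, hVV, one_mul]
  refine ⟨V * D' * V.conjTranspose, ?_, rfl, ?_, ?_, ?_⟩
  · refine Matrix.isHermitian_mul_mul_conjTranspose _ ?_
    rw [Matrix.IsHermitian, hD', Matrix.diagonal_conjTranspose]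
    congr 1
    ext i
    rw [Pi.star_apply, ← Complex.ofReal_inv]
    exact Complex.conj_ofReal _
  · rw [hspec, key, key]
    congr 2
    rw [hD, hD', Matrix.diagonal_mul_diagonal, Matrix.diagonal_mul_diagonal]
    congr 1
    ext i
    exact mul_inv_mul_cancel _
  · rw [hspec, key, key]
    congr 2
    rw [hD, hD', Matrix.diagonal_mul_diagonal, Matrix.diagonal_mul_diagonal]
    congr 1
    ext i
    simpa using mul_inv_mul_cancel ((hA.eigenvalues i : ℂ)⁻¹)
  · rw [hspec, key, key, hD, hD', Matrix.diagonal_mul_diagonal, Matrix.diagonal_mul_diagonal]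
    simp only [mul_comm]

/-- `A` annihilates what its Gram matrix annihilates. -/
theorem mul_eq_zero_of_gram {A : Matrix (Fin N) (Fin M) ℂ} {X : Matrix (Fin M) (Fin K) ℂ}
    (h : A.conjTranspose * A * X = 0) : A * X = 0 := by
  open scoped ComplexOrder in
  rw [← Matrix.conjTranspose_mul_self_eq_zero, Matrix.conjTranspose_mul, Matrix.mul_assoc,
    ← Matrix.mul_assoc A.conjTranspose, h, Matrix.mul_zero]

/-- `G Aᴴ A - 1` is annihilated by the Gram matrix, hence by `A`. This is the Penrose identity `A A⁺
A = A`. -/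
theorem mul_gram_pinv_mul {A : Matrix (Fin N) (Fin M) ℂ} {G : Matrix (Fin M) (Fin M) ℂ}
    (h : A.conjTranspose * A * G * (A.conjTranspose * A) = A.conjTranspose * A) :
    A * (G * (A.conjTranspose * A)) = A := by
  have h0 := mul_eq_zero_of_gram (A := A) (X := G * (A.conjTranspose * A) - 1)
    (by rw [mul_sub, mul_one, ← Matrix.mul_assoc, h, sub_self])
  rw [Matrix.mul_sub, Matrix.mul_one, sub_eq_zero] at h0
  exact h0

theorem one_le_condNumber {A : Matrix (Fin N) (Fin M) ℂ} (hA : A ≠ 0) : 1 ≤ ‖A‖ * ‖pinv A‖ := by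
  obtain ⟨G, -, hp, hH, -, -⟩ := exists_gram_pinv A
  have h1 : A * pinv A * A = A := by
    rw [hp, Matrix.mul_assoc, Matrix.mul_assoc, mul_gram_pinv_mul hH]
  have h2 : ‖A‖ ≤ ‖A‖ * ‖pinv A‖ * ‖A‖ := by
    conv_lhs => rw [← h1]
    exact (Matrix.l2_opNorm_mul _ _).trans
      (mul_le_mul_of_nonneg_right (Matrix.l2_opNorm_mul _ _) (norm_nonneg _))
  have h3 : 0 < ‖A‖ := norm_pos_iff.2 hA
  nlinarith

/-- The normal equations. -/
theorem normal_equations (A : Matrix (Fin N) (Fin M) ℂ) (b : EuclideanSpace ℂ (Fin N)) :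
    Matrix.toEuclideanLin (A.conjTranspose * A) (optSol A b)
      = Matrix.toEuclideanLin A.conjTranspose b := by
  obtain ⟨G, hG, hp, hH, -, -⟩ := exists_gram_pinv A
  have h1 := congrArg Matrix.conjTranspose (mul_gram_pinv_mul hH)
  simp only [Matrix.conjTranspose_mul, Matrix.conjTranspose_conjTranspose, hG.eq] at h1
  rw [optSol, ← toEuclideanLin_mul_apply, hp, ← Matrix.mul_assoc, h1]

theorem iInf_norm_sub (A : Matrix (Fin N) (Fin M) ℂ) (b : EuclideanSpace ℂ (Fin N)) :
    ⨅ y : EuclideanSpace ℂ (Fin M), ‖Matrix.toEuclideanLin A y - b‖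
      = ‖Matrix.toEuclideanLin A (optSol A b) - b‖ := by
  refine le_antisymm (ciInf_le ⟨0, by rintro _ ⟨y, rfl⟩; positivity⟩ _) (le_ciInf fun y => ?_)
  have h1 : Matrix.toEuclideanLin A y - b = Matrix.toEuclideanLin A (y - optSol A b)
      + (Matrix.toEuclideanLin A (optSol A b) - b) := by
    rw [map_sub]; abel
  -- By the normal equations the optimal residual is orthogonal to the range of `A`, so Pythagoras
  -- applies.
  have h2 : inner ℂ (Matrix.toEuclideanLin A (y - optSol A b))
      (Matrix.toEuclideanLin A (optSol A b) - b) = 0 := by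
    rw [inner_toEuclideanLin, map_sub, ← toEuclideanLin_mul_apply, normal_equations, sub_self,
      inner_zero_right]
  have h3 := norm_add_sq (𝕜 := ℂ) (Matrix.toEuclideanLin A (y - optSol A b))
    (Matrix.toEuclideanLin A (optSol A b) - b)
  rw [h2, ← h1] at h3
  refine le_of_sq_le_sq ?_ (norm_nonneg _)
  rw [h3]
  simp only [map_zero]
  nlinarith [sq_nonneg ‖Matrix.toEuclideanLin A (y - optSol A b)‖]

theorem isApproxSolution_of_norm_le {A : Matrix (Fin N) (Fin M) ℂ} {b : EuclideanSpace ℂ (Fin N)}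
    {ε : ℝ} {x : EuclideanSpace ℂ (Fin M)}
    (h : ‖Matrix.toEuclideanLin A (x - optSol A b)‖ ≤ ε) : IsApproxSolution A b ε x := by
  rw [IsApproxSolution, iInf_norm_sub]
  refine le_trans (norm_sub_norm_le _ _) (le_trans (le_of_eq ?_) h)
  rw [map_sub]
  congr 1
  abel

/-! ### The regularized normal equations -/

theorem toEuclideanLin_shift_apply (A : Matrix (Fin N) (Fin M) ℂ) (μ : ℝ)
    (z : EuclideanSpace ℂ (Fin M)) :
    Matrix.toEuclideanLin (A.conjTranspose * A + (μ : ℂ) • 1) z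
      = Matrix.toEuclideanLin (A.conjTranspose * A) z + (μ : ℂ) • z := by
  rw [map_add, map_smul, LinearMap.add_apply, LinearMap.smul_apply, toEuclideanLin_one_apply]

theorem re_inner_shift (A : Matrix (Fin N) (Fin M) ℂ) (μ : ℝ) (z : EuclideanSpace ℂ (Fin M)) :
    RCLike.re (inner ℂ z (Matrix.toEuclideanLin (A.conjTranspose * A + (μ : ℂ) • 1) z))
      = ‖Matrix.toEuclideanLin A z‖ ^ 2 + μ * ‖z‖ ^ 2 := by
  rw [toEuclideanLin_shift_apply, inner_add_right, toEuclideanLin_mul_apply,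
    ← inner_toEuclideanLin, inner_smul_right, map_add, inner_self_eq_norm_sq]
  congr 1
  rw [inner_self_eq_norm_sq_to_K]
  simp [← Complex.ofReal_pow]

/-- Coercivity of `Aᴴ A + μ`, by Cauchy–Schwarz. It gives injectivity of the shifted matrix and
controls every perturbation below. -/
theorem mul_norm_le_norm_shift (A : Matrix (Fin N) (Fin M) ℂ) (μ : ℝ)
    (z : EuclideanSpace ℂ (Fin M)) :
    μ * ‖z‖ ≤ ‖Matrix.toEuclideanLin (A.conjTranspose * A + (μ : ℂ) • 1) z‖ := by
  have h1 := re_inner_shift A μ z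
  have h2 := re_inner_le_norm (𝕜 := ℂ) z
    (Matrix.toEuclideanLin (A.conjTranspose * A + (μ : ℂ) • 1) z)
  rw [h1] at h2
  obtain h | h := (norm_nonneg z).eq_or_lt
  · rw [← h, mul_zero]; exact norm_nonneg _
  · have := sq_nonneg ‖Matrix.toEuclideanLin A z‖
    refine le_of_mul_le_mul_left ?_ h
    nlinarith

theorem isUnit_det_of_injective {W : Matrix (Fin M) (Fin M) ℂ}
    (h : ∀ z, Matrix.toEuclideanLin W z = 0 → z = 0) : IsUnit W.det := by
  rw [isUnit_iff_ne_zero]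
  intro h0
  obtain ⟨v, hv, hv0⟩ := Matrix.exists_mulVec_eq_zero_iff.2 h0
  refine hv ?_
  have := h (WithLp.toLp 2 v) (by
    rw [Matrix.toLpLin_toLp, Matrix.toLin'_apply, hv0]; rfl)
  exact congrArg WithLp.ofLp this

/-- The bias of the regularized solution. -/
theorem norm_bias_le (A : Matrix (Fin N) (Fin M) ℂ) (b : EuclideanSpace ℂ (Fin N)) {μ : ℝ}
    (hμ0 : 0 < μ) {y : EuclideanSpace ℂ (Fin M)}
    (hy : Matrix.toEuclideanLin (A.conjTranspose * A + (μ : ℂ) • 1) y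
      = Matrix.toEuclideanLin A.conjTranspose b) :
    ‖Matrix.toEuclideanLin A (y - optSol A b)‖ ≤
      μ * (‖A‖ * (‖pinv A‖ * ‖pinv A‖ * (‖pinv A‖ * ‖b‖))) := by
  have hshift : Matrix.toEuclideanLin (A.conjTranspose * A + (μ : ℂ) • 1) (y - optSol A b)
      = -((μ : ℂ) • optSol A b) := by
    rw [map_sub, hy, toEuclideanLin_shift_apply, normal_equations]; abel
  obtain ⟨G, hG, hpG, -, hGG, hc⟩ := exists_gram_pinv A
  -- The source condition `x* = Aᴴ A w` improves the bias: in the energy identity for `y - x*` the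
  -- right-hand side becomes `-μ ⟨A (y - x*), A w⟩`, so a factor `‖A (y - x*)‖` can be cancelled and
  -- the bias is linear in `μ`.
  set w := Matrix.toEuclideanLin G (optSol A b) with hw
  have hHw : Matrix.toEuclideanLin (A.conjTranspose * A) w = optSol A b := by
    rw [hw, ← toEuclideanLin_mul_apply, hc, toEuclideanLin_mul_apply, normal_equations,
      ← toEuclideanLin_mul_apply, ← hpG, optSol]
  have hGn : ‖G‖ ≤ ‖pinv A‖ * ‖pinv A‖ := by
    have e : G = pinv A * (pinv A).conjTranspose := by
      rw [hpG, Matrix.conjTranspose_mul, Matrix.conjTranspose_conjTranspose, hG.eq]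
      conv_lhs => rw [← hGG]
      simp only [Matrix.mul_assoc]
    rw [e]
    refine (Matrix.l2_opNorm_mul _ _).trans ?_
    rw [Matrix.l2_opNorm_conjTranspose]
  have hsb : ‖optSol A b‖ ≤ ‖pinv A‖ * ‖b‖ := norm_toEuclideanLin_le _ _
  have hAw : ‖Matrix.toEuclideanLin A w‖ ≤ ‖A‖ * (‖pinv A‖ * ‖pinv A‖ * (‖pinv A‖ * ‖b‖)) :=
    (norm_toEuclideanLin_le A w).trans (mul_le_mul_of_nonneg_left
      ((norm_toEuclideanLin_le G _).trans
        (mul_le_mul hGn hsb (norm_nonneg _) (by positivity))) (norm_nonneg _))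
  set z := y - optSol A b with hz
  have h1 := re_inner_shift A μ z
  rw [hshift, ← hHw, toEuclideanLin_mul_apply, inner_neg_right, inner_smul_right,
    ← inner_toEuclideanLin] at h1
  have h2 := norm_inner_le_norm (𝕜 := ℂ) (Matrix.toEuclideanLin A z) (Matrix.toEuclideanLin A w)
  have h3 : RCLike.re (-((μ : ℂ) * inner ℂ (Matrix.toEuclideanLin A z)
      (Matrix.toEuclideanLin A w))) ≤ μ * (‖Matrix.toEuclideanLin A z‖ *
        ‖Matrix.toEuclideanLin A w‖) := by
    refine (RCLike.re_le_norm _).trans ?_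
    rw [norm_neg, norm_mul, Complex.norm_real, Real.norm_of_nonneg hμ0.le]
    exact mul_le_mul_of_nonneg_left h2 hμ0.le
  rw [h1] at h3
  have h4 : ‖Matrix.toEuclideanLin A z‖ ≤ μ * ‖Matrix.toEuclideanLin A w‖ := by
    obtain h | h := (norm_nonneg (Matrix.toEuclideanLin A z)).eq_or_lt
    · rw [← h]; positivity
    · have : 0 ≤ μ * ‖z‖ ^ 2 := by positivity
      refine le_of_mul_le_mul_left ?_ h
      nlinarith
  exact h4.trans (mul_le_mul_of_nonneg_left hAw hμ0.le)

/-- Solving the perturbed regularized normal equations yields an approximate solution of the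
least-squares problem. -/
theorem perturbed_solution {A : Matrix (Fin N) (Fin M) ℂ} (hA : A ≠ 0)
    {b : EuclideanSpace ℂ (Fin N)} (hb : 0 < ‖b‖) {ε μ τ : ℝ} (hε : 0 < ε)
    (hμ : μ = ε / (2 * ‖A‖ ^ 2 * ‖pinv A‖ ^ 4 * ‖b‖))
    (hτ : τ = ε ^ 2 / (16 * ‖pinv A‖ ^ 2 * condNumber A ^ 2 * ‖b‖ *
      (‖A‖ * (‖optSol A b‖ + 1) + ε)))
    {E : Matrix (Fin M) (Fin M) ℂ} {f : EuclideanSpace ℂ (Fin M)} (hE : ‖E‖ ≤ τ) (hf : ‖f‖ ≤ τ) :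
    IsUnit (A.conjTranspose * A + (μ : ℂ) • 1 + E).det ∧
      ∀ x, Matrix.toEuclideanLin (A.conjTranspose * A + (μ : ℂ) • 1 + E) x
        = Matrix.toEuclideanLin A.conjTranspose b + f → IsApproxSolution A b ε x := by
  have hκ := one_le_condNumber hA
  rw [condNumber] at hτ
  have ha : 0 < ‖A‖ := norm_pos_iff.2 hA
  have hp : 0 < ‖pinv A‖ := by
    by_contra! h
    have : ‖pinv A‖ = 0 := le_antisymm h (norm_nonneg _)
    rw [this, mul_zero] at hκ
    linarith
  set a := ‖A‖
  set p := ‖pinv A‖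
  set β := ‖b‖
  set s := ‖optSol A b‖ with hs
  have hs0 : 0 ≤ s := norm_nonneg _
  have hR : 0 < a * (s + 1) + ε := by positivity
  set R := a * (s + 1) + ε with hRdef
  have hμ0 : 0 < μ := by rw [hμ]; positivity
  -- The admissible error is the fraction `θ = ε / (8 R) ≤ 1 / 8` of the coercivity constant `μ`.
  have hτμ : τ = ε / (8 * R) * μ := by
    rw [hτ, hμ]; field_simp; norm_num
  set θ := ε / (8 * R) with hθ
  have hθ0 : 0 < θ := by positivity
  have hθR : θ * (8 * R) = ε := by rw [hθ]; field_simp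
  have hθ8 : θ ≤ 1 / 8 := by
    have : ε ≤ R := by rw [hRdef]; nlinarith
    rw [hθ, div_le_iff₀ (by positivity)]; linarith
  have hEz : ∀ z, ‖Matrix.toEuclideanLin E z‖ ≤ θ * μ * ‖z‖ := fun z =>
    (norm_toEuclideanLin_le E z).trans
      (mul_le_mul_of_nonneg_right (hE.trans hτμ.le) (norm_nonneg _))
  refine ⟨isUnit_det_of_injective fun z hz => ?_, fun x hx => ?_⟩
  · rw [map_add, LinearMap.add_apply, add_eq_zero_iff_eq_neg] at hz
    have h1 := mul_norm_le_norm_shift A μ z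
    rw [hz, norm_neg] at h1
    have h2 := h1.trans (hEz z)
    by_contra h0
    have h3 : 0 < μ * ‖z‖ := mul_pos hμ0 (norm_pos_iff.2 h0)
    nlinarith
  · -- the exact solution of the regularized equations
    obtain ⟨y, hy⟩ : ∃ y, Matrix.toEuclideanLin (A.conjTranspose * A + (μ : ℂ) • 1) y
        = Matrix.toEuclideanLin A.conjTranspose b := by
      have hinj : Function.Injective
          (Matrix.toEuclideanLin (A.conjTranspose * A + (μ : ℂ) • 1)) := by
        rw [← LinearMap.ker_eq_bot, LinearMap.ker_eq_bot']
        intro z hz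
        have h1 := mul_norm_le_norm_shift A μ z
        rw [hz, norm_zero] at h1
        exact norm_le_zero_iff.1 (by nlinarith)
      exact LinearMap.surjective_of_injective hinj _
    have hshift : Matrix.toEuclideanLin (A.conjTranspose * A + (μ : ℂ) • 1) (y - optSol A b)
        = -((μ : ℂ) • optSol A b) := by
      rw [map_sub, hy, toEuclideanLin_shift_apply, normal_equations]; abel
    have hys : ‖y - optSol A b‖ ≤ s := by
      have h1 := mul_norm_le_norm_shift A μ (y - optSol A b)
      rw [hshift, norm_neg, norm_smul, Complex.norm_real, Real.norm_of_nonneg hμ0.le] at h1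
      exact le_of_mul_le_mul_left h1 hμ0
    have hyn : ‖y‖ ≤ 2 * s := by
      have := norm_le_norm_add_norm_sub' y (optSol A b)
      linarith
    -- its distance from the solution of the perturbed equations
    have hxy : ‖x - y‖ ≤ θ * (1 + ‖x‖) := by
      have h1 := mul_norm_le_norm_shift A μ (x - y)
      -- Subtracting the two systems leaves `f - E x`, whose norm is at most `θ μ (1 + ‖x‖)`;
      -- coercivity divides by `μ`.
      have h2 : Matrix.toEuclideanLin (A.conjTranspose * A + (μ : ℂ) • 1) (x - y)
          = f - Matrix.toEuclideanLin E x := by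
        rw [map_add, LinearMap.add_apply] at hx
        rw [map_sub, hy, eq_sub_of_add_eq hx]; abel
      rw [h2] at h1
      have h3 := norm_sub_le f (Matrix.toEuclideanLin E x)
      have h4 := hEz x
      have h5 : ‖f‖ ≤ θ * μ := hf.trans hτμ.le
      refine le_of_mul_le_mul_left ?_ hμ0
      nlinarith
    -- The bound on `x - y` involves `‖x‖` itself. As `θ ≤ 1 / 8`, this term is absorbed on the
    -- left, using `‖y‖ ≤ 2 ‖x*‖`.
    have hxn : 7 * (1 + ‖x‖) ≤ 16 * (1 + s) := by
      have h1 : ‖x‖ ≤ ‖y‖ + ‖x - y‖ := norm_le_norm_add_norm_sub' x y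
      have h2 : θ * (1 + ‖x‖) ≤ 1 / 8 * (1 + ‖x‖) :=
        mul_le_mul_of_nonneg_right hθ8 (by positivity)
      linarith
    have hAxy : ‖Matrix.toEuclideanLin A (x - y)‖ ≤ ε / 2 := by
      refine (norm_toEuclideanLin_le A _).trans ?_
      have h1 : a * ‖x - y‖ ≤ a * (θ * (1 + ‖x‖)) := mul_le_mul_of_nonneg_left hxy ha.le
      have h2 : a * θ * (7 * (1 + ‖x‖)) ≤ a * θ * (16 * (1 + s)) :=
        mul_le_mul_of_nonneg_left hxn (by positivity)
      have h3 : θ * (a * (1 + s)) ≤ θ * R := by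
        refine mul_le_mul_of_nonneg_left ?_ hθ0.le
        rw [hRdef]; linarith
      nlinarith
    -- the bias of the regularization
    have hAy : ‖Matrix.toEuclideanLin A (y - optSol A b)‖ ≤ ε / 2 := by
      have hAw := norm_bias_le A b hμ0 hy
      -- The choice of `μ` makes the bias bound equal to `ε / (2 κ)`, and `κ ≥ 1`.
      have h5 : μ * (a * (p * p * (p * β))) * (a * p) = ε / 2 := by
        rw [hμ]; field_simp
      have h6 : μ * (a * (p * p * (p * β))) ≤ ε / 2 := by
        have : 0 < μ * (a * (p * p * (p * β))) := by positivity
        nlinarith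
      exact hAw.trans h6
    refine isApproxSolution_of_norm_le ?_
    have e : x - optSol A b = (x - y) + (y - optSol A b) := by abel
    rw [e, map_add]
    exact (norm_add_le _ _).trans (by linarith)

end

/-! ### Nets -/

section

variable {M : ℕ}

/-- A `1/2`-net of the unit ball. -/
theorem exists_net (M : ℕ) : ∃ s : Finset (EuclideanSpace ℂ (Fin M)), s.card ≤ 25 ^ M ∧
    (∀ u ∈ s, ‖u‖ ≤ 1) ∧ ∀ x, ‖x‖ ≤ 1 → ∃ u ∈ s, ‖x - u‖ ≤ 1 / 2 := by
  let P : Finset (EuclideanSpace ℂ (Fin M)) → Prop := fun s =>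
    (∀ u ∈ s, ‖u‖ ≤ 1) ∧ ∀ u ∈ s, ∀ v ∈ s, u ≠ v → 1 / 2 ≤ ‖u - v‖
  -- After scaling by `2` the points lie in a ball of radius `2` with mutual distance at least `1`,
  -- so there are at most `5` to the real dimension `2 M` of them.
  have hcard : ∀ s, P s → s.card ≤ 25 ^ M := fun s hs => by
    have hinj : Function.Injective fun u : EuclideanSpace ℂ (Fin M) => (2 : ℝ) • u :=
      smul_right_injective _ two_ne_zero
    have h := Besicovitch.card_le_of_separated (s.map ⟨_, hinj⟩) (fun c hc => ?_)
      (fun c hc d hd hcd => ?_)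
    · rw [Finset.card_map] at h
      have hr : Module.finrank ℝ (EuclideanSpace ℂ (Fin M)) = 2 * M := by
        rw [finrank_real_of_complex, finrank_euclideanSpace, Fintype.card_fin]
      rw [hr, pow_mul] at h
      simpa using h
    · obtain ⟨u, hu, rfl⟩ := Finset.mem_map.1 hc
      have := hs.1 u hu
      simp only [Function.Embedding.coeFn_mk, norm_smul, Real.norm_ofNat]
      linarith
    · obtain ⟨u, hu, rfl⟩ := Finset.mem_map.1 hc
      obtain ⟨v, hv, rfl⟩ := Finset.mem_map.1 hd
      have := hs.2 u hu v hv fun e => hcd (by rw [e])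
      simp only [Function.Embedding.coeFn_mk, ← smul_sub, norm_smul, Real.norm_ofNat]
      linarith
  have hbdd : BddAbove {k | ∃ s, P s ∧ s.card = k} :=
    ⟨25 ^ M, by rintro _ ⟨s, hs, rfl⟩; exact hcard s hs⟩
  have hne : {k | ∃ s, P s ∧ s.card = k}.Nonempty := ⟨0, ∅, by simp [P], by simp⟩
  obtain ⟨s, hs, hmax⟩ := Nat.sSup_mem hne hbdd
  refine ⟨s, hcard s hs, hs.1, fun x hx => ?_⟩
  -- The net is a separated set of maximal cardinality; a point far from all of its members could be
  -- added to it.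
  by_contra! h
  have hxs : x ∉ s := fun hxs => by
    have := h x hxs
    norm_num at this
  have h1 : P (insert x s) := by
    refine ⟨?_, ?_⟩
    · intro u hu
      obtain rfl | hu := Finset.mem_insert.1 hu
      · exact hx
      · exact hs.1 u hu
    · intro u hu v hv huv
      obtain hu' | hu' := Finset.mem_insert.1 hu <;> obtain hv' | hv' := Finset.mem_insert.1 hv
      · exact absurd (hu'.trans hv'.symm) huv
      · rw [hu']; exact (h v hv').le
      · rw [hv', norm_sub_rev]; exact (h u hu').le
      · exact hs.2 u hu' v hv' huv
  have h2 := le_csSup hbdd ⟨_, h1, rfl⟩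
  rw [← hmax, Finset.card_insert_of_notMem hxs] at h2
  omega

variable {s : Finset (EuclideanSpace ℂ (Fin M))} {t : ℝ}

/-- Replacing the direction `y / ‖y‖` by a net point loses at most `‖y‖ / 2`, which is absorbed on
the left. -/
theorem norm_le_of_net (hs : ∀ x, ‖x‖ ≤ 1 → ∃ u ∈ s, ‖x - u‖ ≤ 1 / 2) (ht : 0 ≤ t)
    {y : EuclideanSpace ℂ (Fin M)} (h : ∀ u ∈ s, (inner ℂ u y).re ≤ t) : ‖y‖ ≤ 2 * t := by
  obtain rfl | hy := eq_or_ne y 0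
  · simpa using ht
  have hy0 : 0 < ‖y‖ := norm_pos_iff.2 hy
  obtain ⟨u, hu, hxu⟩ := hs (((‖y‖⁻¹ : ℝ) : ℂ) • y) (by
    rw [norm_smul, Complex.norm_real, norm_inv, norm_norm, inv_mul_cancel₀ hy0.ne'])
  have h1 : (inner ℂ (((‖y‖⁻¹ : ℝ) : ℂ) • y) y : ℂ) = (‖y‖ : ℝ) := by
    rw [inner_smul_left, inner_self_eq_norm_sq_to_K, Complex.conj_ofReal, Complex.ofReal_inv]
    have : (‖y‖ : ℂ) ≠ 0 := by exact_mod_cast hy0.ne'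
    field_simp
    rfl
  have h2 : (inner ℂ (((‖y‖⁻¹ : ℝ) : ℂ) • y) y : ℂ)
      = inner ℂ u y + inner ℂ (((‖y‖⁻¹ : ℝ) : ℂ) • y - u) y := by
    rw [inner_sub_left]; ring
  rw [h1] at h2
  have h3 := congrArg Complex.re h2
  rw [Complex.ofReal_re, Complex.add_re] at h3
  have h4 := (Complex.re_le_norm _).trans
    (norm_inner_le_norm (𝕜 := ℂ) (((‖y‖⁻¹ : ℝ) : ℂ) • y - u) y)
  have h5 := h u hu
  nlinarith

theorem opNorm_le_of_net (hs : ∀ x, ‖x‖ ≤ 1 → ∃ u ∈ s, ‖x - u‖ ≤ 1 / 2) (ht : 0 ≤ t)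
    {E : Matrix (Fin M) (Fin M) ℂ}
    (h : ∀ u ∈ s, ∀ v ∈ s, (inner ℂ u (Matrix.toEuclideanLin E v)).re ≤ t) : ‖E‖ ≤ 4 * t := by
  have h1 : ∀ v ∈ s, ‖Matrix.toEuclideanLin E v‖ ≤ 2 * t := fun v hv =>
    norm_le_of_net hs ht fun u hu => h u hu v hv
  have h2 : ∀ x, ‖x‖ ≤ 1 → ‖Matrix.toEuclideanLin E x‖ ≤ 2 * t + ‖E‖ * (1 / 2) := fun x hx => by
    obtain ⟨u, hu, hxu⟩ := hs x hx
    have e : Matrix.toEuclideanLin E x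
        = Matrix.toEuclideanLin E u + Matrix.toEuclideanLin E (x - u) := by rw [map_sub]; abel
    rw [e]
    exact (norm_add_le _ _).trans (add_le_add (h1 u hu) ((norm_toEuclideanLin_le E _).trans
      (mul_le_mul_of_nonneg_left hxu (norm_nonneg _))))
  have h3 : ‖E‖ ≤ 2 * t + ‖E‖ * (1 / 2) := by
    conv_lhs => rw [Matrix.l2_opNorm_def]
    refine ContinuousLinearMap.opNorm_le_bound _ (by positivity) fun x => ?_
    obtain rfl | hx := eq_or_ne x 0
    · simp
    have hx0 : 0 < ‖x‖ := norm_pos_iff.2 hx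
    have h4 := h2 (((‖x‖⁻¹ : ℝ) : ℂ) • x) (by
      rw [norm_smul, Complex.norm_real, norm_inv, norm_norm, inv_mul_cancel₀ hx0.ne'])
    rw [map_smul, norm_smul, Complex.norm_real, norm_inv, norm_norm, inv_mul_le_iff₀ hx0] at h4
    rw [mul_comm]
    exact h4
  linarith

end

/-! ### The distribution of a Hadamard test -/

/-- The measured bit is `0` with probability `(1 + ν) / 2`. -/
def HasBias {n : ℕ} (c : Circuit (n + 1)) (ν : ℝ) : Prop :=
  ∃ p₀ p₁ : ℝ, 0 ≤ p₀ ∧ 0 ≤ p₁ ∧ p₀ + p₁ = 1 ∧ p₀ - p₁ = ν ∧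
    ∀ F : Fin 2 → ENNReal,
      expect (c.measure 0) F = ENNReal.ofReal p₀ * F 0 + ENNReal.ofReal p₁ * F 1

theorem expect_measure {n : ℕ} (c : Circuit (n + 1)) (F : Fin 2 → ENNReal) :
    expect (c.measure 0) F = ENNReal.ofReal (∑ y, ‖c.state (Fin.cons 0 y)‖ ^ 2) * F 0 +
      ENNReal.ofReal (∑ y, ‖c.state (Fin.cons 1 y)‖ ^ 2) * F 1 := by
  rw [Circuit.measure, expect_map, expect, tsum_fintype, sum_basis_succ, Fin.sum_univ_two]
  simp only [PMF.ofFintype_apply, Fin.cons_zero, ← Finset.sum_mul]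
  rw [ENNReal.ofReal_sum_of_nonneg fun _ _ => by positivity,
    ENNReal.ofReal_sum_of_nonneg fun _ _ => by positivity]

theorem onAncilla_mul_apply {n : ℕ} (g : Matrix (Fin 2) (Fin 2) ℂ)
    (X : Matrix (Basis (n + 1)) (Basis (n + 1)) ℂ) (z : Fin 2) (y : Basis n) (w : Basis (n + 1)) :
    (onAncilla (n := n) g * X) (Fin.cons z y) w = ∑ z', g z z' * X (Fin.cons z' y) w := by
  rw [Matrix.mul_apply, sum_basis_succ]
  simp [onAncilla]

theorem mul_onAncilla_apply_zero {n : ℕ} (g : Matrix (Fin 2) (Fin 2) ℂ)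
    (X : Matrix (Basis (n + 1)) (Basis (n + 1)) ℂ) (w : Basis (n + 1)) :
    (X * onAncilla (n := n) g) w 0 = ∑ z', X w (Fin.cons z' 0) * g z' 0 := by
  rw [Matrix.mul_apply, sum_basis_succ]
  have h : Fin.tail (0 : Basis (n + 1)) = 0 := rfl
  simp [onAncilla, h]

/-- The relative phase introduced by the phase gate. -/
def Part.phase : Part → ℂ
  | .re => 1
  | .im => -Complex.I

/-- The real or imaginary part of a number. -/
def Part.value : Part → ℂ → ℝ
  | .re => Complex.re
  | .im => Complex.im

theorem hadamardTest_apply_zero {n : ℕ} (p : Part) (U : Matrix (Basis n) (Basis n) ℂ) (z : Fin 2)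
    (y : Basis n) : hadamardTest p U (Fin.cons z y) 0 =
      1 / 2 * ((if y = 0 then 1 else 0) + (if z = 0 then 1 else -1) * (p.phase * U y 0)) := by
  have hs : ((Real.sqrt 2 : ℝ) : ℂ)⁻¹ * ((Real.sqrt 2 : ℝ) : ℂ)⁻¹ = 1 / 2 := by
    rw [← mul_inv, ← Complex.ofReal_mul, Real.mul_self_sqrt (by norm_num)]; norm_num
  have h1 : ∀ z' : Fin 2, (controlled U * onAncilla (n := n) hadamardGate) (Fin.cons z' y) 0
      = (if z' = 1 then U y 0 else if y = 0 then 1 else 0) * ((Real.sqrt 2 : ℝ) : ℂ)⁻¹ := by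
    intro z'
    rw [mul_onAncilla_apply_zero]
    fin_cases z' <;> simp [controlled, hadamardGate, Matrix.one_apply]
  rw [hadamardTest, Matrix.mul_assoc, Matrix.mul_assoc, onAncilla_mul_apply]
  simp only [onAncilla_mul_apply, h1, Fin.sum_univ_two]
  generalize (if y = 0 then (1 : ℂ) else 0) = δ
  have key : ∀ ω : ℂ, (δ + ω) * (((Real.sqrt 2 : ℝ) : ℂ)⁻¹ * ((Real.sqrt 2 : ℝ) : ℂ)⁻¹)
      = 1 / 2 * (δ + ω) := fun ω => by rw [hs, mul_comm]
  cases p <;> fin_cases z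
  · refine Eq.trans ?_ (key (U y 0)) |>.trans ?_
    · simp [hadamardGate, phaseGate]; ring
    · simp [Part.phase]
  · refine Eq.trans ?_ (key (-U y 0)) |>.trans ?_
    · simp [hadamardGate, phaseGate]; ring
    · simp [Part.phase]
  · refine Eq.trans ?_ (key (-Complex.I * U y 0)) |>.trans ?_
    · simp [hadamardGate, phaseGate]; ring
    · simp [Part.phase]
  · refine Eq.trans ?_ (key (Complex.I * U y 0)) |>.trans ?_
    · simp [hadamardGate, phaseGate]; ring
    · simp [Part.phase]

theorem sum_norm_sq_column {n : ℕ} {U : Matrix (Basis n) (Basis n) ℂ}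
    (hU : U ∈ Matrix.unitaryGroup (Basis n) ℂ) : ∑ y, ‖U y 0‖ ^ 2 = 1 := by
  have h := congrFun (congrFun (Matrix.mem_unitaryGroup_iff'.1 hU) 0) 0
  rw [Matrix.mul_apply, Matrix.one_apply_eq] at h
  have h2 : ((∑ x, ‖U x 0‖ ^ 2 : ℝ) : ℂ) = 1 := by
    rw [← h]
    push_cast
    refine Finset.sum_congr rfl fun x _ => ?_
    rw [Matrix.star_apply]
    exact (Complex.conj_mul' _).symm
  exact_mod_cast h2

/-- The amplitudes are half the sum or difference of `|0⟩` and the phased state `U |0⟩`. The two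
unit vectors contribute the constant, and the cross term survives only at the basis state `0`, where
the phase selects the real or the imaginary part. -/
theorem sum_norm_sq_test {n : ℕ} {U : Matrix (Basis n) (Basis n) ℂ}
    (hU : U ∈ Matrix.unitaryGroup (Basis n) ℂ) (p : Part) (z : Fin 2) :
    ∑ y, ‖hadamardTest p U (Fin.cons z y) 0‖ ^ 2
      = (1 + (if z = 0 then 1 else -1) * p.value (U 0 0)) / 2 := by
  have hsum := sum_norm_sq_column hU
  have key : ∀ y, ‖hadamardTest p U (Fin.cons z y) 0‖ ^ 2 =
      1 / 4 * ‖U y 0‖ ^ 2 + (if y = 0 then 1 / 4 + 1 / 2 *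
        ((if z = 0 then 1 else -1) * p.value (U 0 0)) else 0) := by
    intro y
    rw [hadamardTest_apply_zero, ← Complex.normSq_eq_norm_sq, ← Complex.normSq_eq_norm_sq]
    by_cases hy : y = 0
    · subst hy
      cases p <;> fin_cases z <;>
        simp [Part.phase, Part.value, Complex.normSq_apply] <;> ring
    · cases p <;> fin_cases z <;>
        simp [Part.phase, hy, Complex.normSq_apply] <;> ring
  simp only [key, Finset.sum_add_distrib, ← Finset.mul_sum, hsum, Finset.sum_ite_eq',
    Finset.mem_univ, if_true]
  ring

theorem hasBias_hadamardTest {n : ℕ} {c : Circuit (n + 1)} {U : Matrix (Basis n) (Basis n) ℂ}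
    (hU : U ∈ Matrix.unitaryGroup (Basis n) ℂ) {p : Part} (hc : c.mat = hadamardTest p U) :
    HasBias c (p.value (U 0 0)) := by
  refine ⟨∑ y, ‖c.state (Fin.cons 0 y)‖ ^ 2, ∑ y, ‖c.state (Fin.cons 1 y)‖ ^ 2,
    by positivity, by positivity, ?_, ?_, expect_measure c⟩ <;>
  · simp only [Circuit.state, hc, sum_norm_sq_test hU]
    simp
    ring

/-- The moment generating function of the centered outcome of a test. -/
theorem mgf_le {p₀ p₁ : ℝ} (h₀ : 0 ≤ p₀) (h₁ : 0 ≤ p₁) (h : p₀ + p₁ = 1) (a : ℝ) :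
    p₀ * Real.exp (a * (1 - (p₀ - p₁))) + p₁ * Real.exp (a * (-1 - (p₀ - p₁)))
      ≤ Real.exp (2 * a ^ 2) := by
  -- Symmetrization: by Jensen's inequality, the factor that subtracts the mean is at most the
  -- exponential moment of minus an independent copy. The difference of two copies takes the values
  -- `0` and `±2`, whence `cosh (2 a)`.
  have hj : Real.exp (-(a * (p₀ - p₁))) ≤ p₀ * Real.exp (-a) + p₁ * Real.exp a := by
    have := convexOn_exp.2 (Set.mem_univ (-a)) (Set.mem_univ a) h₀ h₁ h
    simp only [smul_eq_mul] at this
    refine le_trans (le_of_eq ?_) this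
    congr 1
    ring
  have e1 : Real.exp (a * (1 - (p₀ - p₁))) = Real.exp a * Real.exp (-(a * (p₀ - p₁))) := by
    rw [← Real.exp_add]; congr 1; ring
  have e2 : Real.exp (a * (-1 - (p₀ - p₁))) = Real.exp (-a) * Real.exp (-(a * (p₀ - p₁))) := by
    rw [← Real.exp_add]; congr 1; ring
  have hc : Real.cosh (2 * a) ≤ Real.exp (2 * a ^ 2) := by
    refine (Real.cosh_le_exp_half_sq _).trans (le_of_eq ?_)
    congr 1; ring
  have h1c := Real.one_le_cosh (2 * a)
  have e3 : Real.exp a * Real.exp (-a) = 1 := by rw [← Real.exp_add]; simp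
  have e4 : Real.cosh (2 * a) = (Real.exp a ^ 2 + Real.exp (-a) ^ 2) / 2 := by
    rw [Real.cosh_eq, ← Real.exp_nat_mul, ← Real.exp_nat_mul]
    congr 3; push_cast; ring
  have hpos : 0 ≤ p₀ * Real.exp a + p₁ * Real.exp (-a) := by positivity
  calc _ = (p₀ * Real.exp a + p₁ * Real.exp (-a)) * Real.exp (-(a * (p₀ - p₁))) := by
        rw [e1, e2]; ring
    _ ≤ (p₀ * Real.exp a + p₁ * Real.exp (-a)) * (p₀ * Real.exp (-a) + p₁ * Real.exp a) :=
        mul_le_mul_of_nonneg_left hj hpos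
    _ = (p₀ ^ 2 + p₁ ^ 2) + 2 * p₀ * p₁ * Real.cosh (2 * a) := by
        rw [e4]; linear_combination (p₀ ^ 2 + p₁ ^ 2) * e3
    _ ≤ (p₀ ^ 2 + p₁ ^ 2) * Real.cosh (2 * a) + 2 * p₀ * p₁ * Real.cosh (2 * a) := by
        nlinarith [sq_nonneg p₀, sq_nonneg p₁]
    _ = Real.cosh (2 * a) := by
        rw [← add_mul, show p₀ ^ 2 + p₁ ^ 2 + 2 * p₀ * p₁ = (p₀ + p₁) ^ 2 by ring, h]; ring
    _ ≤ _ := hc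

theorem HasBias.expect_exp_le {n : ℕ} {c : Circuit (n + 1)} {ν : ℝ} (h : HasBias c ν) (a : ℝ) :
    expect (c.measure 0) (fun z => ENNReal.ofReal
      (Real.exp (a * (1 - 2 * ((z : ℕ) : ℝ) - ν) - 2 * a ^ 2))) ≤ 1 := by
  obtain ⟨p₀, p₁, h₀, h₁, hs, hd, hF⟩ := h
  rw [hF, ← ENNReal.ofReal_mul h₀, ← ENNReal.ofReal_mul h₁, ← ENNReal.ofReal_add (by positivity)
    (by positivity), ← ENNReal.ofReal_one]
  refine ENNReal.ofReal_le_ofReal ?_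
  have := mgf_le h₀ h₁ hs a
  rw [hd] at this
  simp only [Real.exp_sub, Fin.val_zero, Fin.val_one, Nat.cast_zero, Nat.cast_one]
  rw [← mul_div_assoc, ← mul_div_assoc, ← add_div, div_le_one (Real.exp_pos _)]
  refine le_trans (le_of_eq ?_) this
  norm_num

/-! ### Exponential moments of the estimates -/

/-- `m'` differs from `m` only in the memory that `estimate` writes to. -/
structure AgreesForEstimate (m m' : Mem) : Prop where
  nat : ∀ r, r ≠ rT → m'.nat r = m.nat r
  arr : ∀ a, a ≠ aAcc → a ≠ aBit → m'.arr a = m.arr a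

theorem AgreesForEstimate.refl (m : Mem) : AgreesForEstimate m m :=
  ⟨fun _ _ => rfl, fun _ _ _ => rfl⟩

theorem AgreesForEstimate.setNat {m m' : Mem} (h : AgreesForEstimate m m') (t : ℕ) :
    AgreesForEstimate m (m'.setNat rT t) :=
  ⟨fun r hr => by rw [Mem.setNat_nat_of_ne _ _ hr, h.nat r hr], h.arr⟩

theorem AgreesForEstimate.setArr {m m' : Mem} (h : AgreesForEstimate m m') {a : ℕ}
    (ha : a = aAcc ∨ a = aBit) (i j : ℕ) (z : ℂ) : AgreesForEstimate m (m'.setArr a i j z) :=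
  ⟨h.nat, fun a' h1 h2 => by
    rw [Mem.setArr_arr_of_ne _ _ _ _ (by rintro rfl; exact ha.elim h1 h2), h.arr a' h1 h2]⟩

section

variable {n : ℕ} {circ : ℕ → ℕ → Part → Circuit (n + 1)}

/-- The exponential moment of one averaged complex estimate. The statement bounds a general
expectation `H`, so that exponentials of errors stored earlier can be carried along in the factor
`C`. -/
theorem wp_estimate_le {m : Mem} {S : ℕ} (hS : m.nat rS = S) (hS0 : 0 < S) {e f : NExpr} {E F : ℕ}
    (he : ∀ m', AgreesForEstimate m m' → e.eval m' = E)
    (hf : ∀ m', AgreesForEstimate m m' → f.eval m' = F) {μ : ℂ}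
    (hre : HasBias (circ E F .re) μ.re) (him : HasBias (circ E F .im) μ.im) (α : ℂ)
    {H : Mem → ENNReal} {C : ENNReal}
    (hH : ∀ m', AgreesForEstimate m m' → H m' ≤ C * ENNReal.ofReal
      (Real.exp ((α * (m'.arr aAcc 0 0 - μ)).re - 2 * ‖α‖ ^ 2 / S))) :
    wp circ (estimate e f) H m ≤ C := by
  have hS' : (S : ℝ) ≠ 0 := by exact_mod_cast hS0.ne'
  have hSc : (S : ℂ) ≠ 0 := by exact_mod_cast hS0.ne'
  set a : ℂ := α / S with ha
  have han : ‖a‖ ^ 2 = ‖α‖ ^ 2 / S ^ 2 := by rw [ha, norm_div, Complex.norm_natCast, div_pow]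
  -- The infimum over a proposition is `⊤` where the proposition fails. This builds the memory
  -- invariant into the potential, which then needs to be bounded only on memories that satisfy it.
  let Φ : ℕ → Mem → ENNReal := fun t m' => ⨅ _ : AgreesForEstimate m m', C * ENNReal.ofReal
    (Real.exp ((a * (m'.arr aAcc 0 0 - t * μ)).re - 2 * t * ‖a‖ ^ 2))
  rw [estimate, wp_seq, wp_setSc, wp_seq]
  set m₁ := m.setArr aAcc 0 0 (CExpr.eval m (.int 0))
  have hm₁ : AgreesForEstimate m m₁ := (AgreesForEstimate.refl m).setArr (.inl rfl) _ _ _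
  calc _ ≤ wp circ _ (Φ S) m₁ := by
        refine wp_mono fun m' => le_iInf fun h => ?_
        rw [wp_setSc]
        refine (hH _ (h.setArr (.inl rfl) _ _ _)).trans (le_of_eq ?_)
        have h1 : m'.nat rS = S := (h.nat rS (by decide)).trans hS
        rw [Mem.setArr_arr_self]
        simp only [CExpr.eval, sc, NExpr.eval, h1]
        congr 4
        · congr 1
          rw [ha]; field_simp
        · rw [han]; field_simp
    _ ≤ Φ 0 m₁ := by
        refine wp_loop_le (by simpa [NExpr.eval] using (hm₁.nat rS (by decide)).trans hS) Φ
          fun t ht m' => le_iInf fun h => ?_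
        have h0 := h.setNat t
        simp only [wp_seq, wp_test, wp_setSc]
        rw [he _ h0, hf _ h0]
        -- One round multiplies the potential by a factor for the real test with parameter `a.re`
        -- and one for the imaginary test with parameter `-a.im`, since `Re (a i ξ) = -a.im ξ` for
        -- real `ξ`. The two compensators add up to `2 ‖a‖ ^ 2`.
        have key : ∀ z z' : Fin 2, ∀ m'' : Mem, AgreesForEstimate m m'' →
            m''.arr aAcc 0 0 = m'.arr aAcc 0 0 + (1 - 2 * ((z : ℕ) : ℂ))
              + Complex.I * (1 - 2 * ((z' : ℕ) : ℂ)) → Φ (t + 1) m'' ≤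
            C * ENNReal.ofReal
              (Real.exp ((a * (m'.arr aAcc 0 0 - t * μ)).re - 2 * t * ‖a‖ ^ 2)) *
              ENNReal.ofReal (Real.exp (a.re * (1 - 2 * ((z : ℕ) : ℝ) - μ.re) - 2 * a.re ^ 2)) *
              ENNReal.ofReal
                (Real.exp (-a.im * (1 - 2 * ((z' : ℕ) : ℝ) - μ.im) - 2 * (-a.im) ^ 2)) := by
          intro z z' m'' hm'' hacc
          refine iInf_le_of_le hm'' ?_
          rw [mul_assoc C, mul_assoc C, ← ENNReal.ofReal_mul (Real.exp_pos _).le,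
            ← Real.exp_add, ← ENNReal.ofReal_mul (Real.exp_pos _).le, ← Real.exp_add, hacc]
          refine le_of_eq ?_
          congr 3
          have hn : ‖a‖ ^ 2 = a.re ^ 2 + a.im ^ 2 := by
            rw [← Complex.normSq_eq_norm_sq, Complex.normSq_apply]; ring
          rw [hn]
          simp
          ring
        have hstep : ∀ z : Fin 2, ∀ m'' : Mem, AgreesForEstimate m m'' →
            m''.arr aAcc 0 0 = m'.arr aAcc 0 0 + (1 - 2 * ((z : ℕ) : ℂ)) →
            expect ((circ E F .im).measure 0) (fun z' : Fin 2 => Φ (t + 1)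
              ((m''.setArr aBit 0 0 ((z' : ℕ) : ℂ)).setArr aAcc 0 0
                (m''.arr aAcc 0 0 + Complex.I * (1 - 2 * ((z' : ℕ) : ℂ))))) ≤
            C * ENNReal.ofReal
              (Real.exp ((a * (m'.arr aAcc 0 0 - t * μ)).re - 2 * t * ‖a‖ ^ 2)) *
              ENNReal.ofReal (Real.exp (a.re * (1 - 2 * ((z : ℕ) : ℝ) - μ.re) - 2 * a.re ^ 2)) := by
          intro z m'' hm'' hacc
          refine (expect_mono fun z' _ => key z z' _
            ((hm''.setArr (.inr rfl) _ _ _).setArr (.inl rfl) _ _ _)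
            (by rw [Mem.setArr_arr_self, hacc])).trans ?_
          rw [expect_const_mul]
          exact mul_le_of_le_one_right' (him.expect_exp_le _)
        refine (expect_mono fun z _ => ?_).trans ((expect_const_mul _ _ _).trans_le
          (mul_le_of_le_one_right' (hre.expect_exp_le a.re)))
        have hz : AgreesForEstimate m (((m'.setNat rT t).setArr aBit 0 0 ((z : ℕ) : ℂ)).setArr
            aAcc 0 0 (m'.arr aAcc 0 0 + (1 - 2 * ((z : ℕ) : ℂ)))) :=
          (h0.setArr (.inr rfl) _ _ _).setArr (.inl rfl) _ _ _
        refine le_trans (le_of_eq ?_) (hstep z _ hz (Mem.setArr_arr_self _ _ _ _ _))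
        have e1 : CExpr.eval ((m'.setNat rT t).setArr aBit (NExpr.eval (m'.setNat rT t) (.lit 0))
            (NExpr.eval (m'.setNat rT t) (.lit 0)) ((z : ℕ) : ℂ))
            (.add (sc aAcc) (.sub (.int 1) (.mul (.int 2) (sc aBit))))
            = m'.arr aAcc 0 0 + (1 - 2 * ((z : ℕ) : ℂ)) := by
          simp [CExpr.eval, sc, NExpr.eval, Mem.setArr_arr_of_ne]
        rw [e1]
        simp only [NExpr.eval]
        rw [he _ hz, hf _ hz]
        congr 1
        funext z'
        congr 2
        simp [CExpr.eval, sc, NExpr.eval, Mem.setArr_arr_of_ne]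
    _ ≤ C := iInf_le_of_le hm₁ (by simp [m₁, CExpr.eval])

end

/-- The memory holds the data that the estimates depend on. -/
structure IsReady (M S : ℕ) (nrm : ℕ → ℝ) (μ : ℂ) (m : Mem) : Prop where
  rM : m.nat rM = M
  rS : m.nat rS = S
  nrm : ∀ e, m.arr aNrm e 0 = nrm e
  lam : m.arr aLam 0 0 = μ

theorem IsReady.of_agrees {M S : ℕ} {nrm : ℕ → ℝ} {μ : ℂ} {m m' : Mem} (h : IsReady M S nrm μ m)
    (h' : AgreesForEstimate m m') : IsReady M S nrm μ m' :=
  ⟨(h'.nat _ (by decide)).trans h.rM, (h'.nat _ (by decide)).trans h.rS,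
    fun e => by rw [h'.arr _ (by decide) (by decide), h.nrm],
    by rw [h'.arr _ (by decide) (by decide), h.lam]⟩

theorem IsReady.setNat {M S : ℕ} {nrm : ℕ → ℝ} {μ : ℂ} {m : Mem} (h : IsReady M S nrm μ m)
    {r : ℕ} (h0 : 0 ≠ r) (h1 : 1 ≠ r) (v : ℕ) : IsReady M S nrm μ (m.setNat r v) :=
  ⟨(Mem.setNat_nat_of_ne _ _ h0).trans h.rM, (Mem.setNat_nat_of_ne _ _ h1).trans h.rS,
    h.nrm, h.lam⟩

theorem IsReady.setArr {M S : ℕ} {nrm : ℕ → ℝ} {μ : ℂ} {m : Mem} (h : IsReady M S nrm μ m)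
    {a : ℕ} (h0 : aNrm ≠ a) (h1 : aLam ≠ a) (i j : ℕ) (z : ℂ) :
    IsReady M S nrm μ (m.setArr a i j z) :=
  ⟨h.rM, h.rS, fun e => by rw [Mem.setArr_arr_of_ne _ _ _ _ h0, h.nrm],
    by rw [Mem.setArr_arr_of_ne _ _ _ _ h1, h.lam]⟩

/-- The weighted deviation of the value `z` from its mean `r v`, reduced by the exponent in the
bound for its exponential moment. -/
def deviation (S : ℕ) (α : ℂ) (r : ℝ) (v z : ℂ) : ℝ :=
  (α * (z - r * v)).re - 2 * (‖α‖ * r) ^ 2 / S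

/-- The sum of the deviations of the entries of the first `j` rows of the estimated matrix. -/
def deviationW (M S : ℕ) (nrm : ℕ → ℝ) (μ : ℂ) (v α : ℕ → ℕ → ℂ) (m : Mem) (j : ℕ) : ℝ :=
  ∑ j' ∈ Finset.range j, ∑ k ∈ Finset.range M, deviation S (α j' k) (nrm j' * nrm k) (v j' k)
    (m.arr aW j' k - if j' = k then μ else 0)

/-- The sum of the deviations of the first `i` entries of row `j` before the shift. -/
def deviationRow (S : ℕ) (nrm : ℕ → ℝ) (v α : ℕ → ℕ → ℂ) (m : Mem) (j i : ℕ) : ℝ :=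
  ∑ k ∈ Finset.range i, deviation S (α j k) (nrm j * nrm k) (v j k) (m.arr aW j k)

/-- The sum of the deviations of the first `j` entries of the estimated right-hand side. -/
def deviationQ (M S : ℕ) (nrm : ℕ → ℝ) (v : ℕ → ℕ → ℂ) (β : ℕ → ℂ) (m : Mem) (j : ℕ) : ℝ :=
  ∑ j' ∈ Finset.range j, deviation S (β j') (nrm j' * nrm M) (v j' M) (m.arr aQ j' 0)

section

variable {n : ℕ} {circ : ℕ → ℕ → Part → Circuit (n + 1)} {M S : ℕ} {nrm : ℕ → ℝ} {μ : ℂ}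
  {v : ℕ → ℕ → ℂ}

/-- One estimate, which is scaled and stored. -/
theorem wp_estimate_store_le {m : Mem} (hm : IsReady M S nrm μ m) (hS0 : 0 < S) {e f : NExpr}
    {E F : ℕ}
    (he : ∀ m', AgreesForEstimate m m' → e.eval m' = E)
    (hf : ∀ m', AgreesForEstimate m m' → f.eval m' = F)
    (hre : HasBias (circ E F .re) (v E F).re) (him : HasBias (circ E F .im) (v E F).im) (α : ℂ)
    {a : ℕ} {i j : NExpr} {I J : ℕ} (hi : ∀ m', AgreesForEstimate m m' → i.eval m' = I)
    (hj : ∀ m', AgreesForEstimate m m' → j.eval m' = J) {Ψ : Mem → ENNReal} {c : ℝ}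
    (hΨ : ∀ m', AgreesForEstimate m m' → ∀ z : ℂ, Ψ (m'.setArr a I J z) ≤ ENNReal.ofReal
      (Real.exp (c + deviation S α (nrm E * nrm F) (v E F) z))) :
    wp circ (.seq (estimate e f) (.setArr a i j (.mul (.mul (nrmOf e) (nrmOf f)) (sc aAcc)))) Ψ m
      ≤ ENNReal.ofReal (Real.exp c) := by
  rw [wp_seq]
  refine wp_estimate_le hm.rS hS0 he hf hre him (α * (nrm E * nrm F : ℝ)) fun m' h => ?_
  rw [wp_setArr, hi m' h, hj m' h]
  refine (hΨ m' h _).trans (le_of_eq ?_)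
  rw [← ENNReal.ofReal_mul (Real.exp_pos _).le, ← Real.exp_add]
  congr 3
  have h1 := (hm.of_agrees h).nrm
  simp only [deviation, CExpr.eval, nrmOf, NExpr.eval, he m' h, hf m' h, sc, h1]
  congr 1
  · congr 1
    push_cast
    ring
  · rw [norm_mul, Complex.norm_real, mul_pow, mul_pow ‖α‖, Real.norm_eq_abs, sq_abs]

theorem wp_computeW_le (hS0 : 0 < S)
    (hbias : ∀ j < M, ∀ k < M, ∀ p, HasBias (circ j k p) (p.value (v j k))) (α : ℕ → ℕ → ℂ)
    {m : Mem} (hm : IsReady M S nrm μ m) :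
    wp circ computeW (fun m' => ⨅ _ : IsReady M S nrm μ m',
      ENNReal.ofReal (Real.exp (deviationW M S nrm μ v α m' M))) m ≤ 1 := by
  let Φ : ℕ → Mem → ENNReal := fun j m' => ⨅ _ : IsReady M S nrm μ m',
      ENNReal.ofReal (Real.exp (deviationW M S nrm μ v α m' j))
  refine (wp_loop_le (by simpa [NExpr.eval] using hm.rM) Φ fun j hj m₁ => le_iInf fun h₁ => ?_).trans
    (iInf_le_of_le hm (by simp [deviationW]))
  rw [wp_seq]
  -- The diagonal shift is added only after a row is complete. The current row is therefore tracked
  -- without the shift and is converted into a summand of `deviationW` at the end.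
  let Ψ : ℕ → Mem → ENNReal := fun i m' => ⨅ _ : IsReady M S nrm μ m' ∧ m'.nat rJ = j,
      ENNReal.ofReal (Real.exp (deviationW M S nrm μ v α m' j + deviationRow S nrm v α m' j i))
  have h₁' := h₁.setNat (r := rJ) (by decide) (by decide) j
  calc _ ≤ wp circ _ (Ψ M) (m₁.setNat rJ j) := by
        refine wp_mono fun m' => le_iInf fun ⟨h, hJ⟩ => ?_
        rw [wp_setArr]
        refine iInf_le_of_le (h.setArr (by decide) (by decide) _ _ _) (le_of_eq ?_)
        congr 2
        simp only [CExpr.eval, NExpr.eval, hJ, sc, h.lam]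
        rw [deviationW, Finset.sum_range_succ, deviationW, deviationRow]
        congr 1
        · refine Finset.sum_congr rfl fun j' hj' => Finset.sum_congr rfl fun k _ => ?_
          have := (Finset.mem_range.1 hj').ne
          simp [Mem.setArr_arr, this]
        · refine Finset.sum_congr rfl fun k _ => ?_
          by_cases hk : j = k
          · subst hk; simp
          · simp [Mem.setArr_arr, hk, Ne.symm hk]
    _ ≤ Ψ 0 (m₁.setNat rJ j) := by
        refine wp_loop_le (by simpa [NExpr.eval] using h₁'.rM) Ψ
          fun i hi m₂ => le_iInf fun ⟨h₂, hJ⟩ => ?_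
        have h₂' := h₂.setNat (r := rK) (by decide) (by decide) i
        have hJ' : ∀ m', AgreesForEstimate (m₂.setNat rK i) m' → m'.nat rJ = j := fun m' h =>
          (h.nat _ (by decide)).trans hJ
        have hK' : ∀ m', AgreesForEstimate (m₂.setNat rK i) m' → m'.nat rK = i := fun m' h =>
          (h.nat _ (by decide)).trans (Mem.setNat_nat_self _ _ _)
        refine wp_estimate_store_le (e := .reg rJ) (f := .reg rK) (i := .reg rJ) (j := .reg rK)
          h₂' hS0 hJ' hK' (hbias j hj i hi .re) (hbias j hj i hi .im)
          (α j i) hJ' hK' fun m' h z => ?_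
        have hr := h₂'.of_agrees h
        refine iInf_le_of_le ⟨hr.setArr (by decide) (by decide) _ _ _, hJ' m' h⟩ (le_of_eq ?_)
        congr 2
        have hW : m'.arr aW = m₂.arr aW := h.arr _ (by decide) (by decide)
        rw [deviationRow, Finset.sum_range_succ, Mem.setArr_arr_self, ← add_assoc]
        congr 2
        · refine Finset.sum_congr rfl fun j' hj' => Finset.sum_congr rfl fun k _ => ?_
          have := (Finset.mem_range.1 hj').ne
          simp [Mem.setArr_arr, this, hW]
        · refine Finset.sum_congr rfl fun k hk => ?_
          have := (Finset.mem_range.1 hk).ne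
          simp [Mem.setArr_arr, this, hW]
    _ ≤ _ := by
        refine iInf_le_of_le ⟨h₁', Mem.setNat_nat_self _ _ _⟩ (le_of_eq ?_)
        congr 2
        simp [deviationRow, deviationW]

/-- The matrix array is not touched here, so its deviation is a constant factor throughout. -/
theorem wp_computeQ_le (hS0 : 0 < S)
    (hbias : ∀ j < M, ∀ p, HasBias (circ j M p) (p.value (v j M))) (α : ℕ → ℕ → ℂ) (β : ℕ → ℂ)
    {m : Mem} (hm : IsReady M S nrm μ m) :
    wp circ computeQ (fun m' => ⨅ _ : IsReady M S nrm μ m', ENNReal.ofReal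
      (Real.exp (deviationW M S nrm μ v α m' M + deviationQ M S nrm v β m' M))) m ≤
      ENNReal.ofReal (Real.exp (deviationW M S nrm μ v α m M)) := by
  let Φ : ℕ → Mem → ENNReal := fun j m' => ⨅ _ : IsReady M S nrm μ m', ENNReal.ofReal
      (Real.exp (deviationW M S nrm μ v α m' M + deviationQ M S nrm v β m' j))
  refine (wp_loop_le (by simpa [NExpr.eval] using hm.rM) Φ fun j hj m₁ => le_iInf fun h₁ => ?_).trans
    (iInf_le_of_le hm (by simp [deviationQ]))
  have h₁' := h₁.setNat (r := rJ) (by decide) (by decide) j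
  have hJ' : ∀ m', AgreesForEstimate (m₁.setNat rJ j) m' → m'.nat rJ = j := fun m' h =>
    (h.nat _ (by decide)).trans (Mem.setNat_nat_self _ _ _)
  refine wp_estimate_store_le (e := .reg rJ) (f := .reg rM) (i := .reg rJ) (j := .lit 0)
    h₁' hS0 hJ' (fun m' h => (h₁'.of_agrees h).rM) (hbias j hj .re)
    (hbias j hj .im) (β j) hJ' (J := 0) (fun _ _ => rfl) fun m' h z => ?_
  refine iInf_le_of_le ((h₁'.of_agrees h).setArr (by decide) (by decide) _ _ _) (le_of_eq ?_)
  congr 2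
  have hW : m'.arr aW = m₁.arr aW := h.arr _ (by decide) (by decide)
  have hQ : m'.arr aQ = m₁.arr aQ := h.arr _ (by decide) (by decide)
  rw [deviationQ, Finset.sum_range_succ, Mem.setArr_arr_self, ← add_assoc]
  congr 2
  · simp only [deviationW, Mem.setArr_arr_of_ne m' _ _ z (show aW ≠ aQ by decide), hW]
  · refine Finset.sum_congr rfl fun j' hj' => ?_
    have := (Finset.mem_range.1 hj').ne
    simp [Mem.setArr_arr, this, hQ]

/-- The exponential moments of the estimates. -/
theorem wp_estimates_le (hS0 : 0 < S)
    (hbias : ∀ j < M, ∀ k ≤ M, ∀ p, HasBias (circ j k p) (p.value (v j k))) (α : ℕ → ℕ → ℂ)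
    (β : ℕ → ℂ) {m : Mem} (hm : IsReady M S nrm μ m) :
    wp circ (.seq computeW computeQ) (fun m' => ENNReal.ofReal
      (Real.exp (deviationW M S nrm μ v α m' M + deviationQ M S nrm v β m' M))) m ≤ 1 := by
  rw [wp_seq]
  refine (wp_mono fun m' => le_iInf fun h => ?_).trans
    (wp_computeW_le hS0 (fun j hj k hk => hbias j hj k hk.le) α hm)
  exact (wp_mono fun m'' => le_iInf fun _ => le_rfl).trans
    (wp_computeQ_le hS0 (fun j hj => hbias j hj M le_rfl) α β h)

end

/-! ### The classical preprocessing, and running times -/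

section

variable {n : ℕ} {circ : ℕ → ℕ → Part → Circuit (n + 1)}

/-- The running maximum computed by `computeGamma`. -/
def runningMax (nrm : ℕ → ℝ) (M : ℕ) : ℕ → ℝ
  | 0 => 0
  | j + 1 => max (max (runningMax nrm M j) (nrm j * nrm M)) (nrm j * nrm j)

theorem runningMax_eq_iSup {nrm : ℕ → ℝ} {M : ℕ} (hM : 0 < M) :
    runningMax nrm M M = ⨆ j : Fin M, max (nrm j * nrm M) (nrm j ^ 2) := by
  have : Nonempty (Fin M) := ⟨⟨0, hM⟩⟩
  have hbdd : BddAbove (Set.range fun j : Fin M => max (nrm j * nrm M) (nrm j ^ 2)) :=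
    (Set.finite_range _).bddAbove
  refine le_antisymm ?_ (ciSup_le fun i => ?_)
  · have key : ∀ j ≤ M, runningMax nrm M j ≤ ⨆ j : Fin M, max (nrm j * nrm M) (nrm j ^ 2) := by
      intro j
      induction j with
      | zero => exact fun _ => Real.iSup_nonneg fun j => le_max_of_le_right (sq_nonneg _)
      | succ j ih =>
        intro hj
        have h := le_ciSup hbdd ⟨j, hj⟩
        refine max_le (max_le (ih (by omega)) ((le_max_left _ _).trans h)) ?_
        refine le_trans (le_of_eq ?_) ((le_max_right _ _).trans h)
        simp [sq]
    exact key M le_rfl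
  · have hmono : Monotone (runningMax nrm M) := monotone_nat_of_le_succ fun j =>
      (le_max_left _ _).trans (le_max_left _ _)
    refine le_trans ?_ (hmono (Nat.succ_le_of_lt i.2))
    refine max_le ((le_max_right _ _).trans (le_max_left _ _)) ?_
    rw [sq]
    exact le_max_right _ _

theorem spec_max {m : Mem} {x : CExpr} {g y : ℝ} (hg : m.arr aGam 0 0 = g) (hx : x.eval m = y) :
    Spec circ (.ite (sc aGam) x (setSc aGam x) .skip) m (2 * x.cost + 7) fun m' =>
      m'.nat = m.nat ∧ (∀ a, a ≠ aGam → m'.arr a = m.arr a) ∧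
        m'.arr aGam 0 0 = (max g y : ℝ) := by
  have hg' : CExpr.eval m (sc aGam) = g := hg
  refine (Spec.ite (t := x.cost + 3) (fun h => ?_) fun h => ?_).mono
    (by simp [sc, CExpr.cost, NExpr.cost]; omega) fun _ h => h
  · rw [hg', hx, Complex.ofReal_re, Complex.ofReal_re] at h
    refine Spec.setSc ⟨rfl, fun a ha => Mem.setArr_arr_of_ne _ _ _ _ ha, ?_⟩
    rw [Mem.setArr_arr_self, hx, max_eq_right h]
  · rw [hg', hx, Complex.ofReal_re, Complex.ofReal_re] at h
    refine (Spec.skip ⟨rfl, fun _ _ => rfl, ?_⟩).mono (by omega) fun _ h => h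
    rw [hg, max_eq_left h.le]

theorem spec_computeGamma {m : Mem} {M : ℕ} {nrm : ℕ → ℝ} (hM : m.nat rM = M)
    (hn : ∀ e, m.arr aNrm e 0 = nrm e) :
    Spec circ computeGamma m (M * 60 + 10) fun m' => m'.nat rM = M ∧
      (∀ a, a ≠ aGam → m'.arr a = m.arr a) ∧ m'.arr aGam 0 0 = runningMax nrm M M := by
  have h0 : (m.setArr aGam 0 0 (CExpr.eval m (.int 0))).arr aGam 0 0 = runningMax nrm M 0 := by
    simp [runningMax, CExpr.eval]
  refine Spec.seqSc (M * 60 + 2) (by simp [CExpr.cost]; omega) <|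
    Spec.mono (Spec.loop (e := .reg rM) (k := M) (t := 59)
      (m := m.setArr aGam 0 0 (CExpr.eval m (.int 0))) hM (fun j m' => m'.nat rM = M ∧
      (∀ a, a ≠ aGam → m'.arr a = m.arr a) ∧ m'.arr aGam 0 0 = runningMax nrm M j)
      ⟨hM, fun a ha => Mem.setArr_arr_of_ne _ _ _ _ ha, h0⟩ ?_) (by simp [NExpr.cost]) fun _ h => h
  rintro j hj m₁ ⟨h1, h2, h3⟩
  have e1 : CExpr.eval (m₁.setNat rJ j) (.mul (nrmOf (.reg rJ)) (nrmOf (.reg rM)))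
      = (nrm j * nrm M : ℝ) := by
    simp [CExpr.eval, nrmOf, NExpr.eval, Mem.setNat_nat, h1, h2 aNrm (by decide), hn]
  have s1 := spec_max (circ := circ) (m := m₁.setNat rJ j) h3 e1
  refine Spec.mono (Spec.seq s1 (t' := 21) fun m₂ ⟨g1, g2, g3⟩ => ?_)
    (by simp [CExpr.cost, nrmOf, NExpr.cost]) fun _ h => h
  have e2 : CExpr.eval m₂ (nrmOf (.reg rJ)).sq = (nrm j * nrm j : ℝ) := by
    simp [CExpr.eval, CExpr.sq, nrmOf, NExpr.eval, g1, g2 aNrm (by decide), h2 aNrm (by decide), hn]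
  refine Spec.mono (spec_max g3 e2) (by simp [CExpr.cost, nrmOf, NExpr.cost, CExpr.sq])
    fun m₃ ⟨k1, k2, k3⟩ => ⟨?_, fun a ha => ?_, k3⟩
  · rw [k1, g1]
    simpa [Mem.setNat_nat] using h1
  · rw [k2 a ha, g2 a ha]
    exact h2 a ha

theorem spec_estimate {m : Mem} {S K : ℕ} (hS : m.nat rS = S)
    (hK : ∀ e f p, (circ e f p).size ≤ K) {e f : NExpr} (he : e.cost = 1) (hf : f.cost = 1) :
    Spec circ (estimate e f) m (S * (2 * K + 60) + 20) (AgreesForEstimate m) := by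
  have h0 := (AgreesForEstimate.refl m).setArr (a := aAcc) (.inl rfl) 0 0 (CExpr.eval m (.int 0))
  refine Spec.seqSc (S * (2 * K + 60) + 16) (by simp [CExpr.cost]; omega) <|
    Spec.seqLoop (k := S) (2 * K + 59) 14 hS (fun _ => AgreesForEstimate m)
      (by simp [NExpr.cost]) h0 (fun t ht m' h => ?_) fun m' h => ?_
  · have h1 := h.setNat t
    have htest : ∀ (m₁ : Mem) (p : Part), AgreesForEstimate m m₁ →
        Spec circ (.test aBit (.lit 0) (.lit 0) e f p) m₁ (K + 6) (AgreesForEstimate m) :=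
      fun m₁ p h => (Spec.test fun z => h.setArr (.inr rfl) _ _ _).mono (by
        have := hK (e.eval m₁) (f.eval m₁) p
        rw [he, hf]; simp only [NExpr.cost]; omega) fun _ h => h
    refine (Spec.seq (htest _ _ h1) fun m₂ h2 => Spec.seqSc (t' := 16 + (K + 6) + 20)
      (K + 6 + 20) ?_ <| Spec.seq (htest _ _ (h2.setArr (.inl rfl) _ _ _)) fun m₃ h3 =>
      Spec.mono (Spec.setSc (h3.setArr (.inl rfl) _ _ _)) ?_ fun _ h => h).mono (by omega)
      fun _ h => h
    · simp [CExpr.cost, sc, NExpr.cost]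
      omega
    · simp [CExpr.cost, sc, NExpr.cost]
  · exact Spec.mono (Spec.setSc (h.setArr (.inl rfl) _ _ _)) (by simp [CExpr.cost, sc, NExpr.cost])
      fun _ h => h

theorem spec_computeW {m : Mem} {M S K : ℕ} (hM : m.nat rM = M) (hS : m.nat rS = S)
    (hK : ∀ e f p, (circ e f p).size ≤ K) :
    Spec circ computeW m (M * (M * (S * (2 * K + 60) + 40) + 20) + 5) fun m' =>
      m'.nat rM = M ∧ m'.nat rS = S := by
  refine (Spec.loop (k := M) (t := M * (S * (2 * K + 60) + 40) + 19)
    (by simpa [NExpr.eval] using hM) (fun _ m' => m'.nat rM = M ∧ m'.nat rS = S) ⟨hM, hS⟩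
    fun j _ m₁ ⟨h1, h2⟩ => ?_).mono (by simp [NExpr.cost]) fun _ h => h
  refine Spec.seqLoop (k := M) (S * (2 * K + 60) + 39) 15
    (by simpa [NExpr.eval, Mem.setNat_nat] using h1) (fun _ m' => m'.nat rM = M ∧ m'.nat rS = S)
    (by simp [NExpr.cost]) (by simpa [Mem.setNat_nat] using ⟨h1, h2⟩)
    (fun i _ m₂ ⟨g1, g2⟩ => ?_) fun m₂ h => ?_
  · refine (Spec.seq (spec_estimate (S := S) (by simpa [Mem.setNat_nat] using g2) hK rfl rfl)
      fun m₃ h3 => Spec.setArr ⟨?_, ?_⟩).mono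
        (by simp [CExpr.cost, sc, nrmOf, NExpr.cost]) fun _ h => h
    · rw [Mem.setArr_nat, h3.nat _ (by decide)]
      simpa [Mem.setNat_nat] using g1
    · rw [Mem.setArr_nat, h3.nat _ (by decide)]
      simpa [Mem.setNat_nat] using g2
  · exact (Spec.setArr h).mono (by simp [CExpr.cost, sc, NExpr.cost]) fun _ h => h

theorem spec_computeQ {m : Mem} {M S K : ℕ} (hM : m.nat rM = M) (hS : m.nat rS = S)
    (hK : ∀ e f p, (circ e f p).size ≤ K) :
    Spec circ computeQ m (M * (S * (2 * K + 60) + 40) + 5) fun m' => m'.nat rM = M := by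
  refine (Spec.loop (k := M) (t := S * (2 * K + 60) + 39)
    (by simpa [NExpr.eval] using hM) (fun _ m' => m'.nat rM = M ∧ m'.nat rS = S) ⟨hM, hS⟩
    fun j _ m₁ ⟨g1, g2⟩ => ?_).mono (by simp [NExpr.cost]) fun _ h => h.1
  refine (Spec.seq (spec_estimate (S := S) (by simpa [Mem.setNat_nat] using g2) hK rfl rfl)
    fun m₃ h3 => Spec.setArr ⟨?_, ?_⟩).mono
      (by simp [CExpr.cost, sc, nrmOf, NExpr.cost]) fun _ h => h
  · rw [Mem.setArr_nat, h3.nat _ (by decide)]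
    simpa [Mem.setNat_nat] using g1
  · rw [Mem.setArr_nat, h3.nat _ (by decide)]
    simpa [Mem.setNat_nat] using g2

end

/-- The norms of the input vectors, indexed as in the memory. -/
def normAt {M : ℕ} (nrm : Fin M → ℝ) (nrmB : ℝ) (e : ℕ) : ℝ :=
  if h : e < M then nrm ⟨e, h⟩ else if e = M then nrmB else 0

/-- The number `λ`. -/
def shift {N M : ℕ} (A : Matrix (Fin N) (Fin M) ℂ) (nrmB ε : ℝ) : ℝ :=
  ε / (2 * ‖A‖ ^ 2 * ‖pinv A‖ ^ 4 * nrmB)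

/-- The number `T`. -/
def repetitionFactor {N M : ℕ} (A : Matrix (Fin N) (Fin M) ℂ) (b : EuclideanSpace ℂ (Fin N))
    (nrmB ε ρ : ℝ) : ℝ :=
  ρ * (M * ‖pinv A‖ ^ 4 * (‖A‖ * ‖pinv A‖) ^ 4 * nrmB ^ 2 *
    (‖A‖ * (‖optSol A b‖ + 1) + ε) ^ 2) / ε ^ 4

/-- The number of repetitions. -/
def repetitions {N M : ℕ} (A : Matrix (Fin N) (Fin M) ℂ) (b : EuclideanSpace ℂ (Fin N))
    (nrm : Fin M → ℝ) (nrmB ε ρ : ℝ) : ℕ :=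
  ⌈runningMax (normAt nrm nrmB) M M ^ 2 * repetitionFactor A b nrmB ε ρ⌉₊

/-- The preprocessing. -/
def preprocessing : Cmd := .seq computeGamma <| .seq computeLambda computeS

theorem spec_preprocessing {n : ℕ} {circ : ℕ → ℕ → Part → Circuit (n + 1)} {N M : ℕ}
    (A : Matrix (Fin N) (Fin M) ℂ) (b : EuclideanSpace ℂ (Fin N)) (nrm : Fin M → ℝ)
    (nrmB ε ρ : ℝ) : Spec circ preprocessing (initMem A b nrm nrmB ε ρ)
      (M * 60 + repetitions A b nrm nrmB ε ρ + 200)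
      (IsReady M (repetitions A b nrm nrmB ε ρ) (normAt nrm nrmB) (shift A nrmB ε)) := by
  set m := initMem A b nrm nrmB ε ρ with hm
  have hn : ∀ e, m.arr aNrm e 0 = normAt nrm nrmB e := fun e => by
    simp only [hm, initMem, normAt]
    split_ifs <;> simp_all
  have hA : m.arr aA 0 0 = (‖A‖ : ℂ) := rfl
  have hp : m.arr aAinv 0 0 = (‖pinv A‖ : ℂ) := rfl
  have hx : m.arr aXs 0 0 = (‖optSol A b‖ : ℂ) := rfl
  have he : m.arr aEps 0 0 = (ε : ℂ) := rfl
  have hr : m.arr aRho 0 0 = (ρ : ℂ) := rfl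
  have hB : normAt nrm nrmB M = nrmB := by simp [normAt]
  refine (Spec.seq (spec_computeGamma (M := M) rfl hn) fun m₁ ⟨g1, g2, g3⟩ => Spec.seqSc
    (t' := repetitions A b nrm nrmB ε ρ + 190) (repetitions A b nrm nrmB ε ρ + 150)
    (by simp [CExpr.cost, sc, CExpr.sq, nrmOf, NExpr.cost]; omega) ?_).mono (by omega) fun _ h => h
  have hlam : CExpr.eval m₁ (.div (sc aEps) <| .mul (.int 2) <| .mul (sc aA).sq <|
      .mul (sc aAinv).sq.sq (nrmOf (.reg rM))) = (shift A nrmB ε : ℝ) := by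
    simp only [CExpr.eval, CExpr.sq, sc, nrmOf, NExpr.eval, g1, g2 aEps (by decide),
      g2 aA (by decide), g2 aAinv (by decide), g2 aNrm (by decide), hn, hA, hp, he, hB, shift]
    push_cast
    ring
  rw [hlam]
  have hS : CExpr.eval (m₁.setArr aLam 0 0 (shift A nrmB ε : ℝ)) (.mul (sc aGam).sq exprT)
      = (runningMax (normAt nrm nrmB) M M ^ 2 * repetitionFactor A b nrmB ε ρ : ℝ) := by
    simp only [exprT, CExpr.eval, CExpr.sq, sc, nrmOf, NExpr.eval, Mem.setArr_nat, g1, g3,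
      Mem.setArr_arr_of_ne m₁ _ _ _ (show aGam ≠ aLam by decide),
      Mem.setArr_arr_of_ne m₁ _ _ _ (show aRho ≠ aLam by decide),
      Mem.setArr_arr_of_ne m₁ _ _ _ (show aAinv ≠ aLam by decide),
      Mem.setArr_arr_of_ne m₁ _ _ _ (show aA ≠ aLam by decide),
      Mem.setArr_arr_of_ne m₁ _ _ _ (show aNrm ≠ aLam by decide),
      Mem.setArr_arr_of_ne m₁ _ _ _ (show aXs ≠ aLam by decide),
      Mem.setArr_arr_of_ne m₁ _ _ _ (show aEps ≠ aLam by decide), g2 aEps (by decide),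
      g2 aA (by decide), g2 aAinv (by decide), g2 aNrm (by decide), g2 aRho (by decide),
      g2 aXs (by decide), hn, hA, hp, he, hB, hx, hr, repetitionFactor]
    push_cast
    ring
  have hre : (CExpr.eval (m₁.setArr aLam 0 0 (shift A nrmB ε : ℝ)) (.mul (sc aGam).sq exprT)).re
      = runningMax (normAt nrm nrmB) M M ^ 2 * repetitionFactor A b nrmB ε ρ := by
    rw [hS, Complex.ofReal_re]
  refine (Spec.ceil ?_).mono ?_ fun _ h => h
  · rw [hre]
    refine ⟨by simpa [Mem.setNat_nat] using g1, Mem.setNat_nat_self _ _ _, fun e => ?_,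
      by rw [Mem.setNat_arr, Mem.setArr_arr_self]⟩
    rw [Mem.setNat_arr, Mem.setArr_arr_of_ne _ _ _ _ (by decide), g2 _ (by decide), hn]
  · rw [hre]
    simp [exprT, CExpr.cost, sc, CExpr.sq, nrmOf, NExpr.cost, repetitions]

/-! ### The quantum access model -/

/-- Padding by zeros does not change norms and inner products; both are instances of this sum. -/
theorem sum_pad {N : ℕ} {α : Type*} [AddCommMonoid α] (F : ℂ → ℂ → α) (hF : F 0 0 = 0)
    (v w : Fin N → ℂ) : ∑ x, F (pad v x) (pad w x) = ∑ i, F (v i) (w i) := by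
  have hN : N ≤ 2 ^ Nat.clog 2 N := Nat.le_pow_clog (by norm_num) N
  let e : Fin N → Basis (Nat.clog 2 N) := fun i => finFunctionFinEquiv.symm ⟨i, i.2.trans_le hN⟩
  have he : ∀ i, (finFunctionFinEquiv (e i) : ℕ) = i := fun i => by simp [e]
  refine (Fintype.sum_of_injective e (fun i j h => ?_) _ _ (fun x hx => ?_) fun i => ?_).symm
  · rw [Fin.ext_iff, ← he i, ← he j, h]
  · have hx' : ¬ (finFunctionFinEquiv x : ℕ) < N := fun h =>
      hx ⟨⟨_, h⟩, finFunctionFinEquiv.symm_apply_apply x⟩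
    rw [pad, pad, dif_neg hx', dif_neg hx', hF]
  · have hp : ∀ u : Fin N → ℂ, pad u (e i) = u i := fun u => by
      rw [pad, dif_pos (by rw [he]; exact i.2)]
      congr 1
      exact Fin.ext (he i)
    rw [hp, hp]

theorem norm_eq_of_pad {N : ℕ} {v : Fin N → ℂ} {r : ℝ} (hr : 0 ≤ r) {c : Circuit (Nat.clog 2 N)}
    (h : ∀ x, pad v x = r * c.state x) : r = ‖(WithLp.toLp 2 v : EuclideanSpace ℂ (Fin N))‖ := by
  have h1 : ∑ x, ‖pad v x‖ ^ 2 = ∑ i, ‖v i‖ ^ 2 := sum_pad (fun z _ => ‖z‖ ^ 2) (by simp) v v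
  have h2 : ∑ x, ‖c.state x‖ ^ 2 = 1 := sum_norm_sq_column c.unitary.2
  simp only [h, norm_mul, mul_pow, ← Finset.mul_sum, h2, Complex.norm_real, Real.norm_eq_abs,
    sq_abs, mul_one] at h1
  refine (sq_eq_sq₀ hr (norm_nonneg _)).1 ?_
  rw [h1, EuclideanSpace.norm_sq_eq]

/-- The amplitude `⟨0|U₁ᴴ U₂|0⟩`. -/
def overlap {n : ℕ} (c₁ c₂ : Circuit n) : ℂ := (c₁.mat.conjTranspose * c₂.mat) 0 0

/-- This identifies the scaled means of the tests with the entries of `Aᴴ A` and of `Aᴴ b`. -/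
theorem mul_overlap {N : ℕ} {v w : Fin N → ℂ} {r s : ℝ} {c₁ c₂ : Circuit (Nat.clog 2 N)}
    (h₁ : ∀ x, pad v x = r * c₁.state x) (h₂ : ∀ x, pad w x = s * c₂.state x) :
    (r * s : ℝ) * overlap c₁ c₂ = ∑ i, star (v i) * w i := by
  rw [← sum_pad (fun z z' => star z * z') (by simp) v w, overlap, Matrix.mul_apply, Finset.mul_sum]
  refine Finset.sum_congr rfl fun x _ => ?_
  rw [h₁, h₂, Matrix.conjTranspose_apply, star_mul', Circuit.state, Circuit.state]
  simp
  ring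

/-! ### Deviations of the estimates -/

theorem sub_le_sum_deviation {ι : Type*} [Fintype ι] {S : ℕ} {α v z : ι → ℂ} {r : ι → ℝ} {Γ s : ℝ}
    (hr : ∀ i, |r i| ≤ Γ) (hα : ∑ i, ‖α i‖ ^ 2 ≤ s ^ 2) :
    (∑ i, α i * (z i - r i * v i)).re - 2 * s ^ 2 * Γ ^ 2 / S
      ≤ ∑ i, deviation S (α i) (r i) (v i) (z i) := by
  simp only [deviation, Finset.sum_sub_distrib, Complex.re_sum]
  refine sub_le_sub_left ?_ _
  rw [← Finset.sum_div]
  refine div_le_div_of_nonneg_right ?_ (Nat.cast_nonneg S)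
  calc ∑ i, 2 * (‖α i‖ * r i) ^ 2 ≤ ∑ i, 2 * Γ ^ 2 * ‖α i‖ ^ 2 := by
        refine Finset.sum_le_sum fun i _ => ?_
        have h := sq_le_sq' (by linarith [neg_abs_le (r i), hr i]) ((le_abs_self _).trans (hr i))
        rw [mul_pow]
        nlinarith [sq_nonneg ‖α i‖]
    _ ≤ 2 * s ^ 2 * Γ ^ 2 := by
        rw [← Finset.mul_sum]
        nlinarith [sq_nonneg Γ]

/-- Extend a vector by zeros. -/
def extendZero {M : ℕ} (u : EuclideanSpace ℂ (Fin M)) (j : ℕ) : ℂ :=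
  if h : j < M then u ⟨j, h⟩ else 0

@[simp] theorem extendZero_coe {M : ℕ} (u : EuclideanSpace ℂ (Fin M)) (j : Fin M) :
    extendZero u j = u j := by
  simp [extendZero]

theorem inner_toEuclideanLin_eq_sum {M : ℕ} (u w : EuclideanSpace ℂ (Fin M))
    (E : Matrix (Fin M) (Fin M) ℂ) : inner ℂ u (Matrix.toEuclideanLin E w)
      = ∑ p : Fin M × Fin M, star (u p.1) * w p.2 * E p.1 p.2 := by
  rw [PiLp.inner_apply, Fintype.sum_prod_type]
  refine Finset.sum_congr rfl fun j _ => ?_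
  rw [RCLike.inner_apply, Matrix.ofLp_toLpLin, Matrix.toLin'_apply, Matrix.mulVec, dotProduct,
    Finset.sum_mul]
  refine Finset.sum_congr rfl fun k _ => ?_
  simp only [RCLike.star_def]
  ring

section

variable {M S : ℕ} {nrm : ℕ → ℝ} {μ : ℂ} {v : ℕ → ℕ → ℂ} {Γ s : ℝ}

/-- The functional `s ⟨u, E w⟩` has rank-one coefficients, with sum of squares `s² ‖u‖² ‖w‖² ≤ s²`.
So the compensator carries no factor `M`. -/
theorem sub_le_deviationW {u w : EuclideanSpace ℂ (Fin M)} (hu : ‖u‖ ≤ 1) (hw : ‖w‖ ≤ 1)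
    (hΓ : ∀ j < M, ∀ k ≤ M, |nrm j * nrm k| ≤ Γ) {m : Mem} {E : Matrix (Fin M) (Fin M) ℂ}
    (hE : ∀ j k : Fin M, E j k = (m.arr aW j k - if j = k then μ else 0)
      - (nrm j * nrm k : ℝ) * v j k) :
    s * (inner ℂ u (Matrix.toEuclideanLin E w)).re - 2 * s ^ 2 * Γ ^ 2 / S ≤
      deviationW M S nrm μ v (fun j k => s * (star (extendZero u j) * extendZero w k)) m M := by
  have h := sub_le_sum_deviation (S := S) (ι := Fin M × Fin M) (s := s)
    (α := fun p => s * (star (u p.1) * w p.2)) (v := fun p => v p.1 p.2)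
    (z := fun p => m.arr aW p.1 p.2 - if p.1 = p.2 then μ else 0)
    (r := fun p => nrm p.1 * nrm p.2) (fun p => hΓ p.1 p.1.2 p.2 p.2.2.le) ?_
  · refine le_trans (le_of_eq ?_) (h.trans (le_of_eq ?_))
    · congr 1
      rw [inner_toEuclideanLin_eq_sum, ← Complex.re_ofReal_mul, Finset.mul_sum]
      congr 1
      refine Finset.sum_congr rfl fun p _ => ?_
      rw [hE]
      ring
    · rw [deviationW, Fintype.sum_prod_type, Finset.sum_range]
      refine Finset.sum_congr rfl fun j _ => ?_
      rw [Finset.sum_range]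
      refine Finset.sum_congr rfl fun k _ => ?_
      simp [Fin.ext_iff]
  · have e : ∑ p : Fin M × Fin M, ‖(s * (star (u p.1) * w p.2) : ℂ)‖ ^ 2
        = s ^ 2 * ((∑ j, ‖u j‖ ^ 2) * ∑ k, ‖w k‖ ^ 2) := by
      rw [Finset.sum_mul_sum, ← Fintype.sum_prod_type', Finset.mul_sum]
      refine Finset.sum_congr rfl fun p _ => ?_
      rw [norm_mul, norm_mul, norm_star, Complex.norm_real, mul_pow, mul_pow, Real.norm_eq_abs,
        sq_abs]
    rw [e, ← EuclideanSpace.norm_sq_eq, ← EuclideanSpace.norm_sq_eq, ← mul_pow]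
    refine mul_le_of_le_one_right (sq_nonneg _) (pow_le_one₀ (by positivity) ?_)
    exact mul_le_one₀ hu (norm_nonneg _) hw

theorem sub_le_deviationQ {u : EuclideanSpace ℂ (Fin M)} (hu : ‖u‖ ≤ 1)
    (hΓ : ∀ j < M, ∀ k ≤ M, |nrm j * nrm k| ≤ Γ) {m : Mem} {f : EuclideanSpace ℂ (Fin M)}
    (hf : ∀ j : Fin M, f j = m.arr aQ j 0 - (nrm j * nrm M : ℝ) * v j M) :
    s * (inner ℂ u f).re - 2 * s ^ 2 * Γ ^ 2 / S ≤
      deviationQ M S nrm v (fun j => s * star (extendZero u j)) m M := by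
  have h := sub_le_sum_deviation (S := S) (ι := Fin M) (s := s)
    (α := fun j => s * star (u j)) (v := fun j => v j M) (z := fun j => m.arr aQ j 0)
    (r := fun j => nrm j * nrm M) (fun j => hΓ j j.2 M le_rfl) ?_
  · refine le_trans (le_of_eq ?_) (h.trans (le_of_eq ?_))
    · congr 1
      rw [PiLp.inner_apply, ← Complex.re_ofReal_mul, Finset.mul_sum]
      congr 1
      refine Finset.sum_congr rfl fun j _ => ?_
      rw [RCLike.inner_apply, hf, RCLike.star_def]
      ring
    · rw [deviationQ, Finset.sum_range]
      simp
  · have e : ∑ j, ‖(s * star (u j) : ℂ)‖ ^ 2 = s ^ 2 * ∑ j, ‖u j‖ ^ 2 := by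
      rw [Finset.mul_sum]
      refine Finset.sum_congr rfl fun j _ => ?_
      rw [norm_mul, norm_star, Complex.norm_real, mul_pow, Real.norm_eq_abs, sq_abs]
    rw [e, ← EuclideanSpace.norm_sq_eq]
    exact mul_le_of_le_one_right (sq_nonneg _) (pow_le_one₀ (norm_nonneg _) hu)

theorem deviation_zero (r : ℝ) (x z : ℂ) : deviation S 0 r x z = 0 := by simp [deviation]

theorem deviationW_zero (m : Mem) (j : ℕ) : deviationW M S nrm μ v (fun _ _ => 0) m j = 0 := by
  simp [deviationW, deviation_zero]

theorem deviationQ_zero (m : Mem) (j : ℕ) : deviationQ M S nrm v (fun _ => 0) m j = 0 := by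
  simp [deviationQ, deviation_zero]

/-- The probability that the solution of the estimated system is not as good as the solution of any
system close to the exact one. -/
theorem wp_failure_le {n : ℕ} {circ : ℕ → ℕ → Part → Circuit (n + 1)} {solve : Cmd} {C : ℝ}
    (hsolve : IsLinearSolver solve C) (hS0 : 0 < S)
    (hbias : ∀ j < M, ∀ k ≤ M, ∀ p, HasBias (circ j k p) (p.value (v j k)))
    (hΓ : ∀ j < M, ∀ k ≤ M, |nrm j * nrm k| ≤ Γ) {m : Mem} (hm : IsReady M S nrm μ m)
    {K : ℕ} (hK : ∀ e f p, (circ e f p).size ≤ K)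
    {G : Matrix (Fin M) (Fin M) ℂ} {g : EuclideanSpace ℂ (Fin M)}
    (hG : ∀ j k : Fin M, (nrm j * nrm k : ℝ) * v j k = G j k)
    (hg : ∀ j : Fin M, (nrm j * nrm M : ℝ) * v j M = g j) {t : ℝ} (ht : 0 ≤ t) (hs : 0 ≤ s)
    {P : EuclideanSpace ℂ (Fin M) → Prop} [DecidablePred P]
    (hP : ∀ (E : Matrix (Fin M) (Fin M) ℂ) (f : EuclideanSpace ℂ (Fin M)), ‖E‖ ≤ 4 * t →
      ‖f‖ ≤ 4 * t → IsUnit (G + μ • 1 + E).det ∧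
        ∀ x, Matrix.toEuclideanLin (G + μ • 1 + E) x = g + f → P x) :
    wp circ (.seq computeW (.seq computeQ solve))
      (fun m' => if P (WithLp.toLp 2 (m'.vecX M)) then 0 else 1) m ≤
      ENNReal.ofReal (2 * 625 ^ M * Real.exp (-(s * t - 2 * s ^ 2 * Γ ^ 2 / S))) := by
  obtain ⟨net, hcard, hnorm, hnet⟩ := exists_net M
  set x₀ := s * t - 2 * s ^ 2 * Γ ^ 2 / S with hx₀
  set q := ENNReal.ofReal (Real.exp (-x₀)) with hq
  let ψ : EuclideanSpace ℂ (Fin M) × EuclideanSpace ℂ (Fin M) → Mem → ENNReal := fun p m' =>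
    ENNReal.ofReal (Real.exp (deviationW M S nrm μ v
      (fun j k => s * (star (extendZero p.1 j) * extendZero p.2 k)) m' M +
        deviationQ M S nrm v (fun _ => 0) m' M))
  let φ : EuclideanSpace ℂ (Fin M) → Mem → ENNReal := fun u m' =>
    ENNReal.ofReal (Real.exp (deviationW M S nrm μ v (fun _ _ => 0) m' M +
        deviationQ M S nrm v (fun j => s * star (extendZero u j)) m' M))
  have hspec := Spec.seq (circ := circ) (spec_computeW hm.rM hm.rS hK)
    fun m' h => spec_computeQ h.1 h.2 hK
  have hassoc : ∀ F, wp circ (.seq computeW (.seq computeQ solve)) F m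
      = wp circ (.seq computeW computeQ) (wp circ solve F) m := fun F => by
    rw [wp_seq, wp_seq]
    congr 1
    funext m'
    exact wp_seq
  have hbound : ∀ m' : Mem, m'.nat rM = M →
      wp circ solve (fun m' => if P (WithLp.toLp 2 (m'.vecX M)) then 0 else 1) m' ≤
      (∑ p ∈ net ×ˢ net, q * ψ p m') + ∑ u ∈ net, q * φ u m' := by
    intro m' hM'
    let E : Matrix (Fin M) (Fin M) ℂ := m'.matW M - μ • 1 - G
    let f : EuclideanSpace ℂ (Fin M) := WithLp.toLp 2 (m'.vecQ M) - g
    have hE : ∀ j k : Fin M, E j k = (m'.arr aW j k - if j = k then μ else 0)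
        - (nrm j * nrm k : ℝ) * v j k := fun j k => by
      rw [hG]
      simp [E, Mem.matW, Matrix.one_apply]
    have hf : ∀ j : Fin M, f j = m'.arr aQ j 0 - (nrm j * nrm M : ℝ) * v j M := fun j => by
      rw [hg]; rfl
    have hle1 : wp circ solve (fun m' => if P (WithLp.toLp 2 (m'.vecX M)) then 0 else 1) m'
        ≤ 1 := by
      refine Spec.wp_le (t := ⌈C * ((M : ℝ) ^ 3 + 1)⌉₊) (Q := fun _ => True)
        (fun r hr => ⟨?_, trivial⟩) fun m'' _ => by split_ifs <;> simp
      exact_mod_cast ((hsolve.2 n circ m' M hM' r hr).1.trans (Nat.le_ceil _))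
    -- The Chernoff bound in pointwise form: wherever some functional exceeds `t`, its exponential
    -- times `q` dominates the indicator of failure.
    have hone : ∀ y : ℝ, x₀ ≤ y → 1 ≤ q * ENNReal.ofReal (Real.exp y) := fun y hy => by
      rw [hq, ← ENNReal.ofReal_mul (Real.exp_pos _).le, ← Real.exp_add, ← ENNReal.ofReal_one]
      exact ENNReal.ofReal_le_ofReal (Real.one_le_exp (by linarith))
    by_cases h1 : ∃ u ∈ net, ∃ w ∈ net, t < (inner ℂ u (Matrix.toEuclideanLin E w)).re
    · obtain ⟨u, hu, w, hw, h⟩ := h1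
      refine (hle1.trans (hone _ ?_)).trans ((Finset.single_le_sum
        (f := fun p => q * ψ p m') (fun _ _ => zero_le) (Finset.mk_mem_product hu hw)).trans
          le_self_add)
      rw [deviationQ_zero, add_zero]
      refine le_trans ?_ (sub_le_deviationW (S := S) (s := s) (hnorm u hu) (hnorm w hw) hΓ hE)
      rw [hx₀]
      nlinarith
    by_cases h2 : ∃ u ∈ net, t < (inner ℂ u f).re
    · obtain ⟨u, hu, h⟩ := h2
      refine (hle1.trans (hone _ ?_)).trans ((Finset.single_le_sum
        (f := fun u => q * φ u m') (fun _ _ => zero_le) hu).trans le_add_self)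
      rw [deviationW_zero, zero_add]
      refine le_trans ?_ (sub_le_deviationQ (S := S) (s := s) (hnorm u hu) hΓ hf)
      rw [hx₀]
      nlinarith
    -- If no functional on the net exceeds `t`, then both errors are small in norm, and the failure
    -- probability of the deterministic solver is `0`.
    push Not at h1 h2
    have hEn := opNorm_le_of_net hnet ht h1
    have hfn : ‖f‖ ≤ 4 * t := (norm_le_of_net hnet ht h2).trans (by linarith)
    obtain ⟨hunit, hsol⟩ := hP E f hEn hfn
    have hW : G + μ • 1 + E = m'.matW M := by simp only [E]; abel
    have hQ : g + f = WithLp.toLp 2 (m'.vecQ M) := by simp only [f]; abel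
    rw [hW] at hunit hsol
    rw [hQ] at hsol
    refine le_trans (Spec.wp_le (t := ⌈C * ((M : ℝ) ^ 3 + 1)⌉₊) (K := 0)
      (Q := fun m'' => m''.vecX M = (m'.matW M)⁻¹.mulVec (m'.vecQ M))
      (fun r hr => ⟨?_, (hsolve.2 n circ m' M hM' r hr).2 hunit⟩) fun m'' h => ?_) zero_le
    · exact_mod_cast ((hsolve.2 n circ m' M hM' r hr).1.trans (Nat.le_ceil _))
    · rw [if_pos]
      refine hsol _ ?_
      rw [Matrix.toLpLin_toLp, Matrix.toLin'_apply, h, Matrix.mulVec_mulVec,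
        Matrix.mul_nonsing_inv _ hunit, Matrix.one_mulVec]
  have hψ : ∀ p, wp circ (.seq computeW computeQ) (ψ p) m ≤ 1 := fun p =>
    wp_estimates_le hS0 hbias _ _ hm
  have hφ : ∀ u, wp circ (.seq computeW computeQ) (φ u) m ≤ 1 := fun u =>
    wp_estimates_le hS0 hbias _ _ hm
  rw [hassoc]
  calc _ ≤ wp circ (.seq computeW computeQ)
        (fun m' => (∑ p ∈ net ×ˢ net, q * ψ p m') + ∑ u ∈ net, q * φ u m') m :=
        hspec.wp_mono hbound
    _ = (∑ p ∈ net ×ˢ net, q * wp circ (.seq computeW computeQ) (ψ p) m)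
        + ∑ u ∈ net, q * wp circ (.seq computeW computeQ) (φ u) m := by
        simp only [wp, expect_add, expect_sum, expect_const_mul]
    _ ≤ (∑ p ∈ net ×ˢ net, q) + ∑ u ∈ net, q :=
        add_le_add (Finset.sum_le_sum fun p _ => mul_le_of_le_one_right' (hψ p))
          (Finset.sum_le_sum fun u _ => mul_le_of_le_one_right' (hφ u))
    _ ≤ _ := by
        rw [Finset.sum_const, Finset.sum_const, Finset.card_product, ← add_smul, nsmul_eq_mul, hq,
          ← ENNReal.ofReal_natCast, ← ENNReal.ofReal_mul (Nat.cast_nonneg _)]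
        refine ENNReal.ofReal_le_ofReal (mul_le_mul_of_nonneg_right ?_ (Real.exp_pos _).le)
        have h3 : (net.card : ℝ) ≤ 25 ^ M := by exact_mod_cast hcard
        have h4 : (1 : ℝ) ≤ 25 ^ M := one_le_pow₀ (by norm_num)
        have h5 : (625 : ℝ) ^ M = 25 ^ M * 25 ^ M := by rw [← mul_pow]; norm_num
        have h6 : (net.card : ℝ) * net.card ≤ 25 ^ M * 25 ^ M :=
          mul_le_mul h3 h3 (Nat.cast_nonneg _) (by positivity)
        push_cast
        rw [h5]
        nlinarith

end

/-! ### Analysis of the algorithm -/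

theorem IsLinearSolver.mono {solve : Cmd} {C C' : ℝ} (h : IsLinearSolver solve C) (hC : C ≤ C') :
    IsLinearSolver solve C' :=
  ⟨h.1, fun n circ m M hM r hr => ⟨(h.2 n circ m M hM r hr).1.trans
    (mul_le_mul_of_nonneg_right hC (by positivity)), (h.2 n circ m M hM r hr).2⟩⟩

theorem IsHadamardCompiler.mono {comp : ∀ n : ℕ, Circuit n → Circuit n → Part → Circuit (n + 1)}
    {C C' : ℝ} (h : IsHadamardCompiler comp C) (hC : C ≤ C') : IsHadamardCompiler comp C' :=
  fun n c₁ c₂ p => ⟨(h n c₁ c₂ p).1, (h n c₁ c₂ p).2.trans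
    (mul_le_mul_of_nonneg_right hC (by positivity))⟩

/-- The exponent supplies `(δ / 2) ^ (11 M)`. Ten of the eleven powers beat the net, since `625 < 2
^ 10`, and the last one gives `δ`. -/
theorem tail_le {M : ℕ} (hM : 0 < M) {δ x : ℝ} (h0 : 0 < δ) (h1 : δ < 1)
    (hx : 11 * M * Real.log (2 / δ) ≤ x) : 2 * 625 ^ M * Real.exp (-x) ≤ δ := by
  have e : Real.exp (-(11 * M * Real.log (2 / δ))) = ((δ / 2) ^ 11) ^ M := by
    rw [← pow_mul, ← Real.exp_log (show 0 < δ / 2 by positivity), ← Real.exp_nat_mul,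
      ← inv_div 2 δ, Real.log_inv]
    congr 1
    push_cast
    ring
  have h2 : (625 : ℝ) * (δ / 2) ^ 11 ≤ δ / 2 := by
    have h3 : (δ / 2) ^ 10 ≤ (1 / 2) ^ 10 := pow_le_pow_left₀ (by positivity) (by linarith) _
    have h4 : (δ / 2) ^ 11 = (δ / 2) ^ 10 * (δ / 2) := pow_succ _ _
    rw [h4]
    norm_num at h3 ⊢
    nlinarith
  calc 2 * 625 ^ M * Real.exp (-x) ≤ 2 * 625 ^ M * ((δ / 2) ^ 11) ^ M := by
        rw [← e]
        exact mul_le_mul_of_nonneg_left (Real.exp_le_exp.2 (by linarith)) (by positivity)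
    _ = 2 * (625 * (δ / 2) ^ 11) ^ M := by rw [mul_pow]; ring
    _ ≤ 2 * (δ / 2) ^ M := by gcongr
    _ ≤ 2 * (δ / 2) := by
        have := pow_le_of_le_one (show 0 ≤ δ / 2 by positivity) (by linarith) hM.ne'
        linarith
    _ = δ := by ring

/-- The value `s = t T / 4` maximizes `s t - 2 s² / T`, and `Γ² / S ≤ 1 / T`. -/
theorem exponent_ge {Γ T S t : ℝ} (hT : 0 < T) (hS : Γ ^ 2 * T ≤ S) (hS0 : 0 < S) :
    t ^ 2 * T / 8 ≤ t * T / 4 * t - 2 * (t * T / 4) ^ 2 * Γ ^ 2 / S := by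
  have h : 2 * (t * T / 4) ^ 2 * Γ ^ 2 / S ≤ t ^ 2 * T / 8 := by
    rw [div_le_iff₀ hS0]
    have := mul_le_mul_of_nonneg_left hS (show 0 ≤ t ^ 2 * T / 8 by positivity)
    nlinarith
  nlinarith

section

variable {N M : ℕ} {A : Matrix (Fin N) (Fin M) ℂ} {b : EuclideanSpace ℂ (Fin N)}
  {nrm : Fin M → ℝ} {U : Fin M → Circuit (Nat.clog 2 N)} {nrmB : ℝ} {Ub : Circuit (Nat.clog 2 N)}
  {d : ℕ} {ε : ℝ}

theorem ColumnAccess.norm_eq (h : ColumnAccess A nrm U d) (j : Fin M) : nrm j = ‖column A j‖ :=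
  norm_eq_of_pad (h.nonneg j) (h.column_eq j)

theorem VectorAccess.norm_eq (h : VectorAccess b nrmB Ub d) : nrmB = ‖b‖ :=
  norm_eq_of_pad h.pos.le h.vector_eq

theorem normAt_coe (j : Fin M) : normAt nrm nrmB j = nrm j := by simp [normAt]

theorem normAt_self : normAt nrm nrmB M = nrmB := by simp [normAt]

theorem pos_of_ne_zero (hA : A ≠ 0) : 0 < M := by
  rcases M.eq_zero_or_pos with rfl | h
  · exact absurd (Matrix.ext fun _ j => j.elim0) hA
  · exact h

theorem runningMax_eq_Gamma1 (hM : 0 < M) (hU : ColumnAccess A nrm U d)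
    (hb : VectorAccess b nrmB Ub d) : runningMax (normAt nrm nrmB) M M = Gamma1 A b := by
  rw [runningMax_eq_iSup hM, Gamma1]
  simp only [normAt_coe, normAt_self, hU.norm_eq, hb.norm_eq]

theorem max_le_Gamma1 (j : Fin M) : max (‖column A j‖ * ‖b‖) (‖column A j‖ ^ 2) ≤ Gamma1 A b :=
  le_ciSup (f := fun j : Fin M => max (‖column A j‖ * ‖b‖) (‖column A j‖ ^ 2))
    (Set.finite_range _).bddAbove j

theorem Gamma1_pos (hA : A ≠ 0) : 0 < Gamma1 A b := by
  obtain ⟨j, hj⟩ : ∃ j, column A j ≠ 0 := by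
    by_contra! h
    exact hA (Matrix.ext fun i j => congrArg (fun v : EuclideanSpace ℂ (Fin N) => v i) (h j))
  exact (pow_pos (norm_pos_iff.2 hj) 2).trans_le ((le_max_right _ _).trans (max_le_Gamma1 j))

/-- Products of two different column norms do not occur in `Γ₁`; they are bounded through the
squares. -/
theorem abs_mul_normAt_le (hU : ColumnAccess A nrm U d) (hb : VectorAccess b nrmB Ub d) {j k : ℕ}
    (hj : j < M) (hk : k ≤ M) : |normAt nrm nrmB j * normAt nrm nrmB k| ≤ Gamma1 A b := by
  have h : ∀ i : Fin M, ‖column A i‖ * ‖b‖ ≤ Gamma1 A b ∧ ‖column A i‖ ^ 2 ≤ Gamma1 A b := fun i =>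
    max_le_iff.1 (max_le_Gamma1 i)
  rw [show normAt nrm nrmB j = ‖column A ⟨j, hj⟩‖ from (normAt_coe ⟨j, hj⟩).trans (hU.norm_eq _)]
  rcases hk.lt_or_eq with hk | rfl
  · rw [show normAt nrm nrmB k = ‖column A ⟨k, hk⟩‖ from (normAt_coe ⟨k, hk⟩).trans (hU.norm_eq _),
      abs_of_nonneg (by positivity)]
    nlinarith [(h ⟨j, hj⟩).2, (h ⟨k, hk⟩).2, sq_nonneg (‖column A ⟨j, hj⟩‖ - ‖column A ⟨k, hk⟩‖)]
  · rw [normAt_self, hb.norm_eq, abs_of_nonneg (by positivity)]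
    exact (h _).1

/-- The circuit number `e`. -/
def circuitAt {n : ℕ} (U : Fin M → Circuit n) (Ub : Circuit n) (e : ℕ) : Circuit n :=
  if h : e < M then U ⟨e, h⟩ else Ub

theorem circuitAt_coe {n : ℕ} (U : Fin M → Circuit n) (Ub : Circuit n) (j : Fin M) :
    circuitAt U Ub j = U j := by simp [circuitAt]

theorem circuitAt_self {n : ℕ} (U : Fin M → Circuit n) (Ub : Circuit n) :
    circuitAt U Ub M = Ub := by simp [circuitAt]

variable {comp : ∀ n : ℕ, Circuit n → Circuit n → Part → Circuit (n + 1)}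

theorem hasBias_testCircuit {C : ℝ} (hcomp : IsHadamardCompiler comp C) {n : ℕ}
    (U : Fin M → Circuit n) (Ub : Circuit n) (e f : ℕ) (p : Part) :
    HasBias (testCircuit comp U Ub e f p)
      (p.value (overlap (circuitAt U Ub e) (circuitAt U Ub f))) :=
  hasBias_hadamardTest (mul_mem (conjTranspose_mem_unitaryGroup (circuitAt U Ub e).unitary.2)
    (circuitAt U Ub f).unitary.2) (hcomp n _ _ p).1

/-- A circuit has at most depth times number of qubits many gates, so a test has at most `7 (2 d n +
1)` with `n = ⌈log₂ N⌉`. -/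
theorem size_testCircuit_le (hcomp : IsHadamardCompiler comp 7) (hU : ColumnAccess A nrm U d)
    (hb : VectorAccess b nrmB Ub d) (e f : ℕ) (p : Part) :
    (testCircuit comp U Ub e f p).size ≤ 14 * (1 + d * Nat.clog 2 N) := by
  have hs : ∀ e, (circuitAt U Ub e).size ≤ d * Nat.clog 2 N := fun e => by
    refine (Circuit.size_le _).trans (Nat.mul_le_mul_right _ ?_)
    rw [circuitAt]
    split_ifs
    exacts [hU.depth_le _, hb.depth_le]
  have h := (hcomp _ (circuitAt U Ub e) (circuitAt U Ub f) p).2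
  have h' : (testCircuit comp U Ub e f p).size ≤
      7 * ((circuitAt U Ub e).size + (circuitAt U Ub f).size + 1) := by exact_mod_cast h
  have := hs e
  have := hs f
  omega

theorem run_hybridAlgorithm {n : ℕ} {circ : ℕ → ℕ → Part → Circuit (n + 1)} {solve : Cmd} {m : Mem} :
    run circ (hybridAlgorithm solve) m
      = run circ (.seq preprocessing (.seq computeW (.seq computeQ solve))) m := by
  rw [preprocessing, run_seq_assoc, hybridAlgorithm, run, run]
  congr 1
  funext r
  rw [run_seq_assoc]

/-- Every run of the algorithm is short. -/
theorem spec_hybridAlgorithm {solve : Cmd} {C : ℝ} (hsolve : IsLinearSolver solve C)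
    (hcomp : IsHadamardCompiler comp 7) (hU : ColumnAccess A nrm U d)
    (hb : VectorAccess b nrmB Ub d) (ρ : ℝ) :
    Spec (testCircuit comp U Ub) (hybridAlgorithm solve) (initMem A b nrm nrmB ε ρ)
      (M * 60 + repetitions A b nrm nrmB ε ρ + 200 +
        (M * (M * (repetitions A b nrm nrmB ε ρ * (2 * (14 * (1 + d * Nat.clog 2 N)) + 60) + 40)
            + 20) + 5 +
          (M * (repetitions A b nrm nrmB ε ρ * (2 * (14 * (1 + d * Nat.clog 2 N)) + 60) + 40) + 5 +
            ⌈C * ((M : ℝ) ^ 3 + 1)⌉₊))) fun _ => True := by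
  have hs : ∀ m : Mem, m.nat rM = M →
      Spec (testCircuit comp U Ub) solve m ⌈C * ((M : ℝ) ^ 3 + 1)⌉₊ fun _ => True := fun m hm r hr =>
    ⟨by exact_mod_cast ((hsolve.2 _ _ m M hm r hr).1.trans (Nat.le_ceil _)), trivial⟩
  have h : Spec (testCircuit comp U Ub) (.seq preprocessing (.seq computeW (.seq computeQ solve)))
      (initMem A b nrm nrmB ε ρ) _ fun _ => True :=
    (spec_preprocessing A b nrm nrmB ε ρ).seq fun m hm =>
      (spec_computeW hm.rM hm.rS (size_testCircuit_le hcomp hU hb)).seq fun m₁ h₁ =>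
        (spec_computeQ h₁.1 h₁.2 (size_testCircuit_le hcomp hU hb)).seq hs
  rw [Spec] at h ⊢
  rwa [run_hybridAlgorithm]

theorem repetitionFactor_pos (hA : A ≠ 0) (hb : 0 < nrmB) (hε : 0 < ε) {ρ : ℝ} (hρ : 0 < ρ) :
    0 < repetitionFactor A b nrmB ε ρ := by
  have hM : (0 : ℝ) < M := Nat.cast_pos.2 (pos_of_ne_zero hA)
  have ha : 0 < ‖A‖ := norm_pos_iff.2 hA
  have hp : 0 < ‖pinv A‖ := by
    refine (norm_nonneg _).lt_of_ne fun h => ?_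
    have := one_le_condNumber hA
    rw [← h, mul_zero] at this
    linarith
  rw [repetitionFactor]
  positivity

open Classical in
/-- The output is rarely bad. -/
theorem wp_hybridAlgorithm_le {solve : Cmd} {C : ℝ} (hsolve : IsLinearSolver solve C)
    (hcomp : IsHadamardCompiler comp 7) (hA : A ≠ 0) (hU : ColumnAccess A nrm U d)
    (hb : VectorAccess b nrmB Ub d) (hε : 0 < ε) {δ : ℝ} (h0 : 0 < δ) (h1 : δ < 1) :
    wp (testCircuit comp U Ub) (hybridAlgorithm solve)
      (fun m => if IsApproxSolution A b ε (WithLp.toLp 2 (m.vecX M)) then 0 else 1)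
      (initMem A b nrm nrmB ε (360448 * Real.log (2 / δ))) ≤ ENNReal.ofReal δ := by
  have hl : 0 < Real.log (2 / δ) := Real.log_pos (by rw [lt_div_iff₀ h0]; linarith)
  set ρ := 360448 * Real.log (2 / δ) with hρ
  have hM := pos_of_ne_zero hA
  have hκ := one_le_condNumber hA
  have hT := repetitionFactor_pos (b := b) hA hb.pos hε (ρ := ρ) (by positivity)
  set T := repetitionFactor A b nrmB ε ρ with hTdef
  set S := repetitions A b nrm nrmB ε ρ with hS
  have hSle : Gamma1 A b ^ 2 * T ≤ S := by
    rw [hS, repetitions, runningMax_eq_Gamma1 hM hU hb]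
    exact Nat.le_ceil _
  have hΓ := Gamma1_pos (b := b) hA
  have hS0 : (0 : ℝ) < S := lt_of_lt_of_le (by positivity) hSle
  have hbpos : 0 < ‖b‖ := hb.norm_eq ▸ hb.pos
  have ha : 0 < ‖A‖ := norm_pos_iff.2 hA
  have hp : 0 < ‖pinv A‖ := by
    refine (norm_nonneg _).lt_of_ne fun h => ?_
    rw [← h, mul_zero] at hκ
    linarith
  set τ := ε ^ 2 / (16 * ‖pinv A‖ ^ 2 * condNumber A ^ 2 * ‖b‖ *
      (‖A‖ * (‖optSol A b‖ + 1) + ε)) with hτ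
  have hτ0 : 0 < τ := by
    rw [hτ, condNumber]
    positivity
  have hassoc : ∀ F m, wp (testCircuit comp U Ub) (hybridAlgorithm solve) F m
      = wp (testCircuit comp U Ub) preprocessing
        (wp (testCircuit comp U Ub) (.seq computeW (.seq computeQ solve)) F) m := fun F m => by
    rw [← wp_seq, wp, wp, run_hybridAlgorithm]
  rw [hassoc]
  refine (spec_preprocessing A b nrm nrmB ε ρ).wp_le fun m hm => ?_
  refine (wp_failure_le (t := τ / 4) (s := τ / 4 * T / 4) (Γ := Gamma1 A b)
    (v := fun e f => overlap (circuitAt U Ub e) (circuitAt U Ub f))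
    (G := A.conjTranspose * A) (g := Matrix.toEuclideanLin A.conjTranspose b)
    hsolve (by exact_mod_cast hS0)
    (fun j _ k _ p => hasBias_testCircuit hcomp U Ub j k p)
    (fun j hj k hk => abs_mul_normAt_le hU hb hj hk) hm (size_testCircuit_le hcomp hU hb)
    (fun j k => ?_) (fun j => ?_) (by positivity) (by positivity) fun E f hE hf => ?_).trans
      (ENNReal.ofReal_le_ofReal (tail_le hM h0 h1 (le_trans (le_of_eq ?_)
        (exponent_ge hT hSle hS0))))
  · rw [normAt_coe, normAt_coe, circuitAt_coe, circuitAt_coe,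
      mul_overlap (hU.column_eq j) (hU.column_eq k), Matrix.mul_apply]
    rfl
  · rw [normAt_coe, normAt_self, circuitAt_coe, circuitAt_self,
      mul_overlap (hU.column_eq j) hb.vector_eq, Matrix.ofLp_toLpLin, Matrix.toLin'_apply]
    rfl
  · rw [mul_div_cancel₀ _ (by norm_num)] at hE hf
    exact perturbed_solution hA hbpos hε (by rw [shift, hb.norm_eq]) hτ hE hf
  -- Here `τ² T = ρ M / 256`, so with `t = τ / 4` the exponent `t² T / 8` is `ρ M / 32768`. It
  -- equals `11 M log (2 / δ)` for `ρ = 360448 log (2 / δ)`, as `360448 = 11 * 32768`.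
  · rw [hTdef, repetitionFactor, hτ, hρ, condNumber, hb.norm_eq]
    field_simp
    ring

end

/-- All sampling costs are dominated by `M² S D`. Replacing `S` by `X + 1` yields a multiple of `ℓ D
B` and an excess `M² D ≤ M³ D`. -/
theorem running_time_le {M S D : ℕ} {X B ℓ : ℝ} (hM : 0 < M) (hD : 0 < D) (hX : 0 ≤ X)
    (hS : (S : ℝ) ≤ X + 1) (hℓ : 1 / 2 ≤ ℓ) (hB : (M : ℝ) ^ 2 * X = 360448 * ℓ * B) :
    ((M * 60 + S + 200 + (M * (M * (S * (2 * (14 * D) + 60) + 40) + 20) + 5 +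
      (M * (S * (2 * (14 * D) + 60) + 40) + 5 + ⌈300 * ((M : ℝ) ^ 3 + 1)⌉₊)) : ℕ) : ℝ) ≤
      10 ^ 8 * ℓ * D * (B + (M : ℝ) ^ 3) := by
  have hm : (1 : ℝ) ≤ M := by exact_mod_cast hM
  have hd : (1 : ℝ) ≤ D := by exact_mod_cast hD
  have hc : (⌈300 * ((M : ℝ) ^ 3 + 1)⌉₊ : ℝ) ≤ 300 * ((M : ℝ) ^ 3 + 1) + 1 :=
    (Nat.ceil_lt_add_one (by positivity)).le
  have m2 : (M : ℝ) ≤ (M : ℝ) ^ 2 := le_self_pow₀ hm (by norm_num)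
  have m3 : (M : ℝ) ^ 2 ≤ (M : ℝ) ^ 3 := pow_le_pow_right₀ hm (by norm_num)
  have hS0 : (0 : ℝ) ≤ S := Nat.cast_nonneg S
  have hB0 : 0 ≤ B := by
    by_contra! h
    have : 0 ≤ (M : ℝ) ^ 2 * X := by positivity
    nlinarith [mul_neg_of_pos_of_neg (show 0 < 360448 * ℓ by linarith) h]
  push_cast
  set m := (M : ℝ)
  set s := (S : ℝ)
  set D' := (D : ℝ)
  have hsD : 0 ≤ s * D' := by positivity
  have hms : s ≤ s * D' := le_mul_of_one_le_right hS0 hd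
  have h1 : m * (s * D') ≤ m ^ 2 * (s * D') := mul_le_mul_of_nonneg_right m2 hsD
  have h2 : s * D' ≤ m ^ 2 * (s * D') := le_mul_of_one_le_left hsD (hm.trans m2)
  have h3 : m ^ 2 * s ≤ m ^ 2 * (s * D') := mul_le_mul_of_nonneg_left hms (by positivity)
  have h4 : m * s ≤ m ^ 2 * s := mul_le_mul_of_nonneg_right m2 hS0
  have h5 : m ^ 2 * (s * D') ≤ D' * (360448 * ℓ * B + m ^ 3) := by
    rw [← hB]
    have : m ^ 2 * s ≤ m ^ 2 * X + m ^ 3 := by nlinarith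
    nlinarith
  have h6 : m ^ 3 ≤ D' * m ^ 3 := le_mul_of_one_le_left (by positivity) hd
  -- The terms not proportional to `ℓ` are absorbed because `ℓ` is bounded away from `0`.
  have h7 : D' * m ^ 3 ≤ 2 * ℓ * (D' * m ^ 3) :=
    le_mul_of_one_le_left (by positivity) (by linarith)
  have h8 : 0 ≤ ℓ * D' * B := by
    have : 0 ≤ ℓ := by linarith
    positivity
  nlinarith

theorem repetitions_identity {N M : ℕ} (A : Matrix (Fin N) (Fin M) ℂ)
    (b : EuclideanSpace ℂ (Fin N)) (ε ρ : ℝ) :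
    (M : ℝ) ^ 2 * (Gamma1 A b ^ 2 * repetitionFactor A b ‖b‖ ε ρ) = ρ * timeTerm A b ε := by
  rw [repetitionFactor, timeTerm, condNumber]
  ring

end HybridLS

end

/-! ### Accuracy and running time combined. -/

theorem mainTheorem1 :
    ∃ (solve : Cmd) (comp : ∀ n : ℕ, Circuit n → Circuit n → Part → Circuit (n + 1)) (c C : ℝ),
      0 < c ∧ 0 < C ∧ IsLinearSolver solve C ∧ IsHadamardCompiler comp C ∧
      ∀ (N M : ℕ) (A : Matrix (Fin N) (Fin M) ℂ) (b : EuclideanSpace ℂ (Fin N))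
        (nrm : Fin M → ℝ) (U : Fin M → Circuit (Nat.clog 2 N))
        (nrmB : ℝ) (Ub : Circuit (Nat.clog 2 N)) (d : ℕ) (ε δ : ℝ),
        A ≠ 0 → ColumnAccess A nrm U d → VectorAccess b nrmB Ub d →
        0 < ε → 0 < δ → δ < 1 →
        -- correctness with high probability
        ENNReal.ofReal (1 - δ) ≤
          (runAlgorithm solve comp A b nrm U nrmB Ub ε (c * Real.log (2 / δ))).toOuterMeasure
            {r | IsApproxSolution A b ε r.1} ∧
        -- running time, in every run
        ∀ r ∈ (runAlgorithm solve comp A b nrm U nrmB Ub ε (c * Real.log (2 / δ))).support,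
          (r.2 : ℝ) ≤ C * Real.log (2 / δ) * (1 + d * Nat.clog 2 N) *
            (timeTerm A b ε + (M : ℝ) ^ 3) ∧
          ((M : ℝ) ^ 3 ≤ timeTerm A b ε →
            (r.2 : ℝ) ≤ C * Real.log (2 / δ) * (1 + d * Nat.clog 2 N) * timeTerm A b ε) := by
  obtain ⟨comp, hcomp⟩ := exists_hadamardCompiler
  -- The factor `2` is for the second time bound, where `B + M³ ≤ 2 B`. The constant also exceeds
  -- `300` for the solver and `7` for the compiler.
  refine ⟨solver, comp, 360448, 2 * 10 ^ 8, by norm_num, by norm_num,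
    isLinearSolver_solver.mono (by norm_num), hcomp.mono (by norm_num), ?_⟩
  intro N M A b nrm U nrmB Ub d ε δ hA hU hb hε h0 h1
  set p := runAlgorithm solver comp A b nrm U nrmB Ub ε (360448 * Real.log (2 / δ)) with hp
  constructor
  · classical
    have hbad : expect p (fun r => if IsApproxSolution A b ε r.1 then 0 else 1)
        ≤ ENNReal.ofReal δ := by
      rw [hp, runAlgorithm, expect_map]
      exact wp_hybridAlgorithm_le isLinearSolver_solver hcomp hA hU hb hε h0 h1
    have hsum : p.toOuterMeasure {r | IsApproxSolution A b ε r.1} +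
        expect p (fun r => if IsApproxSolution A b ε r.1 then 0 else 1) = 1 := by
      rw [PMF.toOuterMeasure_apply, expect, ← ENNReal.tsum_add, ← p.tsum_coe]
      refine tsum_congr fun r => ?_
      by_cases h : IsApproxSolution A b ε r.1 <;> simp [Set.indicator, h]
    rw [ENNReal.ofReal_sub _ h0.le, ENNReal.ofReal_one, tsub_le_iff_right, ← hsum]
    exact add_le_add_right hbad _
  · intro r hr
    have hM := pos_of_ne_zero hA
    -- Since `δ < 1`, the logarithm is at least `log 2`.
    have hlog : 1 / 2 ≤ Real.log (2 / δ) := by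
      have h2 : Real.log 2 ≤ Real.log (2 / δ) :=
        Real.log_le_log (by norm_num) (by rw [le_div_iff₀ h0]; linarith)
      linarith [Real.log_two_gt_d9]
    rw [hp, runAlgorithm, PMF.support_map] at hr
    obtain ⟨r', hr', rfl⟩ := hr
    have ht := (spec_hybridAlgorithm isLinearSolver_solver hcomp hU hb _ r' hr').1
    have hT := (repetitionFactor_pos (b := b) hA hb.pos hε
      (ρ := 360448 * Real.log (2 / δ)) (by linarith)).le
    have hS : (repetitions A b nrm nrmB ε (360448 * Real.log (2 / δ)) : ℝ) ≤
        Gamma1 A b ^ 2 * repetitionFactor A b nrmB ε (360448 * Real.log (2 / δ)) + 1 := by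
      rw [repetitions, runningMax_eq_Gamma1 hM hU hb]
      exact (Nat.ceil_lt_add_one (by positivity)).le
    have hB := repetitions_identity A b ε (360448 * Real.log (2 / δ))
    rw [← hb.norm_eq] at hB
    have key : (r'.2 : ℝ) ≤ 10 ^ 8 * Real.log (2 / δ) * (1 + d * Nat.clog 2 N) *
        (timeTerm A b ε + (M : ℝ) ^ 3) := by
      refine (Nat.cast_le.2 ht).trans ?_
      exact_mod_cast running_time_le (D := 1 + d * Nat.clog 2 N) hM (by omega) (by positivity) hS
        hlog hB
    have hpos : 0 ≤ 10 ^ 8 * Real.log (2 / δ) * (1 + d * Nat.clog 2 N : ℝ) := by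
      have : 0 ≤ Real.log (2 / δ) := by linarith
      positivity
    have hB0 : 0 ≤ timeTerm A b ε := by
      rw [timeTerm]
      positivity
    refine ⟨key.trans ?_, fun h => key.trans ?_⟩
    · nlinarith [mul_nonneg hpos (show 0 ≤ timeTerm A b ε + (M : ℝ) ^ 3 by positivity)]
    · nlinarith [mul_le_mul_of_nonneg_left h hpos]
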